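/- **Conventions.** For elements $x,y$ of a group put $[x,y]=xyx^{-1}y^{-1}$; $o(x)$ is the order of $x$. The monolith $\operatorname{mon}(G)$ of a finite group $G$ is the intersection of all its non-trivial normal subgroups, and $G$ is monolithic if $\operatorname{mon}(G)\neq\{1\}$. A finite $p$-group is extra-special if its center is cyclic of order $p$ and the quotient by the center is a non-trivial elementary abelian $p$-group. An extra-special quotient of order $32$ of $G$ is a quotient $G/N$, with $N$ normal in $G$, which is an extra-special group of order $32$; it is called unique if there is exactly one such $N$. **Structures.** Let $b,n\ge 2$. A diagonal double Kodaira structure of type $(b,n)$ on $G$ is an ordered set of $4b+1$ generators $$(r_{11},t_{11},\dots,r_{1b},t_{1b},\;r_{21},t_{21},\dots,r_{2b},t_{2b},\;z)$$ of $G$, with $o(z)=n$, satisfying the surface relations $$[r_{1b}^{-1},t_{1b}^{-1}]t_{1b}^{-1}\cdots[r_{11}^{-1},t_{11}^{-1}]t_{11}^{-1}\,(t_{11}t_{12}\cdots t_{1b})=z,$$ $$[r_{21}^{-1},t_{21}]t_{21}\cdots[r_{2b}^{-1},t_{2b}]t_{2b}\,(t_{2b}^{-1}\cdots t_{21}^{-1})=z^{-1},$$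 and, for all $j,k\in\{1,\dots,b\}$, the conjugacy relations - $[r_{1j},r_{2k}]=1$ if $j\le k$, and $[r_{1j},r_{2k}]=z^{-1}r_{2k}r_{2j}^{-1}z\,r_{2j}r_{2k}^{-1}$ if $j>k$; - $[r_{1j},t_{2k}]=1$ if $j<k$, $[r_{1j},t_{2j}]=z^{-1}$, and $[r_{1j},t_{2k}]=[z^{-1},t_{2k}]$ if $j>k$; - $[r_{1j},z]=[r_{2j}^{-1},z]$; - $[t_{1j},r_{2k}]=1$ if $j<k$, $[t_{1j},r_{2j}]=t_{2j}^{-1}z\,t_{2j}$, and $[t_{1j},r_{2k}]=[t_{2j}^{-1},z]$ if $j>k$; - $[t_{1j},t_{2k}]=1$ if $j<k$, $[t_{1j},t_{2j}]=[t_{2j}^{-1},z]$, and $[t_{1j},t_{2k}]=t_{2j}^{-1}z\,t_{2j}z^{-1}t_{2k}z\,t_{2j}^{-1}z^{-1}t_{2j}t_{2k}^{-1}$ if $j>k$; - $[t_{1j},z]=[t_{2j}^{-1},z]$. A prestructure of type $n\ge 2$ on $G$ is an ordered set of nine elements $(r_{11},t_{11},r_{12},t_{12},r_{21},t_{21},r_{22},t_{22},z)$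 of $G$, with $o(z)=n$, satisfying the conjugacy relations for $b=2$ (neither the surface relations nor generation of $G$ is required). The group $\operatorname{Aut}(G)$ acts componentwise on these objects. **Groups.** $G(m,t)$ denotes the $t$-th group of order $m$ in the GAP4 small groups library. Explicitly, the groups below have the following presentations, where all commutators $[x_i,x_j]$, $i<j$, that are not listed are trivial. $G(32,49)$ and $G(32,50)$ are generated by $x_1,\dots,x_5$, with $[x_1,x_2]=[x_2,x_3]=[x_1,x_4]=x_5$ and $x_5^2=1$; for $G(32,49)$ also $x_1^2=x_2^2=x_3^2=x_4^2=1$, and for $G(32,50)$ also $x_1^2=x_4^2=1$, $x_2^2=x_3^2=x_5$. The groups $G(96,224)$ and $G(96,225)$ have one more generator $x_6$, with $x_6^3=1$ and $x_6$ central, and otherwise the relations of $G(32,49)$ and $G(32,50)$ respectively. The groups $G(96,211)$, $G(96,214)$, $G(96,216)$, $G(96,217)$ are generated by $x_1,\dots,x_6$, with $[x_2,x_3]=[x_1,x_4]=x_5$, $[x_1,x_6]=x_6$, $x_5^2=x_6^3=1$, $x_1^2=1$, and $(x_2^2,x_3^2,x_4^2)$ equal to $(1,1,1)$, $(x_5,x_5,1)$,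 $(1,1,x_5)$, $(x_5,x_5,x_5)$ respectively. **Proposition 5.6.** Let $G$ be a non-monolithic group of order $96$ that admits a prestructure of type $n$. Then $n=2$, and $G$ has a unique extra-special quotient $H$ of order $32$. Up to isomorphism, the pairs $(G,H)$ that occur are exactly the following six, with the following numbers of prestructures on $G$ and of diagonal double Kodaira structures of type $(2,2)$ on $G$, both counted up to the action of $\operatorname{Aut}(G)$: | $G$ | $H$ | prestructures | structures of type $(2,2)$ | |---|---|---|---| | $G(96,211)$ | $G(32,49)$ | $40320$ | $0$ | | $G(96,216)$ | $G(32,49)$ | $26880$ | $0$ | | $G(96,224)$ | $G(32,49)$ | $14698880$ | $6297600$ | | $G(96,214)$ | $G(32,50)$ | $13440$ | $0$ | | $G(96,217)$ | $G(32,50)$ | $26880$ | $0$ | | $G(96,225)$ | $G(32,50)$ | $8819328$ | $3778560$ | None of these six groups admits a diagonal double Kodaira structure of type $(b,n)$ with $b\ge 3$. In particular, among them only $G(96,224)$ and $G(96,225)$ admit diagonal double Kodaira structures, and all of these are of type $(2,2)$. -/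

import Mathlib

open scoped commutatorElement

/-! ### Group theory: monoliths and extra-special groups -/

/-- The monolith of a group: the intersection of all its non-trivial normal subgroups. -/
def monolith (G : Type*) [Group G] : Subgroup G :=
  sInf {N : Subgroup G | N.Normal ∧ N ≠ ⊥}

/-- A group is monolithic if its monolith is non-trivial. -/
def IsMonolithic (G : Type*) [Group G] : Prop :=
  monolith G ≠ ⊥

/-- A finite `p`-group is extra-special if its center is cyclic of order `p` and the quotient by
the center is a non-trivial elementary abelian `p`-group. -/
def IsExtraSpecial (G : Type*) [Group G] : Prop :=
  Finite G ∧ ∃ p : ℕ, p.Prime ∧ IsPGroup p G ∧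
    IsCyclic (Subgroup.center G) ∧ Nat.card (Subgroup.center G) = p ∧
    Nontrivial (G ⧸ Subgroup.center G) ∧
    (∀ x y : G ⧸ Subgroup.center G, x * y = y * x) ∧
    (∀ x : G ⧸ Subgroup.center G, x ^ p = 1)

/-- `N` is a normal subgroup of `G` whose quotient `G ⧸ N` is extra-special of order `32`. -/
def HasExtraSpecialQuotient32 {G : Type*} [Group G] (N : Subgroup G) : Prop :=
  ∃ _ : N.Normal, IsExtraSpecial (G ⧸ N) ∧ Nat.card (G ⧸ N) = 32

/-- `N` is a normal subgroup of `G` whose quotient `G ⧸ N` is isomorphic to `H`. -/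
def QuotientIsoTo {G : Type*} [Group G] (N : Subgroup G) (H : Type*) [Group H] : Prop :=
  ∃ _ : N.Normal, Nonempty (G ⧸ N ≃* H)

/-! ### Diagonal double Kodaira structures and prestructures -/

/-- An ordered set of `4 * b + 1` elements
`(r₁₁, t₁₁, …, r₁b, t₁b, r₂₁, t₂₁, …, r₂b, t₂b, z)` of `G`.
The second index runs over `Fin b`, so that it is shifted by one. -/
@[ext]
structure KodairaTuple (b : ℕ) (G : Type*) where
  r₁ : Fin b → G
  t₁ : Fin b → G
  r₂ : Fin b → G
  t₂ : Fin b → G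
  z : G

namespace KodairaTuple

variable {b : ℕ} {G : Type*} [Group G]

/-- The componentwise action of `Aut(G)` on tuples of elements of `G`. -/
instance : MulAction (MulAut G) (KodairaTuple b G) where
  smul α S := ⟨fun j => α (S.r₁ j), fun j => α (S.t₁ j), fun j => α (S.r₂ j),
    fun j => α (S.t₂ j), α S.z⟩
  one_smul _ := rfl
  mul_smul _ _ _ := rfl

/-- The two surface relations. Here `⁅x, y⁆ = x * y * x⁻¹ * y⁻¹`. -/
structure SurfaceRelations (S : KodairaTuple b G) : Prop where
  first :
    ((List.finRange b).reverse.map fun j => ⁅(S.r₁ j)⁻¹, (S.t₁ j)⁻¹⁆ * (S.t₁ j)⁻¹).prod *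
      ((List.finRange b).map fun j => S.t₁ j).prod = S.z
  second :
    ((List.finRange b).map fun j => ⁅(S.r₂ j)⁻¹, S.t₂ j⁆ * S.t₂ j).prod *
      ((List.finRange b).reverse.map fun j => (S.t₂ j)⁻¹).prod = S.z⁻¹

/-- The relations giving the conjugacy action of the `r₁ⱼ` and of the `t₁ⱼ`. -/
structure ConjugacyRelations (S : KodairaTuple b G) : Prop where
  r_r_lt : ∀ j k, j < k → ⁅S.r₁ j, S.r₂ k⁆ = 1
  r_r_eq : ∀ j, ⁅S.r₁ j, S.r₂ j⁆ = 1
  r_r_gt : ∀ j k, k < j →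
    ⁅S.r₁ j, S.r₂ k⁆ = S.z⁻¹ * S.r₂ k * (S.r₂ j)⁻¹ * S.z * S.r₂ j * (S.r₂ k)⁻¹
  r_t_lt : ∀ j k, j < k → ⁅S.r₁ j, S.t₂ k⁆ = 1
  r_t_eq : ∀ j, ⁅S.r₁ j, S.t₂ j⁆ = S.z⁻¹
  r_t_gt : ∀ j k, k < j → ⁅S.r₁ j, S.t₂ k⁆ = ⁅S.z⁻¹, S.t₂ k⁆
  r_z : ∀ j, ⁅S.r₁ j, S.z⁆ = ⁅(S.r₂ j)⁻¹, S.z⁆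
  t_r_lt : ∀ j k, j < k → ⁅S.t₁ j, S.r₂ k⁆ = 1
  t_r_eq : ∀ j, ⁅S.t₁ j, S.r₂ j⁆ = (S.t₂ j)⁻¹ * S.z * S.t₂ j
  t_r_gt : ∀ j k, k < j → ⁅S.t₁ j, S.r₂ k⁆ = ⁅(S.t₂ j)⁻¹, S.z⁆
  t_t_lt : ∀ j k, j < k → ⁅S.t₁ j, S.t₂ k⁆ = 1
  t_t_eq : ∀ j, ⁅S.t₁ j, S.t₂ j⁆ = ⁅(S.t₂ j)⁻¹, S.z⁆
  t_t_gt : ∀ j k, k < j →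
    ⁅S.t₁ j, S.t₂ k⁆ = (S.t₂ j)⁻¹ * S.z * S.t₂ j * S.z⁻¹ * S.t₂ k * S.z *
      (S.t₂ j)⁻¹ * S.z⁻¹ * S.t₂ j * (S.t₂ k)⁻¹
  t_z : ∀ j, ⁅S.t₁ j, S.z⁆ = ⁅(S.t₂ j)⁻¹, S.z⁆

/-- The `4 * b + 1` elements of the tuple generate `G`. -/
def Generates (S : KodairaTuple b G) : Prop :=
  Subgroup.closure
    (Set.range S.r₁ ∪ Set.range S.t₁ ∪ Set.range S.r₂ ∪ Set.range S.t₂ ∪ {S.z}) = ⊤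

/-- The number of orbits of `Aut(G)` on the tuples satisfying `P` (where `P` is invariant under
`Aut(G)`). -/
noncomputable def numberUpToAut (P : KodairaTuple b G → Prop) : ℕ :=
  {O : Set (KodairaTuple b G) | ∃ S, P S ∧ O = MulAction.orbit (MulAut G) S}.ncard

end KodairaTuple

/-- A prestructure of type `n` on `G`: nine elements of `G`, with `z` of order `n ≥ 2`, which
satisfy all the relations of a diagonal double Kodaira structure of type `(2, n)` except the
surface relations, and which need not generate `G`. -/
structure IsPrestructure {G : Type*} [Group G] (n : ℕ) (S : KodairaTuple 2 G) : Prop where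
  two_le_type : 2 ≤ n
  order_z : orderOf S.z = n
  conjugacy : S.ConjugacyRelations

/-- A diagonal double Kodaira structure of type `(b, n)` on `G`, where `b, n ≥ 2`. -/
structure IsDiagonalDoubleKodairaStructure {G : Type*} [Group G] (b n : ℕ)
    (S : KodairaTuple b G) : Prop where
  two_le_genus : 2 ≤ b
  two_le_type : 2 ≤ n
  order_z : orderOf S.z = n
  generates : S.Generates
  surface : S.SurfaceRelations
  conjugacy : S.ConjugacyRelations

/-- `G` admits a prestructure of type `n`. -/
def AdmitsPrestructure (G : Type*) [Group G] (n : ℕ) : Prop :=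
  ∃ S : KodairaTuple 2 G, IsPrestructure n S

/-- `G` admits a diagonal double Kodaira structure of type `(b, n)`. -/
def AdmitsDiagonalDoubleKodairaStructure (G : Type*) [Group G] (b n : ℕ) : Prop :=
  ∃ S : KodairaTuple b G, IsDiagonalDoubleKodairaStructure b n S

/-- The number of prestructures (of any type) on `G` up to the action of `Aut(G)`. -/
noncomputable def numberOfPrestructures (G : Type*) [Group G] : ℕ :=
  KodairaTuple.numberUpToAut fun S : KodairaTuple 2 G => ∃ n, IsPrestructure n S

/-- The number of diagonal double Kodaira structures of type `(b, n)` on `G` up to the action of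
`Aut(G)`. -/
noncomputable def numberOfDiagonalDoubleKodairaStructures (G : Type*) [Group G] (b n : ℕ) : ℕ :=
  KodairaTuple.numberUpToAut fun S : KodairaTuple b G => IsDiagonalDoubleKodairaStructure b n S

/-! ### The small groups -/

namespace SmallGroups

/-- The `i`-th free generator; the generators are numbered from `0`, so that `x 0, x 1, …` are
`x₁, x₂, …` of the usual presentation. -/
abbrev x {m : ℕ} (i : Fin m) : FreeGroup (Fin m) := FreeGroup.of i

/-- The relators of a presentation by powers and commutators, namely
`xᵢ ^ (e i) = q i` for all `i`, and `⁅xᵢ, xⱼ⁆ = c i j` for all `i < j`. -/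
def relators {m : ℕ} (e : Fin m → ℕ) (q : Fin m → FreeGroup (Fin m))
    (c : Fin m → Fin m → FreeGroup (Fin m)) : Set (FreeGroup (Fin m)) :=
  {w | ∃ i, w = x i ^ e i * (q i)⁻¹} ∪ {w | ∃ i j, i < j ∧ w = ⁅x i, x j⁆ * (c i j)⁻¹}

/-- The non-trivial commutators `⁅x₁, x₂⁆ = ⁅x₂, x₃⁆ = ⁅x₁, x₄⁆ = x₅`. -/
def comm32 : Fin 5 → Fin 5 → FreeGroup (Fin 5)
  | 0, 1 => x 4
  | 1, 2 => x 4
  | 0, 3 => x 4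
  | _, _ => 1

/-- The non-trivial commutators `⁅x₂, x₃⁆ = ⁅x₁, x₄⁆ = x₅` and `⁅x₁, x₆⁆ = x₆`. -/
def comm96 : Fin 6 → Fin 6 → FreeGroup (Fin 6)
  | 1, 2 => x 4
  | 0, 3 => x 4
  | 0, 5 => x 5
  | _, _ => 1

/-- The non-trivial commutators `⁅x₁, x₂⁆ = ⁅x₂, x₃⁆ = ⁅x₁, x₄⁆ = x₅`, with `x₆` central. -/
def comm96' : Fin 6 → Fin 6 → FreeGroup (Fin 6)
  | 0, 1 => x 4
  | 1, 2 => x 4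
  | 0, 3 => x 4
  | _, _ => 1

/-- `G(32, 49)`, the extra-special group `H₅(ℤ/2)`. -/
abbrev G32_49 := PresentedGroup (relators ![2, 2, 2, 2, 2] ![1, 1, 1, 1, 1] comm32)

/-- `G(32, 50)`, the extra-special group `G₅(ℤ/2)`; here `x₂² = x₃² = x₅`. -/
abbrev G32_50 := PresentedGroup (relators ![2, 2, 2, 2, 2] ![1, x 4, x 4, 1, 1] comm32)

/-- `G(96, 211)`. -/
abbrev G96_211 := PresentedGroup (relators ![2, 2, 2, 2, 2, 3] ![1, 1, 1, 1, 1, 1] comm96)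

/-- `G(96, 214)`; here `x₂² = x₃² = x₅`. -/
abbrev G96_214 := PresentedGroup (relators ![2, 2, 2, 2, 2, 3] ![1, x 4, x 4, 1, 1, 1] comm96)

/-- `G(96, 216)`; here `x₄² = x₅`. -/
abbrev G96_216 := PresentedGroup (relators ![2, 2, 2, 2, 2, 3] ![1, 1, 1, x 4, 1, 1] comm96)

/-- `G(96, 217)`; here `x₂² = x₃² = x₄² = x₅`. -/
abbrev G96_217 := PresentedGroup (relators ![2, 2, 2, 2, 2, 3] ![1, x 4, x 4, x 4, 1, 1] comm96)

/-- `G(96, 224)`, isomorphic to `G(32, 49) × ℤ/3`. -/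
abbrev G96_224 := PresentedGroup (relators ![2, 2, 2, 2, 2, 3] ![1, 1, 1, 1, 1, 1] comm96')

/-- `G(96, 225)`, isomorphic to `G(32, 50) × ℤ/3`; here `x₂² = x₃² = x₅`. -/
abbrev G96_225 := PresentedGroup (relators ![2, 2, 2, 2, 2, 3] ![1, x 4, x 4, 1, 1, 1] comm96')

end SmallGroups

/-- `(G, H)` is an occurring pair: `G` is a non-monolithic group of order `96` which admits
prestructures and has an extra-special quotient of order `32`, and all such quotients are
isomorphic to `H`. Moreover `G` has `p` prestructures and `d` diagonal double Kodaira structures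
of type `(2, 2)` up to `Aut(G)`, and it has no diagonal double Kodaira structure of type `(b, n)`
with `b ≥ 3`. -/
structure IsTableRow (G H : Type*) [Group G] [Group H] (p d : ℕ) : Prop where
  card_eq : Nat.card G = 96
  not_monolithic : ¬ IsMonolithic G
  admits : AdmitsPrestructure G 2
  exists_quotient : ∃ N : Subgroup G, HasExtraSpecialQuotient32 N
  quotient_iso : ∀ N : Subgroup G, HasExtraSpecialQuotient32 N → QuotientIsoTo N H
  prestructures : numberOfPrestructures G = p
  structures : numberOfDiagonalDoubleKodairaStructures G 2 2 = d
  no_higher_genus : ∀ b n : ℕ, 3 ≤ b → ¬ AdmitsDiagonalDoubleKodairaStructure G b n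

/-! ### Central pairings -/

section CentralPairing

variable {G : Type*} [Group G] {ι : Type*} {z : G}

/-! Arrange a tuple with `b = 2` as two quadruples, `(r₁₁, t₁₁, r₁₂, t₁₂)` and `(t₂₁, r₂₁, t₂₂,
r₂₂)`. When `z` is central, the conjugacy relations say that entries in different positions of the
two quadruples commute and entries in the same position have commutator `z` or `z⁻¹`. Taking
commutators with the first quadruple then maps a subgroup of `G` onto a power of `⟨z⟩`, with `z` in
the kernel. So `o(z) ^ (2b + 1)` divides `|G|` (`orderOf_pow_dvd_card`), and if equality holds only
powers of `z` commute with the whole first quadruple (`mem_zpowers_of_commute_all`).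

A group of order dividing 48 has no prestructure (`z_eq_one_of_card_dvd`). In a minimal
counterexample the tuple generates and `z` lies in every non-trivial normal subgroup; the bound
prevents `z` from being central, so the center is trivial and a Sylow 2-subgroup has index 3. Unless
the order divides 6, that subgroup is normal and then abelian. In every case the group is abelian or
commuting is transitive on non-trivial elements, and both contradict the relations. Hence in order
32 the element `z` generates the center and the group is extra-special. In a non-monolithic group of
order 96, a normal subgroup that misses `z` has order 3; it is the only subgroup of that order, its
quotient is extra-special, and `z` is a central involution. The bound then excludes `b ≥ 3`, since
`2 ^ 7` does not divide 96.

By Schur–Zassenhaus such a group is a `ModelGroup`: it is given by a non-degenerate quadratic form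
on `𝔽₂⁴` and a linear character `f` describing the action on the subgroup of order 3. The first
quadruple of a prestructure lifts a basis of `𝔽₂⁴`, the second lifts the dual basis. Up to `Aut(G)`
a prestructure is therefore the coordinate description of `G` in that basis, a choice of the `2 ^ 4`
lifts of the dual basis, and eight components in `ℤ/3` up to a common sign (`exists_stdTuple`,
`stdTuple_injective`, `numberUpToAut_eq`).

If `f ≠ 0`, an inner automorphism removes the components in `ℤ/3`; the tuple then lies in a
complement and never generates. If `f = 0`, the components are arbitrary, which gives 3281 classes
up to sign; generation means that they do not all vanish, and both surface relations become `a₀ + a₅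
= 1`. It remains to count coordinate descriptions of each group. They are classified by the Arf
invariant, by whether `f` vanishes, and by the value of the quadratic form at the vector dual to
`f`. This gives six classes, whose sizes are found by finite evaluation. -/

theorem commute_of_mem_zpowers (hz : ∀ g, Commute z g) {x : G} (hx : x ∈ Subgroup.zpowers z)
    (g : G) : Commute x g := by
  obtain ⟨k, rfl⟩ := Subgroup.mem_zpowers_iff.mp hx
  exact (hz g).zpow_left k

theorem commutatorElement_mul_right_of_central (a g : G) {h : G}
    (hc : ∀ y, Commute ⁅a, h⁆ y) : ⁅a, g * h⁆ = ⁅a, g⁆ * ⁅a, h⁆ := by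
  have h1 : ⁅a, g * h⁆ = ⁅a, g⁆ * (g * ⁅a, h⁆ * g⁻¹) := by
    simp only [commutatorElement_def]; group
  rw [h1, ← (hc g).eq, mul_inv_cancel_right]

/-- The elements whose commutators with all `a i` are powers of the central element `z`. -/
def commutatorStabilizer (hz : ∀ g, Commute z g) (a : ι → G) : Subgroup G where
  carrier := {g | ∀ i, ⁅a i, g⁆ ∈ Subgroup.zpowers z}
  one_mem' i := by simp
  mul_mem' {g h} hg hh i := by
    rw [commutatorElement_mul_right_of_central _ _ (commute_of_mem_zpowers hz (hh i))]
    exact mul_mem (hg i) (hh i)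
  inv_mem' {g} hg i := by
    have h := commute_of_mem_zpowers hz (hg i)
    have h1 : ⁅a i, g⁻¹⁆ = g⁻¹ * ⁅a i, g⁆⁻¹ * g := by simp only [commutatorElement_def]; group
    have h2 : ⁅a i, g⁻¹⁆ = ⁅a i, g⁆⁻¹ := by
      rw [h1, ← ((h g⁻¹).inv_left).eq, inv_mul_cancel_right]
    rw [h2]
    exact inv_mem (hg i)

/-- The homomorphism `g ↦ (⁅a i, g⁆)ᵢ`. -/
def commutatorPairing (hz : ∀ g, Commute z g) (a : ι → G) :
    commutatorStabilizer hz a →* (ι → Subgroup.zpowers z) where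
  toFun g i := ⟨⁅a i, (g : G)⁆, g.2 i⟩
  map_one' := by ext i; simp
  map_mul' g h := by
    ext i
    simpa using commutatorElement_mul_right_of_central (a i) (g : G)
      (commute_of_mem_zpowers hz (h.2 i))

variable {a b : ι → G}

open Classical in
-- The element `b i` has trivial commutator with every other `a j`, so it maps to a generator of the
-- factor `i`. These generators span a finite product.
theorem commutatorPairing_surjective [Fintype ι] (hz : ∀ g, Commute z g)
    (h1 : ∀ i j, i ≠ j → ⁅a i, b j⁆ = 1) (h2 : ∀ i, ⁅a i, b i⁆ = z ∨ ⁅a i, b i⁆ = z⁻¹) :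
    Function.Surjective (commutatorPairing hz a) := by
  rw [← MonoidHom.range_eq_top, Subgroup.eq_top_iff']
  intro c
  refine Subgroup.pi_mem_of_mulSingle_mem c fun i => ?_
  have hb : b i ∈ commutatorStabilizer hz a := by
    intro j
    by_cases hij : j = i
    · subst hij
      rcases h2 j with h | h <;> rw [h]
      · exact Subgroup.mem_zpowers z
      · exact inv_mem (Subgroup.mem_zpowers z)
    · rw [h1 j i hij]; exact one_mem _
  have hs : commutatorPairing hz a ⟨b i, hb⟩ =
      Pi.mulSingle i ⟨⁅a i, b i⁆, hb i⟩ := by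
    ext j
    by_cases hij : j = i
    · subst hij; simp [commutatorPairing]
    · simp [commutatorPairing, hij, h1 j i hij]
  obtain ⟨k, hk⟩ : ∃ k : ℤ, ⁅a i, b i⁆ ^ k = (c i : G) := by
    obtain ⟨k, hk⟩ := Subgroup.mem_zpowers_iff.mp (c i).2
    rcases h2 i with h | h <;> rw [h]
    · exact ⟨k, hk⟩
    · exact ⟨-k, by simpa using hk⟩
  refine ⟨⟨b i, hb⟩ ^ k, ?_⟩
  rw [map_zpow, hs, ← Pi.mulSingle_zpow]
  congr 1
  ext
  simpa using hk

theorem card_commutatorStabilizer [Fintype ι] (hz : ∀ g, Commute z g)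
    (h1 : ∀ i j, i ≠ j → ⁅a i, b j⁆ = 1) (h2 : ∀ i, ⁅a i, b i⁆ = z ∨ ⁅a i, b i⁆ = z⁻¹) :
    Nat.card (commutatorStabilizer hz a) =
      orderOf z ^ Fintype.card ι * Nat.card (commutatorPairing hz a).ker := by
  rw [Subgroup.card_eq_card_quotient_mul_card_subgroup (commutatorPairing hz a).ker,
    Nat.card_congr (QuotientGroup.quotientKerEquivOfSurjective _
      (commutatorPairing_surjective hz h1 h2)).toEquiv, Nat.card_fun, Nat.card_zpowers,
    Nat.card_eq_fintype_card]

theorem mem_ker_commutatorPairing (hz : ∀ g, Commute z g) (a : ι → G) :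
    ∃ y : (commutatorPairing hz a).ker, ((y : commutatorStabilizer hz a) : G) = z := by
  have hc : ∀ i, ⁅a i, z⁆ = 1 := fun i => commutatorElement_eq_one_iff_commute.mpr (hz _).symm
  have hm : z ∈ commutatorStabilizer hz a := fun i => by rw [hc i]; exact one_mem _
  refine ⟨⟨⟨z, hm⟩, ?_⟩, rfl⟩
  rw [MonoidHom.mem_ker]
  ext i
  exact hc i

theorem orderOf_dvd_card_ker_commutatorPairing (hz : ∀ g, Commute z g) (a : ι → G) :
    orderOf z ∣ Nat.card (commutatorPairing hz a).ker := by
  obtain ⟨y, hy⟩ := mem_ker_commutatorPairing hz a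
  have ho : orderOf y = orderOf z := by
    rw [← Subgroup.orderOf_coe, ← Subgroup.orderOf_coe]
    exact congrArg orderOf hy
  exact ho ▸ orderOf_dvd_natCard _

/-- The image of the pairing contributes `orderOf z` once per index, and the kernel contributes it
once more because it contains `z`. -/
theorem orderOf_pow_dvd_card [Fintype ι] (hz : ∀ g, Commute z g)
    (h1 : ∀ i j, i ≠ j → ⁅a i, b j⁆ = 1) (h2 : ∀ i, ⁅a i, b i⁆ = z ∨ ⁅a i, b i⁆ = z⁻¹) :
    orderOf z ^ (Fintype.card ι + 1) ∣ Nat.card G := by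
  refine dvd_trans ?_ (Subgroup.card_subgroup_dvd_card (commutatorStabilizer hz a))
  rw [card_commutatorStabilizer hz h1 h2, pow_succ]
  exact mul_dvd_mul_left _ (orderOf_dvd_card_ker_commutatorPairing hz a)

/-- If `|G|` equals the lower bound for the order of the stabilizer, nothing is left outside. For
the same reason the kernel is no larger than `⟨z⟩`. -/
theorem commutatorStabilizer_eq_top [Fintype ι] [Finite G] (hz : ∀ g, Commute z g)
    (h1 : ∀ i j, i ≠ j → ⁅a i, b j⁆ = 1) (h2 : ∀ i, ⁅a i, b i⁆ = z ∨ ⁅a i, b i⁆ = z⁻¹)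
    (hcard : Nat.card G = orderOf z ^ (Fintype.card ι + 1)) :
    commutatorStabilizer hz a = ⊤ := by
  apply Subgroup.eq_top_of_card_eq
  refine Nat.dvd_antisymm (Subgroup.card_subgroup_dvd_card _) ?_
  rw [hcard, card_commutatorStabilizer hz h1 h2, pow_succ]
  exact mul_dvd_mul_left _ (orderOf_dvd_card_ker_commutatorPairing hz a)

theorem mem_zpowers_of_commute_all [Fintype ι] [Finite G] (hz : ∀ g, Commute z g)
    (h1 : ∀ i j, i ≠ j → ⁅a i, b j⁆ = 1) (h2 : ∀ i, ⁅a i, b i⁆ = z ∨ ⁅a i, b i⁆ = z⁻¹)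
    (hcard : Nat.card G = orderOf z ^ (Fintype.card ι + 1)) (g : G)
    (hg : ∀ i, ⁅a i, g⁆ = 1) : g ∈ Subgroup.zpowers z := by
  have hC := commutatorStabilizer_eq_top hz h1 h2 hcard
  have hk : Nat.card (commutatorPairing hz a).ker = orderOf z := by
    have h := card_commutatorStabilizer hz h1 h2
    rw [(Subgroup.card_eq_iff_eq_top _).mpr hC, hcard, pow_succ] at h
    exact (Nat.eq_of_mul_eq_mul_left (pow_pos (orderOf_pos z) _) h).symm
  obtain ⟨y, hy⟩ := mem_ker_commutatorPairing hz a
  have hgm : g ∈ commutatorStabilizer hz a := by rw [hC]; trivial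
  have hgk : (⟨g, hgm⟩ : commutatorStabilizer hz a) ∈ (commutatorPairing hz a).ker := by
    rw [MonoidHom.mem_ker]; ext i; exact hg i
  have ht : Subgroup.zpowers y = ⊤ := by
    apply Subgroup.eq_top_of_card_eq
    rw [Nat.card_zpowers, hk, ← Subgroup.orderOf_coe, ← Subgroup.orderOf_coe]
    exact congrArg orderOf hy
  have hm : (⟨⟨g, hgm⟩, hgk⟩ : (commutatorPairing hz a).ker) ∈ Subgroup.zpowers y :=
    by rw [ht]; trivial
  obtain ⟨k, hk⟩ := Subgroup.mem_zpowers_iff.mp hm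
  have h3 : ((y : commutatorStabilizer hz a) : G) ^ k = g := by
    rw [← Subgroup.coe_zpow, ← Subgroup.coe_zpow, hk]
  exact Subgroup.mem_zpowers_iff.mpr ⟨k, by rw [← hy]; exact h3⟩

end CentralPairing

/-! ### Functoriality of the conjugacy relations -/

namespace KodairaTuple

variable {b : ℕ} {G G' : Type*} [Group G] [Group G']

/-- The image of a tuple under a map. -/
def map {G G' : Type*} (f : G → G') (S : KodairaTuple b G) : KodairaTuple b G' :=
  ⟨fun j => f (S.r₁ j), fun j => f (S.t₁ j), fun j => f (S.r₂ j), fun j => f (S.t₂ j), f S.z⟩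

theorem ConjugacyRelations.map {S : KodairaTuple b G} (h : S.ConjugacyRelations) (f : G →* G') :
    (S.map f).ConjugacyRelations := by
  constructor <;> intros <;> simp only [KodairaTuple.map, ← map_commutatorElement, ← map_mul,
    ← map_inv, ← map_one f]
  · rw [h.r_r_lt _ _ ‹_›]
  · rw [h.r_r_eq]
  · rw [h.r_r_gt _ _ ‹_›]
  · rw [h.r_t_lt _ _ ‹_›]
  · rw [h.r_t_eq]
  · rw [h.r_t_gt _ _ ‹_›]
  · rw [h.r_z]
  · rw [h.t_r_lt _ _ ‹_›]
  · rw [h.t_r_eq]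
  · rw [h.t_r_gt _ _ ‹_›]
  · rw [h.t_t_lt _ _ ‹_›]
  · rw [h.t_t_eq]
  · rw [h.t_t_gt _ _ ‹_›]
  · rw [h.t_z]

/-- Allows a tuple to be regarded inside any subgroup that contains its entries. -/
theorem ConjugacyRelations.of_map {S : KodairaTuple b G} (f : G →* G')
    (hf : Function.Injective f) (h : (S.map f).ConjugacyRelations) : S.ConjugacyRelations := by
  constructor <;> intros <;> apply hf <;>
    simp only [map_commutatorElement, map_mul, map_inv, map_one f]
  · exact h.r_r_lt _ _ ‹_›
  · exact h.r_r_eq _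
  · exact h.r_r_gt _ _ ‹_›
  · exact h.r_t_lt _ _ ‹_›
  · exact h.r_t_eq _
  · exact h.r_t_gt _ _ ‹_›
  · exact h.r_z _
  · exact h.t_r_lt _ _ ‹_›
  · exact h.t_r_eq _
  · exact h.t_r_gt _ _ ‹_›
  · exact h.t_t_lt _ _ ‹_›
  · exact h.t_t_eq _
  · exact h.t_t_gt _ _ ‹_›
  · exact h.t_z _

/-- The sub-tuple of genus `2` formed by the indices `i` and `k`. -/
def restrict {G : Type*} (i k : Fin b) (S : KodairaTuple b G) : KodairaTuple 2 G :=
  ⟨![S.r₁ i, S.r₁ k], ![S.t₁ i, S.t₁ k], ![S.r₂ i, S.r₂ k], ![S.t₂ i, S.t₂ k], S.z⟩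

theorem ConjugacyRelations.restrict {S : KodairaTuple b G} (h : S.ConjugacyRelations)
    {i k : Fin b} (hik : i < k) : (S.restrict i k).ConjugacyRelations where
  r_r_lt j l hjl := by fin_cases j <;> fin_cases l <;> first | exact h.r_r_lt _ _ hik | simp at hjl
  r_r_eq j := by fin_cases j <;> exact h.r_r_eq _
  r_r_gt j l hjl := by fin_cases j <;> fin_cases l <;> first | exact h.r_r_gt _ _ hik | simp at hjl
  r_t_lt j l hjl := by fin_cases j <;> fin_cases l <;> first | exact h.r_t_lt _ _ hik | simp at hjl
  r_t_eq j := by fin_cases j <;> exact h.r_t_eq _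
  r_t_gt j l hjl := by fin_cases j <;> fin_cases l <;> first | exact h.r_t_gt _ _ hik | simp at hjl
  r_z j := by fin_cases j <;> exact h.r_z _
  t_r_lt j l hjl := by fin_cases j <;> fin_cases l <;> first | exact h.t_r_lt _ _ hik | simp at hjl
  t_r_eq j := by fin_cases j <;> exact h.t_r_eq _
  t_r_gt j l hjl := by fin_cases j <;> fin_cases l <;> first | exact h.t_r_gt _ _ hik | simp at hjl
  t_t_lt j l hjl := by fin_cases j <;> fin_cases l <;> first | exact h.t_t_lt _ _ hik | simp at hjl
  t_t_eq j := by fin_cases j <;> exact h.t_t_eq _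
  t_t_gt j l hjl := by fin_cases j <;> fin_cases l <;> first | exact h.t_t_gt _ _ hik | simp at hjl
  t_z j := by fin_cases j <;> exact h.t_z _

/-- For central `z` all twisted right-hand sides collapse to 1. The partner of `r₁ⱼ` is `t₂ⱼ` and
that of `t₁ⱼ` is `r₂ⱼ`, hence the opposite order of the two second-half families. -/
theorem ConjugacyRelations.pairing_ne {S : KodairaTuple b G} (h : S.ConjugacyRelations)
    (hz : ∀ g, Commute S.z g) (i j : Fin b ⊕ Fin b) (hij : i ≠ j) :
    ⁅Sum.elim S.r₁ S.t₁ i, Sum.elim S.t₂ S.r₂ j⁆ = 1 := by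
  have hc : ∀ g : G, ⁅g, S.z⁆ = 1 := fun g => commutatorElement_eq_one_iff_commute.mpr (hz g).symm
  have hc' : ∀ g : G, ⁅S.z⁻¹, g⁆ = 1 := fun g =>
    commutatorElement_eq_one_iff_commute.mpr (hz g).inv_left
  rcases i with i | i <;> rcases j with j | j <;> simp only [Sum.elim_inl, Sum.elim_inr]
  · have hne : i ≠ j := fun e => hij (by rw [e])
    rcases lt_or_gt_of_ne hne with hlt | hgt
    · exact h.r_t_lt _ _ hlt
    · rw [h.r_t_gt _ _ hgt, hc']
  · rcases lt_trichotomy i j with hlt | rfl | hgt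
    · exact h.r_r_lt _ _ hlt
    · exact h.r_r_eq _
    · rw [h.r_r_gt _ _ hgt, ((hz (S.r₂ j)).inv_left).eq, mul_assoc (S.r₂ j),
        ((hz _).inv_left).eq]
      group
  · rcases lt_trichotomy i j with hlt | rfl | hgt
    · exact h.t_t_lt _ _ hlt
    · rw [h.t_t_eq, hc]
    · rw [h.t_t_gt _ _ hgt, mul_assoc _ S.z (S.t₂ i), (hz (S.t₂ i)).eq, mul_assoc _ S.z (S.t₂ i)⁻¹,
        (hz (S.t₂ i)⁻¹).eq]
      group
  · have hne : i ≠ j := fun e => hij (by rw [e])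
    rcases lt_or_gt_of_ne hne with hlt | hgt
    · exact h.t_r_lt _ _ hlt
    · rw [h.t_r_gt _ _ hgt, hc]

theorem ConjugacyRelations.pairing_eq {S : KodairaTuple b G} (h : S.ConjugacyRelations)
    (hz : ∀ g, Commute S.z g) (i : Fin b ⊕ Fin b) :
    ⁅Sum.elim S.r₁ S.t₁ i, Sum.elim S.t₂ S.r₂ i⁆ = S.z ∨
    ⁅Sum.elim S.r₁ S.t₁ i, Sum.elim S.t₂ S.r₂ i⁆ = S.z⁻¹ := by
  rcases i with i | i <;> simp only [Sum.elim_inl, Sum.elim_inr]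
  · exact Or.inr (h.r_t_eq i)
  · left; rw [h.t_r_eq, mul_assoc, (hz _).eq, inv_mul_cancel_left]

theorem ConjugacyRelations.orderOf_pow_dvd_card {S : KodairaTuple b G}
    (h : S.ConjugacyRelations) (hz : ∀ g, Commute S.z g) :
    orderOf S.z ^ (2 * b + 1) ∣ Nat.card G := by
  have := _root_.orderOf_pow_dvd_card hz (h.pairing_ne hz) (h.pairing_eq hz)
  simpa [two_mul] using this

/-- A group in which commuting is transitive on non-trivial elements has no non-trivial tuple
satisfying the conjugacy relations. -/
theorem ConjugacyRelations.z_eq_one_of_commute_trans {S : KodairaTuple 2 G}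
    (h : S.ConjugacyRelations)
    (hG : ∀ x : G, x ≠ 1 → ∀ a b, Commute a x → Commute b x → Commute a b) : S.z = 1 := by
  by_contra hz
  -- Two links of a chain: `r₁₁` and `r₁₂` commute with `r₂₂ ≠ 1`, hence with each other; then `r₁₂`
  -- and `t₂₂` commute with `r₁₁ ≠ 1`, hence with each other. But their commutator is `z⁻¹`.
  have e1 : Commute (S.r₁ 0) (S.r₂ 1) :=
    commutatorElement_eq_one_iff_commute.mp (h.r_r_lt 0 1 (by decide))
  have e2 : Commute (S.r₁ 1) (S.r₂ 1) := commutatorElement_eq_one_iff_commute.mp (h.r_r_eq 1)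
  have e3 : Commute (S.r₁ 0) (S.t₂ 1) :=
    commutatorElement_eq_one_iff_commute.mp (h.r_t_lt 0 1 (by decide))
  have n1 : S.r₂ 1 ≠ 1 := by
    intro e
    have := h.t_r_eq 1
    rw [e, commutatorElement_one_right] at this
    apply hz
    calc S.z = S.t₂ 1 * ((S.t₂ 1)⁻¹ * S.z * S.t₂ 1) * (S.t₂ 1)⁻¹ := by group
      _ = 1 := by rw [← this]; group
  have n2 : S.r₁ 0 ≠ 1 := by
    intro e
    have := h.r_t_eq 0
    rw [e, commutatorElement_one_left] at this
    exact hz (inv_eq_one.mp this.symm)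
  have e4 := hG _ n1 _ _ e1 e2
  have e5 := hG _ n2 _ _ e4.symm e3.symm
  have := h.r_t_eq 1
  rw [commutatorElement_eq_one_iff_commute.mpr e5] at this
  exact hz (inv_eq_one.mp this.symm)

end KodairaTuple

/-! ### Groups of order dividing `48` -/

namespace KodairaTuple

variable {b : ℕ} {G : Type*} [Group G]

/-- The elements `r₁ⱼ` and `t₁ⱼ`. -/
def firstHalf {G : Type*} (S : KodairaTuple b G) : Fin b ⊕ Fin b → G := Sum.elim S.r₁ S.t₁

/-- The elements `r₂ⱼ` and `t₂ⱼ`. -/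
def secondHalf {G : Type*} (S : KodairaTuple b G) : Fin b ⊕ Fin b → G := Sum.elim S.r₂ S.t₂

/-- The relations for `z` say that `r₁ⱼ` and `r₂ⱼ⁻¹` conjugate `z` in the same way, and likewise for
`t`. So if one of two twins centralizes `z`, the other does too. -/
theorem ConjugacyRelations.commute_z_iff {S : KodairaTuple b G} (h : S.ConjugacyRelations)
    (i : Fin b ⊕ Fin b) : Commute (S.secondHalf i * S.firstHalf i) S.z := by
  have key : ⁅S.firstHalf i, S.z⁆ = ⁅(S.secondHalf i)⁻¹, S.z⁆ := by
    rcases i with i | i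
    · exact h.r_z i
    · exact h.t_z i
  simp only [commutatorElement_def, mul_left_inj, inv_inv] at key
  have key2 : S.secondHalf i * (S.firstHalf i * S.z * (S.firstHalf i)⁻¹) =
      S.z * S.secondHalf i := by rw [key]; group
  change _ = _
  calc _ = S.secondHalf i * (S.firstHalf i * S.z * (S.firstHalf i)⁻¹) * S.firstHalf i := by group
    _ = _ := by rw [key2, mul_assoc]

/-- Meant for quotients that kill `z`: there the two halves generate subgroups which centralize each
other. -/
theorem ConjugacyRelations.commute_of_z_eq_one {S : KodairaTuple b G}
    (h : S.ConjugacyRelations) (hz : S.z = 1) (i j : Fin b ⊕ Fin b) :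
    Commute (S.firstHalf i) (S.secondHalf j) := by
  have hc : ∀ g, Commute S.z g := fun g => by rw [hz]; exact Commute.one_left g
  have key : ∀ j', ⁅Sum.elim S.r₁ S.t₁ i, Sum.elim S.t₂ S.r₂ j'⁆ = 1 := by
    intro j'
    by_cases hij : i = j'
    · subst hij
      rcases h.pairing_eq hc i with e | e <;> rw [e, hz]
      simp
    · exact h.pairing_ne hc i j' hij
  rcases j with j | j
  · exact commutatorElement_eq_one_iff_commute.mp (key (Sum.inr j))
  · exact commutatorElement_eq_one_iff_commute.mp (key (Sum.inl j))

end KodairaTuple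

theorem Subgroup.eq_top_of_prime_index {G : Type*} [Group G] [Finite G] {P H : Subgroup G}
    (hP : P.index.Prime) (hle : P ≤ H) {g : G} (hg : g ∈ H) (hgP : g ∉ P) : H = ⊤ := by
  rcases (Nat.dvd_prime hP).mp (Subgroup.index_dvd_of_le hle) with h | h
  · exact Subgroup.index_eq_one.mp h
  · exfalso
    have h1 := P.card_mul_index
    have h2 := H.card_mul_index
    rw [h, ← h1] at h2
    have h3 := Nat.eq_of_mul_eq_mul_right hP.pos h2
    exact hgP (Subgroup.eq_of_le_of_card_ge hle h3.le ▸ hg)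

theorem commute_of_closure_eq_top {G : Type*} [Group G] {X : Set G}
    (hX : Subgroup.closure X = ⊤) (h : ∀ x ∈ X, ∀ y ∈ X, Commute x y) (a b : G) :
    Commute a b := by
  have h1 : Subgroup.closure X ≤ Subgroup.centralizer X :=
    (Subgroup.closure_le _).mpr fun x hx => Subgroup.mem_centralizer_iff.mpr fun y hy => h y hy x hx
  have h2 : Subgroup.closure X ≤ Subgroup.centralizer {a} := by
    refine (Subgroup.closure_le _).mpr fun x hx => Subgroup.mem_centralizer_iff.mpr ?_
    rintro y rfl
    exact (Subgroup.mem_centralizer_iff.mp (h1 (hX ▸ Subgroup.mem_top y)) x hx).symm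
  exact Subgroup.mem_centralizer_iff.mp (h2 (hX ▸ Subgroup.mem_top b)) a rfl

theorem IsCyclic.commute {G : Type*} [Group G] [IsCyclic G] (a b : G) : Commute a b :=
  IsCyclic.isMulCommutative.is_comm.comm a b

theorem Subgroup.centralizer_singleton_eq_top {G : Type*} [Group G] {x : G}
    (h : Subgroup.centralizer {x} = ⊤) (g : G) : Commute x g := by
  have : g ∈ Subgroup.centralizer {x} := by rw [h]; trivial
  exact Subgroup.mem_centralizer_iff.mp this x rfl

theorem commute_of_card_dvd_four {G : Type*} [Group G] (h : Nat.card G ∣ 4) (a b : G) :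
    Commute a b := by
  have hle := Nat.le_of_dvd (by norm_num) h
  have : Nat.card G = 1 ∨ Nat.card G = 2 ∨ Nat.card G = 2 ^ 2 := by
    interval_cases hc : Nat.card G <;> simp_all
  rcases this with h1 | h1 | h1
  · have := (Nat.card_eq_one_iff_unique.mp h1).1
    exact Subsingleton.elim _ _
  · have := Fact.mk Nat.prime_two
    have := isCyclic_of_prime_card h1
    exact IsCyclic.commute a b
  · have := Fact.mk Nat.prime_two
    exact (IsPGroup.isMulCommutative_of_card_eq_prime_sq h1).is_comm.comm a b

theorem isCyclic_of_card_dvd_six {G : Type*} [Group G] (h : Nat.card G ∣ 6)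
    (h6 : Nat.card G ≠ 6) : IsCyclic G := by
  have hle := Nat.le_of_dvd (by norm_num) h
  have : Nat.card G = 1 ∨ Nat.card G = 2 ∨ Nat.card G = 3 := by
    interval_cases hc : Nat.card G <;> simp_all
  rcases this with h1 | h1 | h1
  · have := (Nat.card_eq_one_iff_unique.mp h1).1
    infer_instance
  · have := Fact.mk Nat.prime_two
    exact isCyclic_of_prime_card h1
  · have := Fact.mk Nat.prime_three
    exact isCyclic_of_prime_card h1

/-- If the center is trivial, centralizers of non-trivial elements are proper, so their order is a
proper divisor of 6 and they are cyclic. Otherwise the quotient by the center is cyclic for the same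
reason, and the group is abelian. -/
theorem commute_trans_of_card_dvd_six {G : Type*} [Group G] (h : Nat.card G ∣ 6) :
    (∀ a b : G, Commute a b) ∨
      ∀ x : G, x ≠ 1 → ∀ a b, Commute a x → Commute b x → Commute a b := by
  have hfin : Finite G := Nat.finite_of_card_ne_zero (by rintro e; simp [e] at h)
  by_cases hc : Subgroup.center G = ⊥
  · right
    intro x hx a b ha hb
    have hC : Nat.card (Subgroup.centralizer {x}) ≠ 6 := by
      intro h6
      have hG : Nat.card G = 6 := Nat.dvd_antisymm h (h6 ▸ Subgroup.card_subgroup_dvd_card _)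
      have ht := Subgroup.eq_top_of_card_eq _ (h6.trans hG.symm)
      have : x ∈ Subgroup.center G := Subgroup.mem_center_iff.mpr fun g =>
        (Subgroup.centralizer_singleton_eq_top ht g).symm
      rw [hc, Subgroup.mem_bot] at this
      exact hx this
    have := isCyclic_of_card_dvd_six ((Subgroup.card_subgroup_dvd_card _).trans h) hC
    have hcomm := IsCyclic.commute (G := Subgroup.centralizer {x})
      ⟨a, Subgroup.mem_centralizer_iff.mpr (by rintro y rfl; exact ha.symm)⟩
      ⟨b, Subgroup.mem_centralizer_iff.mpr (by rintro y rfl; exact hb.symm)⟩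
    exact congrArg Subtype.val hcomm
  · left
    have hne : Nat.card (G ⧸ Subgroup.center G) ≠ 6 := by
      intro h6
      have h1 := Subgroup.card_eq_card_quotient_mul_card_subgroup (Subgroup.center G)
      have h2 : Nat.card (Subgroup.center G) = 1 := by
        have := Nat.le_of_dvd (by norm_num) h
        have h3 : 0 < Nat.card (Subgroup.center G) := Nat.card_pos
        rw [h6] at h1; omega
      exact hc (Subgroup.card_eq_one.mp h2)
    have := isCyclic_of_card_dvd_six
      ((Subgroup.card_quotient_dvd_card (Subgroup.center G)).trans h) hne
    exact fun a b => (MonoidHom.isMulCommutative_of_isCyclic_of_ker_le_center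
      (QuotientGroup.mk' (Subgroup.center G)) (by simp)).is_comm.comm a b

/-! ### Minimal counterexamples of order dividing 48. -/

section MinimalTuple

open KodairaTuple

variable {G : Type*} [Group G] [Finite G] {S : KodairaTuple 2 G}

/-- A normal `2`-subgroup is centralized by an element of all non-trivial normal subgroups. -/
theorem commute_of_mem_normal_two_subgroup {z : G}
    (hmin : ∀ N : Subgroup G, N.Normal → N ≠ ⊥ → z ∈ N) {K : Subgroup G} [K.Normal]
    (hK : IsPGroup 2 K) (hne : K ≠ ⊥) :
    z ∈ (Subgroup.center K).map K.subtype ∧ ∀ k ∈ K, Commute z k := by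
  have := Fact.mk Nat.prime_two
  have hnt : Nontrivial K := K.bot_or_nontrivial.resolve_left hne
  have hz : z ∈ (Subgroup.center K).map K.subtype := by
    refine hmin _ inferInstance fun e => ?_
    have h1 := hK.center_nontrivial
    rw [Subgroup.map_eq_bot_iff_of_injective _ K.subtype_injective] at e
    rw [e] at h1
    exact not_subsingleton _ (inferInstance : Subsingleton (⊥ : Subgroup K))
  refine ⟨hz, fun k hk => ?_⟩
  obtain ⟨y, hy, rfl⟩ := hz
  exact congrArg Subtype.val (Subgroup.mem_center_iff.mp hy ⟨k, hk⟩).symm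

/-- Let `M` be the center of `P` and `x` an entry outside `P`. The relations modulo `M` force `x` to
act trivially on `P / M`, while triviality of the center of `G` makes `m ↦ ⁅x, m⁆` bijective on `M`.
Together these give `P = M`. An abelian `P` whose non-trivial elements have their centralizers
inside `P` makes commuting transitive. -/
theorem false_of_normal_index_three (h : S.ConjugacyRelations) (hz : S.z ≠ 1)
    (hmin : ∀ N : Subgroup G, N.Normal → N ≠ ⊥ → S.z ∈ N)
    (hgen : ∀ H : Subgroup G, (∀ i, S.firstHalf i ∈ H) → (∀ i, S.secondHalf i ∈ H) →
      S.z ∈ H → H = ⊤)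
    (hctr : Subgroup.center G = ⊥) (P : Subgroup G) [P.Normal] (hP : P.index = 3)
    (hcard : Nat.card P ∣ 16) : False := by
  have h2 := Fact.mk Nat.prime_two
  have hP' : P.index.Prime := hP ▸ Nat.prime_three
  have hPG : IsPGroup 2 P := by
    obtain ⟨k, -, hk⟩ := (Nat.dvd_prime_pow Nat.prime_two (m := 4)).mp (by simpa using hcard)
    exact IsPGroup.of_card hk
  have hctr' : ∀ x : G, (∀ g, Commute x g) → x = 1 := fun x hx => by
    have : x ∈ Subgroup.center G := Subgroup.mem_center_iff.mpr fun g => (hx g).symm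
    rwa [hctr, Subgroup.mem_bot] at this
  have hPne : P ≠ ⊥ := by
    rintro rfl
    rw [Subgroup.index_bot] at hP
    have := Fact.mk Nat.prime_three
    have := isCyclic_of_prime_card hP
    exact hz (hctr' _ fun g => IsCyclic.commute _ _)
  obtain ⟨hzM, hzP⟩ := commute_of_mem_normal_two_subgroup hmin hPG hPne
  set M : Subgroup G := (Subgroup.center P).map P.subtype with hM
  have hMP : M ≤ P := Subgroup.map_subtype_le _
  have hMc : ∀ m ∈ M, ∀ p ∈ P, Commute m p := by
    rintro _ ⟨y, hy, rfl⟩ p hp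
    exact congrArg Subtype.val (Subgroup.mem_center_iff.mp hy ⟨p, hp⟩).symm
  have hMn : M.Normal := inferInstance
  -- two elements outside `P` and in `P` generate
  have hout : ∀ g, g ∉ P → ∀ q, (∀ p ∈ P, Commute q p) → Commute q g → q = 1 := by
    intro g hg q hq hqg
    have ht : Subgroup.centralizer {q} = ⊤ := by
      refine Subgroup.eq_top_of_prime_index hP' (fun p hp => ?_) (g := g) ?_ hg
      · exact Subgroup.mem_centralizer_iff.mpr (by rintro y rfl; exact hq p hp)
      · exact Subgroup.mem_centralizer_iff.mpr (by rintro y rfl; exact hqg)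
    exact hctr' q (Subgroup.centralizer_singleton_eq_top ht)
  have hzC : ∀ g, Commute g S.z → g ∈ P := fun g hg => by
    by_contra hgP
    exact hz (hout g hgP _ hzP hg.symm)
  have hcomP : ∀ a b : G, ⁅a, b⁆ ∈ P := by
    intro a b
    have := Fact.mk Nat.prime_three
    have hcy : IsCyclic (G ⧸ P) := isCyclic_of_prime_card (p := 3) hP
    rw [← QuotientGroup.eq_one_iff]
    have : ((⁅a, b⁆ : G) : G ⧸ P) = ⁅(a : G ⧸ P), (b : G ⧸ P)⁆ := rfl
    rw [this, commutatorElement_eq_one_iff_commute]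
    exact IsCyclic.commute _ _
  -- the commutators of elements of `P` lie in `M`
  have hPM : ∀ p ∈ P, ∀ q ∈ P, ⁅p, q⁆ ∈ M := by
    have hquot : Nat.card (P ⧸ Subgroup.center P) ∣ 4 := by
      have h1 := Subgroup.card_eq_card_quotient_mul_card_subgroup (Subgroup.center P)
      -- The element `z` is not central in `G`, so `1`, `z` and some conjugate of `z` are three
      -- elements of `M`. Being a power of two, the order of `M` is then at least 4, and `P / M` has
      -- order dividing 4.
      have h3 : 3 ≤ Nat.card (Subgroup.center P) := by
        obtain ⟨g, hg⟩ : ∃ g, ¬ Commute g S.z := by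
          by_contra hcon
          push Not at hcon
          exact hz (hctr' _ fun g => (hcon g).symm)
        have hMcard : Nat.card M = Nat.card (Subgroup.center P) :=
          Nat.card_congr (Subgroup.equivMapOfInjective _ _ P.subtype_injective).symm.toEquiv
        rw [← hMcard]
        have hsub : ({1, S.z, g * S.z * g⁻¹} : Set G) ⊆ M := by
          rintro x (rfl | rfl | rfl)
          · exact one_mem _
          · exact hzM
          · exact hMn.conj_mem _ hzM g
        have hc3 : ({1, S.z, g * S.z * g⁻¹} : Set G).ncard = 3 := by
          rw [Set.ncard_eq_three]
          refine ⟨1, S.z, g * S.z * g⁻¹, hz.symm, ?_, ?_, rfl⟩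
          · intro e
            exact hz (conj_eq_one_iff.mp e.symm)
          · intro e
            exact hg (mul_inv_eq_iff_eq_mul.mp e.symm)
        rw [← hc3]
        exact Set.ncard_le_ncard hsub (Set.toFinite _)
      obtain ⟨k, hk4, hk⟩ := (Nat.dvd_prime_pow Nat.prime_two (m := 4)).mp
        (show Nat.card (Subgroup.center P) ∣ 2 ^ 4 from
          (Subgroup.card_subgroup_dvd_card _).trans hcard)
      have hk2 : 2 ≤ k := by
        by_contra hlt
        have : k ≤ 1 := by omega
        interval_cases k <;> omega
      have h4 : 4 ∣ Nat.card (Subgroup.center P) := by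
        rw [hk]; exact pow_dvd_pow 2 hk2
      obtain ⟨c, hc⟩ := h4
      obtain ⟨d, hd⟩ := hcard
      refine ⟨c * d, ?_⟩
      have : 4 * 4 = 4 * (Nat.card (P ⧸ Subgroup.center P) * (c * d)) := by
        calc 4 * 4 = Nat.card P * d := hd
          _ = _ := by rw [h1, hc]; ring
      exact Nat.eq_of_mul_eq_mul_left (by norm_num) this
    intro p hp q hq
    have := commute_of_card_dvd_four hquot ((⟨p, hp⟩ : P) : P ⧸ Subgroup.center P)
      ((⟨q, hq⟩ : P) : P ⧸ Subgroup.center P)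
    rw [← commutatorElement_eq_one_iff_commute] at this
    have h3 : ⁅(⟨p, hp⟩ : P), ⟨q, hq⟩⁆ ∈ Subgroup.center P := by
      rw [← QuotientGroup.eq_one_iff]; exact this
    exact ⟨_, h3, rfl⟩
  -- an element of the first half outside `P`, with its twin
  obtain ⟨i, hi⟩ : ∃ i, S.firstHalf i ∉ P := by
    by_contra hcon
    -- If the whole first half lay in `P`, so would every twin, because the product of two twins
    -- centralizes `z`. Then `P` would contain a generating set.
    push Not at hcon
    have : P = ⊤ := by
      refine hgen P hcon (fun i => ?_) (hMP hzM)
      have := hzC _ (h.commute_z_iff i)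
      exact (Subgroup.mul_mem_cancel_right P (hcon i)).mp this
    rw [this, Subgroup.index_top] at hP
    omega
  set x := S.firstHalf i with hx
  set y := S.secondHalf i with hy
  have hyx : y * x ∈ P := hzC _ (h.commute_z_iff i)
  -- Modulo `M` the group is a product of two commuting subgroups `K₁` and `K₂`, generated by the
  -- halves, so `p = k₁ k₂`. Conjugation by `x ∈ K₁` changes only `k₁`, conjugation by `y⁻¹` with `y
  -- ∈ K₂` only `k₂`, and the two agree on the abelian group `P / M`, since `y x ∈ P`. The
  -- discrepancy `c` therefore lies in both subgroups.
  have hxp : ∀ p ∈ P, ⁅x, p⁆ ∈ M := by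
    intro p hp
    let π := QuotientGroup.mk' M
    have hπ1 : ∀ g, π g = 1 ↔ g ∈ M := fun g => QuotientGroup.eq_one_iff g
    have hc := fun i j => (h.map π).commute_of_z_eq_one ((hπ1 _).mpr hzM) i j
    have hf : ∀ i, (S.map π).firstHalf i = π (S.firstHalf i) := by rintro (i | i) <;> rfl
    have hs : ∀ i, (S.map π).secondHalf i = π (S.secondHalf i) := by rintro (i | i) <;> rfl
    set K₁ := Subgroup.closure (Set.range (S.map π).firstHalf)
    set K₂ := Subgroup.closure (Set.range (S.map π).secondHalf)
    have hK : ∀ a ∈ K₁, ∀ b ∈ K₂, Commute a b := by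
      have h1 : K₁ ≤ Subgroup.centralizer (Set.range (S.map π).secondHalf) := by
        rw [Subgroup.closure_le]
        rintro _ ⟨i, rfl⟩
        refine Subgroup.mem_centralizer_iff.mpr ?_
        rintro _ ⟨j, rfl⟩
        exact (hc i j).symm
      intro a ha
      have h2 : K₂ ≤ Subgroup.centralizer {a} := by
        rw [Subgroup.closure_le]
        intro b hb
        refine Subgroup.mem_centralizer_iff.mpr ?_
        rintro _ rfl
        exact (Subgroup.mem_centralizer_iff.mp (h1 ha) b hb).symm
      exact fun b hb => Subgroup.mem_centralizer_iff.mp (h2 hb) a rfl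
    have htop : K₁ ⊔ K₂ = ⊤ := by
      have : (K₁ ⊔ K₂).comap π = ⊤ := by
        refine hgen _ (fun i => ?_) (fun i => ?_) ?_
        · refine (le_sup_left : K₁ ≤ K₁ ⊔ K₂) ?_
          rw [← hf]; exact Subgroup.subset_closure ⟨i, rfl⟩
        · refine (le_sup_right : K₂ ≤ K₁ ⊔ K₂) ?_
          rw [← hs]; exact Subgroup.subset_closure ⟨i, rfl⟩
        · rw [Subgroup.mem_comap, (hπ1 _).mpr hzM]; exact one_mem _
      rw [eq_top_iff]
      intro g _
      obtain ⟨g, rfl⟩ := QuotientGroup.mk'_surjective M g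
      have : g ∈ (K₁ ⊔ K₂).comap π := this ▸ Subgroup.mem_top g
      exact this
    obtain ⟨⟨⟨k₁, hk₁⟩, ⟨k₂, hk₂⟩⟩, hk⟩ :
        ∃ k : K₁ × K₂, (k.1 : G ⧸ M) * k.2 = π p := by
      have hr := MonoidHom.noncommCoprod_range K₁.subtype K₂.subtype
        (fun a b => hK a a.2 b b.2)
      rw [Subgroup.range_subtype, Subgroup.range_subtype, htop] at hr
      have : π p ∈ (K₁.subtype.noncommCoprod K₂.subtype (fun a b => hK a a.2 b b.2)).range :=
        hr ▸ Subgroup.mem_top _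
      obtain ⟨k, hk⟩ := this
      exact ⟨k, hk⟩
    simp only at hk
    have hxK : π x ∈ K₁ := by rw [hx, ← hf]; exact Subgroup.subset_closure ⟨i, rfl⟩
    have hyK : π y ∈ K₂ := by rw [hy, ← hs]; exact Subgroup.subset_closure ⟨i, rfl⟩
    have hPcomm : ∀ a ∈ P, ∀ b ∈ P, Commute (π a) (π b) := fun a ha b hb => by
      rw [← commutatorElement_eq_one_iff_commute, ← map_commutatorElement, hπ1]
      exact hPM a ha b hb
    have e1 : π x * π p * (π x)⁻¹ = (π y)⁻¹ * π p * π y := by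
      have := (hPcomm _ hyx _ hp).eq
      rw [map_mul] at this
      calc π x * π p * (π x)⁻¹ = (π y)⁻¹ * (π y * π x * π p) * (π x)⁻¹ := by group
        _ = _ := by rw [this]; group
    set c := k₁⁻¹ * (π x * k₁ * (π x)⁻¹) with hcdef
    have ec : π x * π p * (π x)⁻¹ = k₁ * c * k₂ := by
      rw [hcdef, ← hk]
      have := (hK _ hxK _ hk₂).inv_left.eq
      calc π x * (k₁ * k₂) * (π x)⁻¹ = π x * k₁ * (k₂ * (π x)⁻¹) := by group
        _ = _ := by rw [← this]; group
    have ec2 : c = (π y)⁻¹ * k₂ * π y * k₂⁻¹ := by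
      have h3 : k₁ * c * k₂ = k₁ * ((π y)⁻¹ * k₂ * π y) := by
        rw [← ec, e1, ← hk]
        have := (hK _ hk₁ _ hyK).inv_right.eq
        calc (π y)⁻¹ * (k₁ * k₂) * π y = ((π y)⁻¹ * k₁) * k₂ * π y := by group
          _ = _ := by rw [← this]; group
      rw [mul_assoc] at h3
      rw [← mul_left_cancel h3]; group
    have hc1 : c ∈ K₁ := mul_mem (inv_mem hk₁) (mul_mem (mul_mem hxK hk₁) (inv_mem hxK))
    have hc2 : c ∈ K₂ := by
      rw [ec2]
      exact mul_mem (mul_mem (mul_mem (inv_mem hyK) hk₂) hyK) (inv_mem hk₂)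
    have ec3 : π x * π p * (π x)⁻¹ = c * π p := by
      rw [ec, ← hk, (hK _ hk₁ _ hc2).eq, mul_assoc]
    have hcx : Commute (π x) c := hK _ hxK _ hc2
    -- Since `x` commutes with `c`, three conjugations multiply `p` by `c ^ 3`. But `x ^ 3` lies in
    -- `P` and acts trivially modulo `M`, so `c ^ 3 = 1`; as the image of an element of `P`, `c`
    -- also has order dividing 16.
    have ec4 : π x ^ 3 * π p * (π x ^ 3)⁻¹ = c ^ 3 * π p := by
      have e : π x * π p = c * π p * π x := by rw [← ec3]; group
      have e' : ∀ w, π x * (π p * w) = c * (π p * (π x * w)) := fun w => by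
        rw [← mul_assoc, e]; simp only [mul_assoc]
      have e'' : ∀ w, π x * (c * w) = c * (π x * w) := fun w => by
        rw [← mul_assoc, hcx.eq, mul_assoc]
      simp only [pow_succ, pow_zero, one_mul, mul_inv_rev, mul_assoc, e', e'',
        mul_inv_cancel_left, mul_inv_cancel, mul_one]
    have hx3 : x ^ 3 ∈ P := by
      have := P.pow_index_mem x
      rwa [hP] at this
    have hc3 : c ^ 3 = 1 := by
      have := (hPcomm _ hx3 _ hp).eq
      rw [map_pow] at this
      rw [this, mul_inv_cancel_right] at ec4
      exact mul_eq_right.mp ec4.symm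
    have hcm : π ⁅x, p⁆ = c := by
      rw [map_commutatorElement, commutatorElement_def, ec3, mul_inv_cancel_right]
    have hc16 : c ^ 16 = 1 := by
      rw [← hcm, ← map_pow]
      have : (⟨⁅x, p⁆, hcomP x p⟩ : P) ^ 16 = 1 := by
        rw [← orderOf_dvd_iff_pow_eq_one]
        exact (orderOf_dvd_natCard _).trans hcard
      have h16 : ⁅x, p⁆ ^ 16 = 1 := congrArg Subtype.val this
      rw [h16, map_one]
    have : c = 1 := by
      calc c = c ^ 16 * ((c ^ 3) ^ 5)⁻¹ := by group
        _ = 1 := by rw [hc16, hc3]; simp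
    rw [← hπ1, hcm, this]
  have hfix : ∀ m ∈ M, ∀ p ∈ P, ⁅x, m⁆ = ⁅x, p⁆ → Commute (m⁻¹ * p) x := by
    intro m hm p hp e
    change m⁻¹ * p * x = x * (m⁻¹ * p)
    simp only [commutatorElement_def] at e
    have e1 : x * m * x⁻¹ = x * p * x⁻¹ * (p⁻¹ * m) := by
      calc x * m * x⁻¹ = x * m * x⁻¹ * m⁻¹ * m := by group
        _ = _ := by rw [e]; group
    have e2 : Commute (x * m * x⁻¹) (p⁻¹ * m) :=
      hMc _ (hMn.conj_mem _ hm x) _ (mul_mem (inv_mem hp) (hMP hm))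
    have e3 : Commute m p := hMc _ hm _ hp
    have e4 : x * p * x⁻¹ = (p⁻¹ * m)⁻¹ * (x * m * x⁻¹) := by
      rw [← e2.inv_right.eq, e1]; group
    calc m⁻¹ * p * x = m⁻¹ * p * x * m⁻¹ * m := by group
      _ = (p⁻¹ * m)⁻¹ * (x * m * x⁻¹) * x * m⁻¹ := by
          have : (p⁻¹ * m)⁻¹ = m⁻¹ * p := by group
          rw [this]; group
      _ = x * (p * m⁻¹) := by rw [← e4]; group
      _ = _ := by rw [e3.inv_left.eq]
  -- `1 - x` is bijective on `M`
  have hsurj : ∀ m' ∈ M, ∃ m ∈ M, ⁅x, m⁆ = m' := by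
    let F : M → M := fun m => ⟨⁅x, m⁆, hxp _ (hMP m.2)⟩
    -- Two elements of `M` with the same value differ by an element which commutes with `P` and with
    -- `x`, hence is central in `G` and trivial.
    have hF : Function.Injective F := by
      intro m n hmn
      have h1 : (m : G)⁻¹ * n = 1 :=
        hout x hi _ (fun p hp => hMc _ (mul_mem (inv_mem m.2) n.2) p hp)
          (hfix m m.2 n (hMP n.2) (congrArg Subtype.val hmn))
      exact Subtype.ext (inv_mul_eq_one.mp h1)
    intro m' hm'
    obtain ⟨m, hm⟩ := (Finite.injective_iff_surjective.mp hF) ⟨m', hm'⟩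
    exact ⟨m, m.2, congrArg Subtype.val hm⟩
  -- Every `p ∈ P` is an element of `M` times an element commuting with `x`. The commutator of `c`
  -- with the latter lies in `M` and commutes with `x`, so it vanishes; thus `c` centralizes `P` as
  -- well as `x`.
  have hcentral : ∀ c ∈ P, Commute c x → c = 1 := by
    intro c hc hcx
    refine hout x hi c (fun p hp => ?_) hcx
    obtain ⟨m, hm, e⟩ := hsurj _ (hxp p hp)
    have hfix := hfix m hm p hp e
    have hmp : m⁻¹ * p ∈ P := mul_mem (inv_mem (hMP hm)) hp
    have hone : ⁅c, m⁻¹ * p⁆ = 1 := by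
      refine hout x hi _ (fun q hq => hMc _ (hPM c hc _ hmp) q hq) ?_
      exact ((hcx.mul_left hfix).mul_left hcx.inv_left).mul_left hfix.inv_left
    have hcm : Commute c m := (hMc m hm c hc).symm
    have := hcm.mul_right (commutatorElement_eq_one_iff_commute.mp hone)
    rwa [mul_inv_cancel_left] at this
  have hPab : ∀ p ∈ P, ∀ q ∈ P, Commute p q := by
    have hPM' : ∀ p ∈ P, p ∈ M := by
      intro p hp
      obtain ⟨m, hm, e⟩ := hsurj _ (hxp p hp)
      have : m⁻¹ * p = 1 :=
        hcentral _ (mul_mem (inv_mem (hMP hm)) hp) (hfix m hm p hp e)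
      rw [← inv_mul_eq_one.mp this]; exact hm
    exact fun p hp q hq => hMc p (hPM' p hp) q hq
  -- For `w ∈ P` the centralizer lies in the abelian group `P`. For `w ∉ P` and `a`, `b` commuting
  -- with `w`, the commutator `⁅a, b⁆` lies in `P` and commutes with `w`, so it is central and
  -- trivial.
  refine hz (h.z_eq_one_of_commute_trans fun w hw a b ha hb => ?_)
  by_cases hwP : w ∈ P
  · have hin : ∀ a, Commute a w → a ∈ P := fun a ha => by
      by_contra haP
      exact hw (hout a haP w (fun p hp => hPab w hwP p hp) ha.symm)
    exact hPab a (hin a ha) b (hin b hb)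
  · rw [← commutatorElement_eq_one_iff_commute]
    refine hout w hwP _ (fun p hp => hPab _ (hcomP a b) p hp) ?_
    exact ((ha.mul_left hb).mul_left ha.inv_left).mul_left hb.inv_left

/-- The normal core `K` of a Sylow 2-subgroup has quotient of order dividing 6. If `K` is trivial,
the dichotomy for such orders ends the proof; otherwise `G / K` turns out to be abelian, which makes
the Sylow subgroup normal. -/
theorem false_of_minimal (h : S.ConjugacyRelations) (hz : S.z ≠ 1)
    (hmin : ∀ N : Subgroup G, N.Normal → N ≠ ⊥ → S.z ∈ N)
    (hgen : ∀ H : Subgroup G, (∀ i, S.firstHalf i ∈ H) → (∀ i, S.secondHalf i ∈ H) →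
      S.z ∈ H → H = ⊤)
    (hcard : Nat.card G ∣ 48) : False := by
  have h2 := Fact.mk Nat.prime_two
  -- A central `z` would give `orderOf z ^ 5 ∣ 48`, impossible since `2 ^ 5 ∤ 48` and `3 ^ 5 > 48`.
  have hnc : ¬ ∀ g, Commute S.z g := by
    intro hc
    have h1 := (h.orderOf_pow_dvd_card hc).trans hcard
    have h3 : 2 ≤ orderOf S.z := by
      have := orderOf_pos S.z
      have : orderOf S.z ≠ 1 := fun e => hz (orderOf_eq_one_iff.mp e)
      omega
    have h4 := Nat.le_of_dvd (by norm_num) h1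
    have h5 : orderOf S.z < 3 := by
      by_contra h6
      have := Nat.pow_le_pow_left (show 3 ≤ orderOf S.z by omega) (2 * 2 + 1)
      omega
    have h6 : orderOf S.z = 2 := by omega
    rw [h6] at h1
    norm_num at h1
  have hctr : Subgroup.center G = ⊥ := by
    by_contra hne
    exact hnc fun g => (Subgroup.mem_center_iff.mp (hmin _ inferInstance hne) g).symm
  have hnt : Nontrivial G := ⟨S.z, 1, hz⟩
  have hnp : ¬ IsPGroup 2 G := fun hp => by
    have := hp.center_nontrivial
    rw [hctr] at this
    exact not_subsingleton _ (inferInstance : Subsingleton (⊥ : Subgroup G))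
  have hall : ¬ ∀ i, Commute (S.firstHalf i) S.z ∧ Commute (S.secondHalf i) S.z := by
    intro hc
    refine hnc (Subgroup.centralizer_singleton_eq_top (hgen _ (fun i => ?_) (fun i => ?_) ?_)) <;>
      refine Subgroup.mem_centralizer_iff.mpr ?_ <;> rintro y rfl
    · exact (hc i).1.symm
    · exact (hc i).2.symm
    · rfl
  have hone : ¬ ∀ i, Commute (S.firstHalf i) S.z := fun hc => hall fun i =>
    ⟨hc i, by simpa using (h.commute_z_iff i).mul_left (hc i).inv_left⟩
  have htwo : ¬ ∀ i, Commute (S.secondHalf i) S.z := fun hc => hall fun i =>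
    ⟨by simpa using (hc i).inv_left.mul_left (h.commute_z_iff i), hc i⟩
  let P : Sylow 2 G := default
  have hidx : P.index = 3 := by
    have hd : P.index ∣ 3 := by
      have h1 : P.index ∣ 2 ^ 4 * 3 := P.index_dvd_card.trans hcard
      refine Nat.Coprime.dvd_of_dvd_mul_left (Nat.Coprime.pow_right 4 ?_) h1
      exact ((Nat.Prime.coprime_iff_not_dvd Nat.prime_two).mpr P.not_dvd_index).symm
    rcases (Nat.dvd_prime Nat.prime_three).mp hd with h1 | h1
    · exfalso
      have := P.isPGroup'
      rw [Subgroup.index_eq_one.mp h1] at this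
      exact hnp (this.of_equiv Subgroup.topEquiv)
    · exact h1
  have hPcard : Nat.card P ∣ 16 := by
    have := P.card_mul_index
    rw [hidx] at this
    rw [← this] at hcard
    exact Nat.dvd_of_mul_dvd_mul_right (k := 3) (by norm_num) hcard
  set K := (P : Subgroup G).normalCore with hK
  have hKP : K ≤ P := Subgroup.normalCore_le _
  have hK6 : Nat.card (G ⧸ K) ∣ 6 := by
    have e := Subgroup.normalCore_eq_ker (P : Subgroup G)
    have h1 : Nat.card (G ⧸ K) = Nat.card (MulAction.toPermHom G (G ⧸ (P : Subgroup G))).range := by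
      rw [hK, e]
      exact Nat.card_congr (QuotientGroup.quotientKerEquivRange _).toEquiv
    rw [h1]
    refine (Subgroup.card_subgroup_dvd_card _).trans ?_
    rw [Nat.card_perm]
    change (P : Subgroup G).index.factorial ∣ 6
    rw [hidx]; decide
  by_cases hKb : K = ⊥
  · have h6 : Nat.card G ∣ 6 := by
      rwa [hKb, Nat.card_congr (QuotientGroup.quotientBot (G := G)).toEquiv] at hK6
    rcases commute_trans_of_card_dvd_six h6 with hc | hc
    · exact hnc (hc _)
    · exact hz (h.z_eq_one_of_commute_trans hc)
  have hK2 : IsPGroup 2 K := P.isPGroup'.to_le hKP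
  obtain ⟨hzK, hzcK⟩ := commute_of_mem_normal_two_subgroup hmin hK2 hKb
  have hzK : S.z ∈ K := Subgroup.map_subtype_le _ hzK
  let π := QuotientGroup.mk' K
  have hπ1 : ∀ g, π g = 1 ↔ g ∈ K := fun g => QuotientGroup.eq_one_iff g
  have hf : ∀ i, (S.map π).firstHalf i = π (S.firstHalf i) := by rintro (i | i) <;> rfl
  have hs : ∀ i, (S.map π).secondHalf i = π (S.secondHalf i) := by rintro (i | i) <;> rfl
  have hc : ∀ i j, Commute (π (S.firstHalf i)) (π (S.secondHalf j)) := fun i j => by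
    have := (h.map π).commute_of_z_eq_one ((hπ1 _).mpr hzK) i j
    rwa [hf, hs] at this
  -- Neither half can lie entirely in `K`, since `z` centralizes `K`. If commuting is transitive in
  -- `G / K`, all images of one half commute with a common non-trivial image of the other half,
  -- hence with each other.
  have hQ : ∀ a b : G ⧸ K, Commute a b := by
    rcases commute_trans_of_card_dvd_six hK6 with hQ | hQ
    · exact hQ
    obtain ⟨j, hj⟩ : ∃ j, π (S.secondHalf j) ≠ 1 := by
      by_contra hcon
      push Not at hcon
      exact htwo fun i => (hzcK _ ((hπ1 _).mp (hcon i))).symm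
    obtain ⟨i, hi⟩ : ∃ j, π (S.firstHalf j) ≠ 1 := by
      by_contra hcon
      push Not at hcon
      exact hone fun i => (hzcK _ ((hπ1 _).mp (hcon i))).symm
    refine commute_of_closure_eq_top (X := Set.range (π ∘ S.firstHalf) ∪
      Set.range (π ∘ S.secondHalf)) ?_ ?_
    · have : (Subgroup.closure (Set.range (π ∘ S.firstHalf) ∪
          Set.range (π ∘ S.secondHalf))).comap π = ⊤ := by
        refine hgen _ (fun i => ?_) (fun i => ?_) ?_
        · exact Subgroup.subset_closure (Or.inl ⟨i, rfl⟩)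
        · exact Subgroup.subset_closure (Or.inr ⟨i, rfl⟩)
        · rw [Subgroup.mem_comap, (hπ1 _).mpr hzK]; exact one_mem _
      rw [eq_top_iff]
      intro g _
      obtain ⟨g, rfl⟩ := QuotientGroup.mk'_surjective K g
      rw [← Subgroup.mem_comap]
      change g ∈ (Subgroup.closure _).comap π
      rw [this]; trivial
    · rintro _ (⟨k, rfl⟩ | ⟨k, rfl⟩) _ (⟨l, rfl⟩ | ⟨l, rfl⟩)
      · exact hQ _ hj _ _ (hc k j) (hc l j)
      · exact hc k l
      · exact (hc l k).symm
      · exact hQ _ hi _ _ (hc i k).symm (hc i l).symm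
  have hPn : (P : Subgroup G).Normal := by
    refine ⟨fun p hp g => ?_⟩
    have h1 : ⁅g, p⁆ ∈ K := by
      rw [← hπ1, map_commutatorElement, commutatorElement_eq_one_iff_commute]
      exact hQ _ _
    have h3 : g * p * g⁻¹ = ⁅g, p⁆ * p := by simp [commutatorElement_def]
    rw [h3]
    exact mul_mem (hKP h1) hp
  exact false_of_normal_index_three h hz hmin hgen hctr P hidx hPcard

end MinimalTuple

/-- A group of order dividing `48` has no prestructures. -/
theorem KodairaTuple.ConjugacyRelations.z_eq_one_of_card_dvd {G : Type*} [Group G]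
    (hcard : Nat.card G ∣ 48) {S : KodairaTuple 2 G} (h : S.ConjugacyRelations) : S.z = 1 := by
  induction hm : Nat.card G using Nat.strong_induction_on generalizing G with
  | _ m ih =>
    subst hm
    have hfin : Finite G := Nat.finite_of_card_ne_zero (by rintro e; simp [e] at hcard)
    by_contra hz
    -- Failure of either minimality hypothesis gives a smaller counterexample: the quotient by `N`,
    -- where `z` survives, or the proper subgroup `H`.
    refine false_of_minimal h hz (fun N hN hne => ?_) (fun H h1 h2 h3 => ?_) hcard
    · by_contra hzN
      have hlt : Nat.card (G ⧸ N) < Nat.card G := by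
        have h1 := Subgroup.card_eq_card_quotient_mul_card_subgroup N
        have h3 : 1 < Nat.card N := by
          have : Nat.card N ≠ 1 := fun e => hne (Subgroup.card_eq_one.mp e)
          have : 0 < Nat.card N := Nat.card_pos
          omega
        have h4 : 0 < Nat.card (G ⧸ N) := Nat.card_pos
        nlinarith
      have := ih _ hlt ((Subgroup.card_quotient_dvd_card N).trans hcard)
        (h.map (QuotientGroup.mk' N)) rfl
      exact hzN ((QuotientGroup.eq_one_iff _).mp this)
    · by_contra hne
      have hlt : Nat.card H < Nat.card G := by
        refine lt_of_le_of_ne (Nat.le_of_dvd Nat.card_pos (Subgroup.card_subgroup_dvd_card H)) ?_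
        exact fun e => hne (Subgroup.eq_top_of_card_eq _ e)
      let T : KodairaTuple 2 H := ⟨fun j => ⟨S.r₁ j, h1 (Sum.inl j)⟩, fun j => ⟨S.t₁ j, h1 (Sum.inr j)⟩,
        fun j => ⟨S.r₂ j, h2 (Sum.inl j)⟩, fun j => ⟨S.t₂ j, h2 (Sum.inr j)⟩, ⟨S.z, h3⟩⟩
      have hT : T.ConjugacyRelations := ConjugacyRelations.of_map H.subtype H.subtype_injective h
      have := ih _ hlt ((Subgroup.card_subgroup_dvd_card H).trans hcard) hT rfl
      exact hz (congrArg Subtype.val this)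

/-! ### Groups of order `32` and non-monolithic groups of order `96` -/

theorem finite_of_card {α : Type*} {n : ℕ} (hn : n ≠ 0) (hG : Nat.card α = n) : Finite α :=
  Nat.finite_of_card_ne_zero (by rwa [hG])

section Order32

open KodairaTuple

variable {G : Type*} [Group G] {S : KodairaTuple 2 G}

theorem isPGroup_two_of_card_thirtyTwo (hG : Nat.card G = 32) : IsPGroup 2 G :=
  IsPGroup.of_card (n := 5) (by rw [hG]; norm_num)

/-- A 2-group has a central involution `y`. The quotient by `⟨y⟩` has order 16, so `z` dies there
and lies in `⟨y⟩`. -/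
theorem KodairaTuple.ConjugacyRelations.central_of_card_thirtyTwo (hG : Nat.card G = 32)
    (h : S.ConjugacyRelations) (hz : S.z ≠ 1) : (∀ g, Commute S.z g) ∧ orderOf S.z = 2 := by
  have := finite_of_card (by norm_num) hG
  have h2 := Fact.mk Nat.prime_two
  have hp := isPGroup_two_of_card_thirtyTwo hG
  have hnt : Nontrivial G := ⟨S.z, 1, hz⟩
  have hc := hp.center_nontrivial
  obtain ⟨k, hk⟩ := (hp.to_subgroup (Subgroup.center G)).exists_card_eq
  have hk0 : k ≠ 0 := by
    rintro rfl
    rw [pow_zero, Nat.card_eq_one_iff_unique] at hk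
    exact not_subsingleton _ hk.1
  obtain ⟨y, hy⟩ := exists_prime_orderOf_dvd_card' (G := Subgroup.center G) 2
    (hk ▸ dvd_pow_self 2 hk0)
  have hyc : ∀ g, Commute (y : G) g := fun g => (Subgroup.mem_center_iff.mp y.2 g).symm
  have hyo : orderOf (y : G) = 2 := by rw [Subgroup.orderOf_coe, hy]
  have hn : (Subgroup.zpowers (y : G)).Normal := by
    refine ⟨fun x hx g => ?_⟩
    rwa [← (commute_of_mem_zpowers hyc hx g).eq, mul_inv_cancel_right]
  have hzy : S.z ∈ Subgroup.zpowers (y : G) := by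
    have hd : Nat.card (G ⧸ Subgroup.zpowers (y : G)) ∣ 48 := by
      have h1 := Subgroup.card_eq_card_quotient_mul_card_subgroup (Subgroup.zpowers (y : G))
      rw [hG, Nat.card_zpowers, hyo] at h1
      have : Nat.card (G ⧸ Subgroup.zpowers (y : G)) = 16 := by omega
      rw [this]; norm_num
    exact (QuotientGroup.eq_one_iff _).mp
      ((h.map (QuotientGroup.mk' _)).z_eq_one_of_card_dvd hd)
  refine ⟨commute_of_mem_zpowers hyc hzy, ?_⟩
  have h1 := orderOf_dvd_of_mem_zpowers hzy
  rw [hyo] at h1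
  exact ((Nat.dvd_prime Nat.prime_two).mp h1).resolve_left
    fun e => hz (orderOf_eq_one_iff.mp e)

/-- This is the equality case of the bound, `32 = 2 ^ (4 + 1)`. -/
theorem KodairaTuple.ConjugacyRelations.mem_zpowers_of_commute (hG : Nat.card G = 32)
    (h : S.ConjugacyRelations) (hz : S.z ≠ 1) {g : G} (hg : ∀ i, Commute (S.firstHalf i) g) :
    g ∈ Subgroup.zpowers S.z := by
  have := finite_of_card (by norm_num) hG
  obtain ⟨hc, ho⟩ := h.central_of_card_thirtyTwo hG hz
  refine mem_zpowers_of_commute_all hc (h.pairing_ne hc) (h.pairing_eq hc) ?_ g fun i => ?_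
  · rw [hG, ho]; simp
  · exact commutatorElement_eq_one_iff_commute.mpr (hg i)

theorem KodairaTuple.ConjugacyRelations.commutator_firstHalf_mem (hG : Nat.card G = 32)
    (h : S.ConjugacyRelations) (hz : S.z ≠ 1) (g : G) (i : Fin 2 ⊕ Fin 2) :
    ⁅S.firstHalf i, g⁆ ∈ Subgroup.zpowers S.z := by
  have := finite_of_card (by norm_num) hG
  obtain ⟨hc, ho⟩ := h.central_of_card_thirtyTwo hG hz
  have ht := commutatorStabilizer_eq_top hc (h.pairing_ne hc) (h.pairing_eq hc)
    (by rw [hG, ho]; simp)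
  have : g ∈ commutatorStabilizer hc (Sum.elim S.r₁ S.t₁) := by rw [ht]; trivial
  exact this i

theorem mem_zpowers_of_orderOf_two {z x : G} (hz : orderOf z = 2)
    (hx : x ∈ Subgroup.zpowers z) : x = 1 ∨ x = z := by
  obtain ⟨k, rfl⟩ := Subgroup.mem_zpowers_iff.mp hx
  have h2 : z ^ (2 : ℤ) = 1 := by
    have := pow_orderOf_eq_one z
    rw [hz] at this
    exact_mod_cast this
  rcases Int.even_or_odd' k with ⟨m, rfl | rfl⟩
  · left; rw [zpow_mul, h2, one_zpow]
  · right; rw [zpow_add, zpow_mul, h2, one_zpow, one_mul, zpow_one]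

/-- The commutators of `g` with the first half lie in the central subgroup `⟨z⟩` of order 2, so
those of `g ^ 2`, being their squares, vanish. -/
theorem KodairaTuple.ConjugacyRelations.sq_mem (hG : Nat.card G = 32)
    (h : S.ConjugacyRelations) (hz : S.z ≠ 1) (g : G) : g ^ 2 ∈ Subgroup.zpowers S.z := by
  obtain ⟨hc, ho⟩ := h.central_of_card_thirtyTwo hG hz
  refine h.mem_zpowers_of_commute hG hz fun i => ?_
  have h1 := h.commutator_firstHalf_mem hG hz g i
  rw [← commutatorElement_eq_one_iff_commute, pow_two,
    commutatorElement_mul_right_of_central _ _ (commute_of_mem_zpowers hc h1)]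
  have hzz : S.z * S.z = 1 := by
    have := pow_orderOf_eq_one S.z
    rwa [ho, pow_two] at this
  rcases mem_zpowers_of_orderOf_two ho h1 with e | e <;> rw [e]
  · simp
  · exact hzz

/-- Conjugation by an entry of the first half multiplies `x` and `y` by central elements, and this
does not change their commutator. -/
theorem KodairaTuple.ConjugacyRelations.commutator_mem (hG : Nat.card G = 32)
    (h : S.ConjugacyRelations) (hz : S.z ≠ 1) (x y : G) : ⁅x, y⁆ ∈ Subgroup.zpowers S.z := by
  obtain ⟨hc, ho⟩ := h.central_of_card_thirtyTwo hG hz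
  refine h.mem_zpowers_of_commute hG hz fun i => ?_
  have hx := commute_of_mem_zpowers hc (h.commutator_firstHalf_mem hG hz x i)
  have hy := commute_of_mem_zpowers hc (h.commutator_firstHalf_mem hG hz y i)
  set a := S.firstHalf i
  have ex : a * x * a⁻¹ = ⁅a, x⁆ * x := by simp [commutatorElement_def]
  have ey : a * y * a⁻¹ = ⁅a, y⁆ * y := by simp [commutatorElement_def]
  have e : a * ⁅x, y⁆ * a⁻¹ = ⁅x, y⁆ := by
    calc a * ⁅x, y⁆ * a⁻¹ = ⁅a * x * a⁻¹, a * y * a⁻¹⁆ := by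
          simp only [commutatorElement_def]; group
      _ = ⁅⁅a, x⁆ * x, ⁅a, y⁆ * y⁆ := by rw [ex, ey]
      _ = (⁅a, x⁆ * (x * ⁅a, y⁆)) * y * x⁻¹ * (⁅a, x⁆⁻¹ * y⁻¹) * ⁅a, y⁆⁻¹ := by
          simp only [commutatorElement_def]; group
      _ = (⁅a, x⁆ * (⁅a, y⁆ * x)) * y * x⁻¹ * (y⁻¹ * ⁅a, x⁆⁻¹) * ⁅a, y⁆⁻¹ := by
          rw [(hy x).eq, (hx y⁻¹).inv_left.eq]
      _ = ⁅a, x⁆ * (⁅a, y⁆ * (⁅x, y⁆ * ⁅a, x⁆⁻¹)) * ⁅a, y⁆⁻¹ := by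
          simp only [commutatorElement_def]; group
      _ = ⁅a, x⁆ * ⁅a, y⁆ * ⁅a, x⁆⁻¹ * (⁅x, y⁆ * ⁅a, y⁆⁻¹) := by
          rw [← (hx ⁅x, y⁆).inv_left.eq]; group
      _ = ⁅a, x⁆ * (⁅a, y⁆ * ⁅a, x⁆⁻¹) * ⁅a, y⁆⁻¹ * ⁅x, y⁆ := by
          rw [← (hy ⁅x, y⁆).inv_left.eq]; group
      _ = _ := by rw [(hy _).eq]; group
  exact mul_inv_eq_iff_eq_mul.mp e

theorem KodairaTuple.ConjugacyRelations.center_eq (hG : Nat.card G = 32)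
    (h : S.ConjugacyRelations) (hz : S.z ≠ 1) :
    Subgroup.center G = Subgroup.zpowers S.z := by
  obtain ⟨hc, -⟩ := h.central_of_card_thirtyTwo hG hz
  refine le_antisymm (fun g hg => ?_) ?_
  · exact h.mem_zpowers_of_commute hG hz fun i => Subgroup.mem_center_iff.mp hg _
  · rw [Subgroup.zpowers_le]
    exact Subgroup.mem_center_iff.mpr fun g => (hc g).symm

theorem KodairaTuple.ConjugacyRelations.isExtraSpecial (hG : Nat.card G = 32)
    (h : S.ConjugacyRelations) (hz : S.z ≠ 1) : IsExtraSpecial G := by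
  have := finite_of_card (by norm_num) hG
  obtain ⟨hc, ho⟩ := h.central_of_card_thirtyTwo hG hz
  have hctr := h.center_eq hG hz
  have hcard : Nat.card (Subgroup.center G) = 2 := by rw [hctr, Nat.card_zpowers, ho]
  refine ⟨this, 2, Nat.prime_two, isPGroup_two_of_card_thirtyTwo hG, ?_, hcard, ?_, ?_, ?_⟩
  · have := Fact.mk Nat.prime_two
    exact isCyclic_of_prime_card hcard
  · have h1 := Subgroup.card_eq_card_quotient_mul_card_subgroup (Subgroup.center G)
    rw [hG, hcard] at h1
    exact (Finite.one_lt_card_iff_nontrivial (α := G ⧸ Subgroup.center G)).mp (by omega)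
  · intro x y
    obtain ⟨x, rfl⟩ := QuotientGroup.mk_surjective x
    obtain ⟨y, rfl⟩ := QuotientGroup.mk_surjective y
    have h1 : ((⁅x, y⁆ : G) : G ⧸ Subgroup.center G) = 1 := by
      rw [QuotientGroup.eq_one_iff, hctr]; exact h.commutator_mem hG hz x y
    exact commutatorElement_eq_one_iff_mul_comm.mp h1
  · intro x
    obtain ⟨x, rfl⟩ := QuotientGroup.mk_surjective x
    rw [← QuotientGroup.mk_pow, QuotientGroup.eq_one_iff, hctr]
    exact h.sq_mem hG hz x

end Order32

/-! ### Order 96: the normal subgroup of order three. -/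

section Order96

open KodairaTuple

variable {G : Type*} [Group G]

theorem card_quotient_of_card_three (hG : Nat.card G = 96) {N : Subgroup G}
    (hN : Nat.card N = 3) : Nat.card (G ⧸ N) = 32 := by
  have h1 := Subgroup.card_eq_card_quotient_mul_card_subgroup N
  rw [hG, hN] at h1; omega

theorem mem_of_pow_three_eq_one (hG : Nat.card G = 96) {N : Subgroup G} [N.Normal]
    (hN : Nat.card N = 3) {x : G} (hx : x ^ 3 = 1) : x ∈ N := by
  have h1 : (x : G ⧸ N) ^ 32 = 1 := by
    rw [← card_quotient_of_card_three hG hN]; exact pow_card_eq_one'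
  have h2 : (x : G ⧸ N) ^ 3 = 1 := by rw [← QuotientGroup.mk_pow, hx]; rfl
  have h3 : (x : G ⧸ N) = 1 := by
    -- The exponents come from the Bézout identity `3 · 11 - 32 = 1`.
    calc (x : G ⧸ N) = ((x : G ⧸ N) ^ 3) ^ 11 * ((x : G ⧸ N) ^ 32)⁻¹ := by group
      _ = 1 := by rw [h1, h2]; simp
  exact (QuotientGroup.eq_one_iff x).mp h3

theorem pow_three_of_mem {N : Subgroup G} (hN : Nat.card N = 3) {x : G} (hx : x ∈ N) :
    x ^ 3 = 1 := by
  have : (⟨x, hx⟩ : N) ^ 3 = 1 := by rw [← hN]; exact pow_card_eq_one'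
  exact congrArg Subtype.val this

theorem eq_of_normal_card_three (hG : Nat.card G = 96) {N N' : Subgroup G} [N.Normal]
    (hN : Nat.card N = 3) (hN' : Nat.card N' = 3) : N' = N := by
  have := finite_of_card (by norm_num) hG
  exact Subgroup.eq_of_le_of_card_ge
    (fun x hx => mem_of_pow_three_eq_one hG hN (pow_three_of_mem hN' hx)) (by rw [hN, hN'])

variable {S : KodairaTuple 2 G}

/-- If `N` had even order, the quotient would have order dividing 48, where `z` cannot survive. So
`N` has odd order dividing 96. -/
theorem KodairaTuple.ConjugacyRelations.card_eq_three_of_notMem (hG : Nat.card G = 96)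
    (h : S.ConjugacyRelations) {N : Subgroup G} [N.Normal] (hne : N ≠ ⊥) (hz : S.z ∉ N) :
    Nat.card N = 3 := by
  have := finite_of_card (by norm_num) hG
  have h1 := Subgroup.card_eq_card_quotient_mul_card_subgroup N
  have h2 : ¬ Nat.card (G ⧸ N) ∣ 48 := fun hd => hz ((QuotientGroup.eq_one_iff _).mp
    ((h.map (QuotientGroup.mk' N)).z_eq_one_of_card_dvd hd))
  have h3 : Nat.card N ≠ 1 := fun e => hne (Subgroup.card_eq_one.mp e)
  rw [hG] at h1
  have hodd : ¬ 2 ∣ Nat.card N := by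
    rintro ⟨c, hc⟩
    refine h2 ⟨c, ?_⟩
    have : 2 * 48 = 2 * (Nat.card (G ⧸ N) * c) := by rw [hc] at h1; linarith
    omega
  have h4 : Nat.card N ∣ 2 ^ 5 * 3 := ⟨Nat.card (G ⧸ N), by linarith⟩
  have h5 : Nat.card N ∣ 3 := Nat.Coprime.dvd_of_dvd_mul_left
    (Nat.Coprime.pow_right 5 ((Nat.Prime.coprime_iff_not_dvd Nat.prime_two).mpr hodd).symm) h4
  exact ((Nat.dvd_prime Nat.prime_three).mp h5).resolve_left h3

theorem KodairaTuple.ConjugacyRelations.z_mem_of_card_two (hG : Nat.card G = 96)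
    (h : S.ConjugacyRelations) {Y : Subgroup G} [Y.Normal] (hY : Nat.card Y = 2) : S.z ∈ Y := by
  by_contra hz
  have hne : Y ≠ ⊥ := by rintro rfl; simp at hY
  have := h.card_eq_three_of_notMem hG hne hz
  omega

/-- A non-monolithic group of order `96` with a prestructure has a normal Sylow `3`-subgroup, and
the element `z` is a central involution. -/
theorem KodairaTuple.ConjugacyRelations.exists_normal_card_three (hG : Nat.card G = 96)
    (hmon : ¬ IsMonolithic G) (h : S.ConjugacyRelations) (hz : S.z ≠ 1) :
    (∃ N : Subgroup G, N.Normal ∧ Nat.card N = 3) ∧ (∀ g, Commute S.z g) ∧ orderOf S.z = 2 := by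
  have hfin := finite_of_card (by norm_num) hG
  have hbot : ∀ x : G, x ≠ 1 → ∃ N : Subgroup G, N.Normal ∧ N ≠ ⊥ ∧ x ∉ N := by
    intro x hx
    by_contra hcon
    push Not at hcon
    have hm : x ∈ monolith G := by
      rw [monolith, Subgroup.mem_sInf]
      exact fun N hN => hcon N hN.1 hN.2
    rw [not_not.mp hmon, Subgroup.mem_bot] at hm
    exact hx hm
  obtain ⟨N, hN, hNne, hzN⟩ := hbot _ hz
  have hN3 := h.card_eq_three_of_notMem hG hNne hzN
  obtain ⟨⟨u, huN⟩, hu'⟩ := N.ne_bot_iff_exists_ne_one.mp hNne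
  have hu : u ≠ 1 := fun e => hu' (Subtype.ext e)
  -- `N` misses `z` and `M` misses the generator `u` of `N`, so `N ∩ M` is trivial. As `N` is the
  -- only subgroup of order 3, `M` does not have order 3 and therefore contains `z`. Now `⁅z, g⁆`
  -- and `z ^ 2` lie in `M`, and in `N` by the result for order 32.
  obtain ⟨M, hM, hMne, huM⟩ := hbot _ hu
  have hinf : ∀ x ∈ N, x ∈ M → x = 1 := by
    intro x hxN hxM
    by_contra hx
    have := Fact.mk Nat.prime_three
    have h1 : (⟨x, hxN⟩ : N) ≠ 1 := fun e => hx (congrArg Subtype.val e)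
    have h2 : (⟨u, huN⟩ : N) ∈ Subgroup.zpowers (⟨x, hxN⟩ : N) :=
      mem_zpowers_of_prime_card hN3 h1
    obtain ⟨k, hk⟩ := Subgroup.mem_zpowers_iff.mp h2
    have h3 : x ^ k = u := congrArg Subtype.val hk
    exact huM (h3 ▸ zpow_mem hxM k)
  have hzM : S.z ∈ M := by
    by_contra hzM
    have hM3 := h.card_eq_three_of_notMem hG hMne hzM
    exact huM (eq_of_normal_card_three hG hM3 hN3 ▸ huN)
  have hzbar : (QuotientGroup.mk' N) S.z ≠ 1 := fun e => hzN ((QuotientGroup.eq_one_iff _).mp e)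
  obtain ⟨hc, ho⟩ := (h.map (QuotientGroup.mk' N)).central_of_card_thirtyTwo
    (card_quotient_of_card_three hG hN3) hzbar
  refine ⟨⟨N, hN, hN3⟩, fun g => ?_, ?_⟩
  · rw [← commutatorElement_eq_one_iff_commute]
    refine hinf _ ?_ ?_
    · rw [← QuotientGroup.eq_one_iff]
      exact commutatorElement_eq_one_iff_commute.mpr (hc g)
    · have : ⁅S.z, g⁆ = S.z * (g * S.z⁻¹ * g⁻¹) := by simp only [commutatorElement_def]; group
      rw [this]
      exact mul_mem hzM (hM.conj_mem _ (inv_mem hzM) g)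
  · refine orderOf_eq_prime (hinf _ ?_ (pow_mem hzM 2)) hz
    have h1 := pow_orderOf_eq_one ((QuotientGroup.mk' N) S.z)
    rw [show orderOf ((QuotientGroup.mk' N) S.z) = 2 from ho, ← map_pow] at h1
    exact (QuotientGroup.eq_one_iff _).mp h1

/-- Two of the indices already form a prestructure, so `z` is a central involution. With three or
more indices the bound would require `2 ^ 7 ∣ 96`. -/
theorem KodairaTuple.ConjugacyRelations.genus_le_two {b : ℕ} (hG : Nat.card G = 96)
    (hmon : ¬ IsMonolithic G) {S : KodairaTuple b G} (h : S.ConjugacyRelations) (hz : S.z ≠ 1) :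
    b ≤ 2 := by
  by_contra hb
  have h1 := h.restrict (i := ⟨0, by omega⟩) (k := ⟨1, by omega⟩) (by simp [Fin.lt_def])
  obtain ⟨-, hc, ho⟩ := h1.exists_normal_card_three hG hmon hz
  have h2 := h.orderOf_pow_dvd_card hc
  rw [hG, show orderOf S.z = 2 from ho] at h2
  have h3 : 2 ^ 7 ∣ 2 ^ (2 * b + 1) := pow_dvd_pow 2 (by omega)
  have := h3.trans h2
  norm_num at this

theorem KodairaTuple.ConjugacyRelations.hasExtraSpecialQuotient32 (hG : Nat.card G = 96)
    (h : S.ConjugacyRelations) {N : Subgroup G} [hN : N.Normal] (hN3 : Nat.card N = 3)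
    (hzN : S.z ∉ N) : HasExtraSpecialQuotient32 N :=
  ⟨hN, (h.map (QuotientGroup.mk' N)).isExtraSpecial (card_quotient_of_card_three hG hN3)
    (fun e => hzN ((QuotientGroup.eq_one_iff _).mp e)), card_quotient_of_card_three hG hN3⟩

theorem HasExtraSpecialQuotient32.card_eq_three (hG : Nat.card G = 96) {N : Subgroup G}
    (h : HasExtraSpecialQuotient32 N) : Nat.card N = 3 := by
  obtain ⟨_, -, h1⟩ := h
  have h2 := Subgroup.card_eq_card_quotient_mul_card_subgroup N
  rw [hG, h1] at h2; omega

end Order96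

/-! ### Model groups

Quadratic data consist of a quadratic form on `𝔽₂⁴` together with a linear character. They define a
group of order `96`: an extension by `ℤ/3` of an extension of `𝔽₂⁴` by `ℤ/2`. We use the field
structure of `Bool`, with `+` the exclusive or. -/

/-- A quadratic form on `𝔽₂⁴`, given by its polar form and its values on the basis vectors, and a
linear character. -/
@[ext]
structure QuadraticData where
  /-- the values of the polar form at `01, 02, 03, 12, 13, 23` -/
  a : Fin 6 → Bool
  q : Fin 4 → Bool
  f : Fin 4 → Bool

/-- The automorphism of `ℤ/3` attached to an element of `𝔽₂`. -/
def signOf (x : Bool) : ZMod 3 := cond x (-1) 1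

theorem signOf_zero : signOf 0 = 1 := rfl

theorem signOf_add (x y : Bool) : signOf (x + y) = signOf x * signOf y := by
  revert x y; decide

namespace QuadraticData

variable (D : QuadraticData)

/-- The bilinear form with matrix lower triangular, whose diagonal is `q` and whose
symmetrization has the entries `a`. -/
def bil (v w : Fin 4 → Bool) : Bool :=
  D.q 0 * v 0 * w 0 + D.q 1 * v 1 * w 1 + D.q 2 * v 2 * w 2 + D.q 3 * v 3 * w 3 +
  D.a 0 * v 1 * w 0 + D.a 1 * v 2 * w 0 + D.a 2 * v 3 * w 0 +
  D.a 3 * v 2 * w 1 + D.a 4 * v 3 * w 1 + D.a 5 * v 3 * w 2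

/-- The quadratic form. -/
def quad (v : Fin 4 → Bool) : Bool := D.bil v v

/-- The polar form. -/
def polar (v w : Fin 4 → Bool) : Bool :=
  D.a 0 * (v 0 * w 1 + v 1 * w 0) + D.a 1 * (v 0 * w 2 + v 2 * w 0) +
  D.a 2 * (v 0 * w 3 + v 3 * w 0) + D.a 3 * (v 1 * w 2 + v 2 * w 1) +
  D.a 4 * (v 1 * w 3 + v 3 * w 1) + D.a 5 * (v 2 * w 3 + v 3 * w 2)

/-- The linear character. -/
def char (v : Fin 4 → Bool) : Bool :=
  D.f 0 * v 0 + D.f 1 * v 1 + D.f 2 * v 2 + D.f 3 * v 3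

theorem bil_add_left (v v' w : Fin 4 → Bool) : D.bil (v + v') w = D.bil v w + D.bil v' w := by
  simp only [bil, Pi.add_apply]; ring

theorem bil_add_right (v w w' : Fin 4 → Bool) : D.bil v (w + w') = D.bil v w + D.bil v w' := by
  simp only [bil, Pi.add_apply]; ring

theorem bil_zero_left (w : Fin 4 → Bool) : D.bil 0 w = 0 := by simp [bil]

theorem bil_zero_right (w : Fin 4 → Bool) : D.bil w 0 = 0 := by simp [bil]

theorem char_add (v w : Fin 4 → Bool) : D.char (v + w) = D.char v + D.char w := by
  simp only [char, Pi.add_apply]; ring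

theorem char_zero : D.char 0 = 0 := by simp [char]

/-- In characteristic two the diagonal terms cancel. Since `bil` is the cocycle of the model group,
this identifies commutators with values of the polar form. -/
theorem bil_add_bil_swap (v w : Fin 4 → Bool) : D.bil v w + D.bil w v = D.polar v w := by
  have h : ∀ x : Bool, x + x = 0 := BooleanRing.add_self
  have e : D.bil v w + D.bil w v = D.polar v w +
      ((D.q 0 * v 0 * w 0 + D.q 1 * v 1 * w 1 + D.q 2 * v 2 * w 2 + D.q 3 * v 3 * w 3) +
      (D.q 0 * v 0 * w 0 + D.q 1 * v 1 * w 1 + D.q 2 * v 2 * w 2 + D.q 3 * v 3 * w 3)) := by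
    simp only [bil, polar]; ring
  rw [e, h, add_zero]

theorem polar_comm (v w : Fin 4 → Bool) : D.polar v w = D.polar w v := by
  simp only [polar]; ring

end QuadraticData

/-- The group of order `96` attached to quadratic data. -/
@[ext]
structure ModelGroup (D : QuadraticData) where
  v : Fin 4 → Bool
  s : Bool
  c : ZMod 3

namespace ModelGroup

variable {D : QuadraticData}

instance : Mul (ModelGroup D) :=
  ⟨fun x y => ⟨x.v + y.v, x.s + y.s + D.bil x.v y.v, x.c + signOf (D.char x.v) * y.c⟩⟩

instance : One (ModelGroup D) := ⟨⟨0, 0, 0⟩⟩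

instance : Inv (ModelGroup D) :=
  ⟨fun x => ⟨x.v, x.s + D.bil x.v x.v, - (signOf (D.char x.v) * x.c)⟩⟩

@[simp] theorem mul_v (x y : ModelGroup D) : (x * y).v = x.v + y.v := rfl
@[simp] theorem mul_s (x y : ModelGroup D) : (x * y).s = x.s + y.s + D.bil x.v y.v := rfl
@[simp] theorem mul_c (x y : ModelGroup D) :
    (x * y).c = x.c + signOf (D.char x.v) * y.c := rfl
@[simp] theorem one_v : (1 : ModelGroup D).v = 0 := rfl
@[simp] theorem one_s : (1 : ModelGroup D).s = 0 := rfl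
@[simp] theorem one_c : (1 : ModelGroup D).c = 0 := rfl

instance : Group (ModelGroup D) :=
  Group.ofLeftAxioms
    (fun x y w => by
      ext1
      · simp only [mul_v]; ring
      · simp only [mul_s, mul_v, D.bil_add_left, D.bil_add_right]; ring
      · simp only [mul_c, mul_v, D.char_add, signOf_add]; ring)
    (fun x => by
      ext1
      · simp
      · simp [D.bil_zero_left]
      · simp [D.char_zero, signOf_zero])
    (fun x => by
      have h : ∀ y : Bool, y + y = 0 := BooleanRing.add_self
      ext1
      · funext i; exact h _
      · change x.s + D.bil x.v x.v + x.s + D.bil x.v x.v = 0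
        rw [add_assoc, h]
      · change - (signOf (D.char x.v) * x.c) + signOf (D.char x.v) * x.c = 0
        ring)

@[simp] theorem inv_v (x : ModelGroup D) : (x⁻¹).v = x.v := rfl
@[simp] theorem inv_s (x : ModelGroup D) : (x⁻¹).s = x.s + D.bil x.v x.v := rfl
@[simp] theorem inv_c (x : ModelGroup D) : (x⁻¹).c = - (signOf (D.char x.v) * x.c) := rfl

/-- The underlying set of the model group. -/
def equivProd (D : QuadraticData) : ModelGroup D ≃ (Fin 4 → Bool) × Bool × ZMod 3 where
  toFun x := (x.v, x.s, x.c)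
  invFun x := ⟨x.1, x.2.1, x.2.2⟩
  left_inv _ := rfl
  right_inv _ := rfl

theorem card (D : QuadraticData) : Nat.card (ModelGroup D) = 96 := by
  rw [Nat.card_congr (equivProd D)]; simp

instance : Finite (ModelGroup D) := finite_of_card (by norm_num) (card D)

/-- The central involution. -/
def zed (D : QuadraticData) : ModelGroup D := ⟨0, 1, 0⟩

/-- The generator of the normal subgroup of order three. -/
def cub (D : QuadraticData) : ModelGroup D := ⟨0, 0, 1⟩

theorem commutator_eq (x y : ModelGroup D) : ⁅x, y⁆ =
    ⟨0, D.polar x.v y.v,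
      x.c + signOf (D.char x.v) * y.c - y.c - signOf (D.char y.v) * x.c⟩ := by
  have h : ∀ y : Bool, y + y = 0 := BooleanRing.add_self
  rw [commutatorElement_def, mul_assoc, ← mul_inv_rev, mul_inv_eq_iff_eq_mul]
  ext1
  · simp [add_comm]
  · simp only [mul_s, mul_v, D.bil_zero_left, ← D.bil_add_bil_swap, add_zero]
    have : D.bil x.v y.v + D.bil y.v x.v + (y.s + x.s + D.bil y.v x.v) =
      x.s + y.s + D.bil x.v y.v + (D.bil y.v x.v + D.bil y.v x.v) := by ring
    rw [this, h, add_zero]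
  · simp only [mul_c, D.char_zero, signOf_zero]; ring

theorem zed_commute (x : ModelGroup D) : Commute (zed D) x := by
  rw [← commutatorElement_eq_one_iff_commute, commutator_eq]
  ext1
  · rfl
  · simp [zed, QuadraticData.polar]
  · simp [zed, D.char_zero, signOf_zero]

theorem zed_mul_zed : zed D * zed D = 1 := by
  ext1
  · simp [zed]
  · simp [zed, D.bil_zero_left]; rfl
  · simp [zed]

theorem zed_ne_one : zed D ≠ 1 := fun h => by
  have := congrArg ModelGroup.s h
  simp [zed] at this

end ModelGroup

/-! ### Homomorphisms from model groups -/

section Lift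

variable {G : Type*} [Group G]

/-- The power of a group element with exponent in `𝔽₂`. -/
def bpow (g : G) (b : Bool) : G := cond b g 1

/-- The power of a group element with exponent in `ℤ/3`. -/
def cpow (g : G) (c : ZMod 3) : G := g ^ c.val

@[simp] theorem bpow_zero (g : G) : bpow g 0 = 1 := rfl
@[simp] theorem bpow_one (g : G) : bpow g 1 = g := rfl
@[simp] theorem cpow_zero (g : G) : cpow g 0 = 1 := pow_zero g
@[simp] theorem cpow_one (g : G) : cpow g 1 = g := pow_one g

theorem map_bpow {G' : Type*} [Group G'] (φ : G →* G') (g : G) (b : Bool) :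
    φ (bpow g b) = bpow (φ g) b := by
  cases b
  · exact map_one φ
  · rfl

theorem map_cpow {G' : Type*} [Group G'] (φ : G →* G') (g : G) (c : ZMod 3) :
    φ (cpow g c) = cpow (φ g) c := map_pow φ g _

theorem bpow_add {z : G} (hz : z * z = 1) (a b : Bool) :
    bpow z (a + b) = bpow z a * bpow z b := by
  cases a <;> cases b
  · exact (mul_one _).symm
  · exact (one_mul _).symm
  · exact (mul_one _).symm
  · exact hz.symm

theorem cpow_add {u : G} (hu : u ^ 3 = 1) (c d : ZMod 3) :
    cpow u (c + d) = cpow u c * cpow u d := by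
  rw [cpow, cpow, cpow, ← pow_add, ZMod.val_add, ← pow_eq_pow_mod _ hu]

/-- The elements `g i`, `z`, `u` satisfy the defining relations of the model group. -/
structure LiftRelations (D : QuadraticData) (g : Fin 4 → G) (z u : G) : Prop where
  z_g : ∀ i, Commute z (g i)
  z_u : Commute z u
  z_z : z * z = 1
  u_u : u ^ 3 = 1
  sq : ∀ i, g i * g i = bpow z (D.q i)
  comm₀₁ : ⁅g 0, g 1⁆ = bpow z (D.a 0)
  comm₀₂ : ⁅g 0, g 2⁆ = bpow z (D.a 1)
  comm₀₃ : ⁅g 0, g 3⁆ = bpow z (D.a 2)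
  comm₁₂ : ⁅g 1, g 2⁆ = bpow z (D.a 3)
  comm₁₃ : ⁅g 1, g 3⁆ = bpow z (D.a 4)
  comm₂₃ : ⁅g 2, g 3⁆ = bpow z (D.a 5)
  act : ∀ i, g i * u * (g i)⁻¹ = cond (D.f i) u⁻¹ u

variable {D : QuadraticData} {g : Fin 4 → G} {z u : G}

theorem commute_bpow {x y : G} (h : Commute x y) (a : Bool) : Commute (bpow x a) y := by
  cases a
  · exact Commute.one_left y
  · exact h

theorem bpow_swap (hz : z * z = 1) {x y : G} {a : Bool}
    (h : ⁅x, y⁆ = bpow z a) (v w : Bool) :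
    bpow y v * bpow x w = bpow z (a * v * w) * (bpow x w * bpow y v) := by
  have key : y * x = bpow z a * (x * y) := by
    have h1 : bpow z a * bpow z a = 1 := by
      rw [← bpow_add hz, BooleanRing.add_self, bpow_zero]
    calc y * x = bpow z a * bpow z a * (y * x) := by rw [h1, one_mul]
      _ = bpow z a * (⁅x, y⁆ * (y * x)) := by rw [h, mul_assoc]
      _ = _ := by rw [commutatorElement_def]; group
  cases v <;> cases w
  · change 1 * 1 = bpow z (a * 0 * 0) * (1 * 1); simp
  · change 1 * x = bpow z (a * 0 * 1) * (x * 1); simp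
  · change y * 1 = bpow z (a * 1 * 0) * (1 * y); simp
  · change y * x = bpow z (a * 1 * 1) * (x * y); simpa using key

theorem bpow_merge {x : G} {q : Bool} (h : x * x = bpow z q) (v w : Bool) :
    bpow x v * bpow x w = bpow z (q * v * w) * bpow x (v + w) := by
  cases v <;> cases w
  · change 1 * 1 = bpow z (q * 0 * 0) * 1; simp
  · change 1 * x = bpow z (q * 0 * 1) * x; simp
  · change x * 1 = bpow z (q * 1 * 0) * x; simp
  · change x * x = bpow z (q * 1 * 1) * 1; simpa using h

theorem bpow_cpow (hu : u ^ 3 = 1) {x : G} {f : Bool} (h : x * u * x⁻¹ = cond f u⁻¹ u)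
    (v : Bool) (c : ZMod 3) :
    bpow x v * cpow u c = cpow u (signOf (f * v) * c) * bpow x v := by
  cases v
  · change 1 * cpow u c = cpow u (signOf (f * 0) * c) * 1
    simp [signOf_zero]
  · change x * cpow u c = cpow u (signOf (f * 1) * c) * x
    rw [mul_one, ← mul_inv_eq_iff_eq_mul]
    have h1 : x * cpow u c * x⁻¹ = (x * u * x⁻¹) ^ c.val := by rw [cpow, conj_pow]
    rw [h1, h]
    cases f
    · change u ^ c.val = cpow u (1 * c); rw [one_mul]; rfl
    · change u⁻¹ ^ c.val = cpow u (-1 * c)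
      rw [inv_pow, inv_eq_iff_mul_eq_one]
      change cpow u c * cpow u (-1 * c) = 1
      rw [← cpow_add hu]; simp

namespace LiftRelations

/-- The value of the homomorphism from the model group. -/
def fn (g : Fin 4 → G) (z u : G) (x : ModelGroup D) : G :=
  cpow u x.c * (bpow (g 0) (x.v 0) * (bpow (g 1) (x.v 1) * (bpow (g 2) (x.v 2) *
    bpow (g 3) (x.v 3)))) * bpow z x.s

variable (h : LiftRelations D g z u)

include h

/-- Collection into normal form: moving `g j` past an earlier `g i` costs a power of `z` given by
the polar form, and merging two equal generators costs one given by `q`. The total exponent is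
`bil`, which is why that form is lower triangular. -/
theorem mul_form (v w : Fin 4 → Bool) :
    (bpow (g 0) (v 0) * (bpow (g 1) (v 1) * (bpow (g 2) (v 2) * bpow (g 3) (v 3)))) *
    (bpow (g 0) (w 0) * (bpow (g 1) (w 1) * (bpow (g 2) (w 2) * bpow (g 3) (w 3)))) =
    bpow z (D.bil v w) *
    (bpow (g 0) (v 0 + w 0) * (bpow (g 1) (v 1 + w 1) * (bpow (g 2) (v 2 + w 2) *
      bpow (g 3) (v 3 + w 3)))) := by
  have sw : ∀ {i j : Fin 4} {a : Bool}, ⁅g i, g j⁆ = bpow z a → ∀ (v w : Bool) (k : G),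
      bpow (g j) v * (bpow (g i) w * k) = bpow z (a * v * w) * (bpow (g i) w * (bpow (g j) v * k)) :=
    fun {i j a} e v w k => by
      rw [← mul_assoc, bpow_swap h.z_z e]; simp only [mul_assoc]
  have mg : ∀ (i : Fin 4) (v w : Bool) (k : G),
      bpow (g i) v * (bpow (g i) w * k) = bpow z (D.q i * v * w) * (bpow (g i) (v + w) * k) :=
    fun i v w k => by rw [← mul_assoc, bpow_merge (h.sq i), mul_assoc]
  have mg' := bpow_merge (h.sq 3)
  have mz : ∀ (i : Fin 4) (v a : Bool) (k : G),
      bpow (g i) v * (bpow z a * k) = bpow z a * (bpow (g i) v * k) := fun i v a k => by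
    rw [← mul_assoc, ← (commute_bpow (commute_bpow (h.z_g i).symm v).symm a).eq, mul_assoc]
  have zz : ∀ (a b : Bool) (k : G), bpow z a * (bpow z b * k) = bpow z (a + b) * k :=
    fun a b k => by rw [bpow_add h.z_z, mul_assoc]
  simp only [mul_assoc, sw h.comm₀₁, sw h.comm₀₂, sw h.comm₀₃, sw h.comm₁₂, sw h.comm₁₃,
    sw h.comm₂₃, mg, mg', mz, zz]
  congr 2
  simp only [QuadraticData.bil]
  ring

theorem form_cpow (v : Fin 4 → Bool) (c : ZMod 3) :
    (bpow (g 0) (v 0) * (bpow (g 1) (v 1) * (bpow (g 2) (v 2) * bpow (g 3) (v 3)))) * cpow u c =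
    cpow u (signOf (D.char v) * c) *
    (bpow (g 0) (v 0) * (bpow (g 1) (v 1) * (bpow (g 2) (v 2) * bpow (g 3) (v 3)))) := by
  have mv : ∀ (i : Fin 4) (v : Bool) (c : ZMod 3) (k : G),
      bpow (g i) v * (cpow u c * k) = cpow u (signOf (D.f i * v) * c) * (bpow (g i) v * k) :=
    fun i v c k => by rw [← mul_assoc, bpow_cpow h.u_u (h.act i), mul_assoc]
  simp only [mul_assoc, bpow_cpow h.u_u (h.act 3), mv, QuadraticData.char, signOf_add]

/-- The homomorphism from the model group determined by elements which satisfy its defining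
relations. -/
def lift : ModelGroup D →* G :=
  MonoidHom.mk' (fn g z u) fun x y => by
    have e1 := h.mul_form x.v y.v
    have e2 := h.form_cpow x.v y.c
    simp only [fn, ModelGroup.mul_v, ModelGroup.mul_s, ModelGroup.mul_c, Pi.add_apply,
      cpow_add h.u_u, bpow_add h.z_z]
    generalize bpow (g 0) (x.v 0 + y.v 0) * (bpow (g 1) (x.v 1 + y.v 1) *
      (bpow (g 2) (x.v 2 + y.v 2) * bpow (g 3) (x.v 3 + y.v 3))) = XY at *
    generalize hX : bpow (g 0) (x.v 0) * (bpow (g 1) (x.v 1) * (bpow (g 2) (x.v 2) *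
      bpow (g 3) (x.v 3))) = X at *
    generalize hY : bpow (g 0) (y.v 0) * (bpow (g 1) (y.v 1) * (bpow (g 2) (y.v 2) *
      bpow (g 3) (y.v 3))) = Y at *
    have zg : ∀ (a b : Bool) (i : Fin 4), Commute (bpow z a) (bpow (g i) b) := fun a b i =>
      commute_bpow (commute_bpow (h.z_g i).symm b).symm a
    have hzY : ∀ a, Commute (bpow z a) Y := fun a => by
      rw [← hY]
      exact (zg a _ 0).mul_right ((zg a _ 1).mul_right ((zg a _ 2).mul_right (zg a _ 3)))
    have hzX : ∀ a, Commute (bpow z a) X := fun a => by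
      rw [← hX]
      exact (zg a _ 0).mul_right ((zg a _ 1).mul_right ((zg a _ 2).mul_right (zg a _ 3)))
    have hzu : ∀ a c, Commute (bpow z a) (cpow u c) := fun a c =>
      commute_bpow (h.z_u.pow_right _) a
    have hzz : ∀ a b, Commute (bpow z a) (bpow z b) := fun a b =>
      commute_bpow (commute_bpow (Commute.refl z) b).symm a
    calc cpow u x.c * cpow u (signOf (D.char x.v) * y.c) * XY *
          (bpow z x.s * bpow z y.s * bpow z (D.bil x.v y.v))
        = cpow u x.c * (cpow u (signOf (D.char x.v) * y.c) *
          (bpow z (D.bil x.v y.v) * XY)) * (bpow z x.s * bpow z y.s) := by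
          have hzXY : Commute (bpow z (D.bil x.v y.v)) XY := by
            have e3 : XY = (bpow z (D.bil x.v y.v))⁻¹ * (X * Y) := by rw [e1]; group
            rw [e3]
            exact (Commute.refl _).inv_right.mul_right ((hzX _).mul_right (hzY _))
          rw [hzXY.eq, ← ((hzz _ x.s).mul_right (hzz _ y.s)).eq]
          simp only [mul_assoc]
      _ = cpow u x.c * (X * cpow u y.c * Y) * (bpow z x.s * bpow z y.s) := by
          rw [← e1, e2]; simp only [mul_assoc]
      _ = cpow u x.c * X * (cpow u y.c * Y * bpow z x.s) * bpow z y.s := by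
          simp only [mul_assoc]
      _ = cpow u x.c * X * (bpow z x.s * (cpow u y.c * Y)) * bpow z y.s := by
          rw [((hzu x.s y.c).mul_right (hzY x.s)).eq]
      _ = _ := by simp only [mul_assoc]

omit h in
theorem lift_apply (h : LiftRelations D g z u) (x : ModelGroup D) : h.lift x = fn g z u x := rfl

end LiftRelations

end Lift

/-! ### Change of basis -/

namespace QuadraticData

/-- The linear combination of four vectors. -/
def comb (t : Fin 4 → Bool) (v : Fin 4 → Fin 4 → Bool) : Fin 4 → Bool := fun j =>
  t 0 * v 0 j + t 1 * v 1 j + t 2 * v 2 j + t 3 * v 3 j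

/-- The standard basis. -/
def stdBasis (i : Fin 4) : Fin 4 → Bool := Pi.single i 1

variable (D : QuadraticData)

theorem comb_stdBasis (t : Fin 4 → Bool) : comb t stdBasis = t := by
  funext j
  fin_cases j <;> simp [comb, stdBasis]

theorem stdBasis_comb (v : Fin 4 → Fin 4 → Bool) (i : Fin 4) : comb (stdBasis i) v = v i := by
  funext j
  fin_cases i <;> simp [comb, stdBasis]

theorem comb_add (t t' : Fin 4 → Bool) (v : Fin 4 → Fin 4 → Bool) :
    comb (t + t') v = comb t v + comb t' v := by
  funext j
  simp only [comb, Pi.add_apply]; ring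

theorem polar_comb_left (t : Fin 4 → Bool) (v : Fin 4 → Fin 4 → Bool) (w : Fin 4 → Bool) :
    D.polar (comb t v) w = t 0 * D.polar (v 0) w + t 1 * D.polar (v 1) w +
      t 2 * D.polar (v 2) w + t 3 * D.polar (v 3) w := by
  simp only [polar, comb]; ring

theorem char_comb (t : Fin 4 → Bool) (v : Fin 4 → Fin 4 → Bool) :
    D.char (comb t v) = t 0 * D.char (v 0) + t 1 * D.char (v 1) +
      t 2 * D.char (v 2) + t 3 * D.char (v 3) := by
  simp only [char, comb]; ring

/-- The quadratic data of four vectors. -/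
def pull (v : Fin 4 → Fin 4 → Bool) : QuadraticData where
  a := ![D.polar (v 0) (v 1), D.polar (v 0) (v 2), D.polar (v 0) (v 3),
    D.polar (v 1) (v 2), D.polar (v 1) (v 3), D.polar (v 2) (v 3)]
  q i := D.quad (v i)
  f i := D.char (v i)

theorem pull_stdBasis : D.pull stdBasis = D := by
  ext i
  · fin_cases i <;> simp [pull, polar, stdBasis]
  · fin_cases i <;> simp [pull, quad, bil, stdBasis]
  · fin_cases i <;> simp [pull, char, stdBasis]

theorem polar_pull (v : Fin 4 → Fin 4 → Bool) (t t' : Fin 4 → Bool) :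
    (D.pull v).polar t t' = D.polar (comb t v) (comb t' v) := by
  have hs : ∀ w, D.polar w w = 0 := fun w => by
    rw [← D.bil_add_bil_swap]; exact BooleanRing.add_self _
  rw [D.polar_comb_left]
  simp only [D.polar_comm _ (comb t' v), D.polar_comb_left, hs]
  rw [D.polar_comm (v 1) (v 0), D.polar_comm (v 2) (v 0), D.polar_comm (v 3) (v 0),
    D.polar_comm (v 2) (v 1), D.polar_comm (v 3) (v 1), D.polar_comm (v 3) (v 2)]
  simp only [polar, pull, Matrix.cons_val]
  ring

/-- Four vectors are linearly independent. -/
def Independent (v : Fin 4 → Fin 4 → Bool) : Prop := ∀ t, comb t v = 0 → t = 0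

theorem Independent.surjective {v : Fin 4 → Fin 4 → Bool} (h : Independent v)
    (w : Fin 4 → Bool) : ∃ t, comb t v = w := by
  have hinj : Function.Injective fun t => comb t v := by
    intro t t' e
    have h1 : comb (t + t') v = 0 := by
      rw [comb_add, show comb t v = comb t' v from e]
      funext j; exact BooleanRing.add_self _
    funext j
    have h2 : t j + t' j = 0 := congrFun (h _ h1) j
    have h3 : t j = - t' j := eq_neg_of_add_eq_zero_left h2
    rwa [BooleanRing.neg_eq] at h3
  exact (Finite.injective_iff_surjective.mp hinj) w

/-- The Pfaffian of the polar form. -/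
def pf : Bool := D.a 0 * D.a 5 + D.a 1 * D.a 4 + D.a 2 * D.a 3

/-- The basis dual to the standard basis with respect to a non-degenerate polar form. -/
def dual (j : Fin 4) : Fin 4 → Bool :=
  ![![0, D.a 5, D.a 4, D.a 3], ![D.a 5, 0, D.a 2, D.a 1],
    ![D.a 4, D.a 2, 0, D.a 0], ![D.a 3, D.a 1, D.a 0, 0]] j

variable {D}

/-- An alternating form with vanishing Pfaffian is degenerate; a radical vector is found by
exhausting the 64 coefficient vectors. -/
theorem exists_radical (h : D.pf = 0) :
    ∃ t : Fin 4 → Bool, t ≠ 0 ∧ ∀ w, D.polar t w = 0 := by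
  have key : ∀ a b c d e f : Bool, a * f + b * e + c * d = 0 → ∃ t₀ t₁ t₂ t₃ : Bool,
      ¬ (t₀ = 0 ∧ t₁ = 0 ∧ t₂ = 0 ∧ t₃ = 0) ∧
      a * t₁ + b * t₂ + c * t₃ = 0 ∧ a * t₀ + d * t₂ + e * t₃ = 0 ∧
      b * t₀ + d * t₁ + f * t₃ = 0 ∧ c * t₀ + e * t₁ + f * t₂ = 0 := by decide +kernel
  obtain ⟨t₀, t₁, t₂, t₃, hne, h0, h1, h2, h3⟩ := key _ _ _ _ _ _ h
  refine ⟨![t₀, t₁, t₂, t₃], fun e => hne ?_, fun w => ?_⟩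
  · exact ⟨congrFun e 0, congrFun e 1, congrFun e 2, congrFun e 3⟩
  · simp only [polar, Matrix.cons_val]
    calc _ = w 0 * (D.a 0 * t₁ + D.a 1 * t₂ + D.a 2 * t₃) +
          w 1 * (D.a 0 * t₀ + D.a 3 * t₂ + D.a 4 * t₃) +
          w 2 * (D.a 1 * t₀ + D.a 3 * t₁ + D.a 5 * t₃) +
          w 3 * (D.a 2 * t₀ + D.a 4 * t₁ + D.a 5 * t₂) := by ring
      _ = 0 := by rw [h0, h1, h2, h3]; simp

/-- The vectors `dual j` are the columns of the Pfaffian adjoint of the Gram matrix; their pairings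
with the basis are the Pfaffian on the diagonal and 0 elsewhere. -/
theorem polar_stdBasis_dual (h : D.pf = 1) (i j : Fin 4) :
    D.polar (stdBasis i) (D.dual j) = if i = j then 1 else 0 := by
  have h' : D.a 0 * D.a 5 + D.a 1 * D.a 4 + D.a 2 * D.a 3 = 1 := h
  fin_cases i <;> fin_cases j <;> simp [polar, stdBasis, dual] <;>
    first
      | exact h'
      | (rw [← h']; ring)

theorem eq_of_polar_stdBasis (h : D.pf = 1) {w w' : Fin 4 → Bool}
    (hw : ∀ i, D.polar (stdBasis i) w = D.polar (stdBasis i) w') : w = w' := by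
  have key : ∀ w : Fin 4 → Bool, w = comb ![D.polar (stdBasis 0) w, D.polar (stdBasis 1) w,
      D.polar (stdBasis 2) w, D.polar (stdBasis 3) w] D.dual := by
    intro w
    have h' : D.a 0 * D.a 5 + D.a 1 * D.a 4 + D.a 2 * D.a 3 = 1 := h
    funext j
    fin_cases j <;> simp [comb, polar, stdBasis, dual] <;> revert h' <;>
      generalize D.a 0 = a <;> generalize D.a 1 = b <;> generalize D.a 2 = c <;>
      generalize D.a 3 = d <;> generalize D.a 4 = e <;> generalize D.a 5 = f <;>
      generalize w 0 = w₀ <;> generalize w 1 = w₁ <;> generalize w 2 = w₂ <;>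
      generalize w 3 = w₃ <;>
      revert a b c d e f w₀ w₁ w₂ w₃ <;> decide +kernel
  rw [key w, key w', hw, hw, hw, hw]

theorem independent_of_polar {v w : Fin 4 → Fin 4 → Bool}
    (h : ∀ i j, D.polar (v i) (w j) = if i = j then 1 else 0) : Independent v := by
  intro t ht
  funext j
  have h1 := D.polar_comb_left t v (w j)
  have h0 : D.polar 0 (w j) = 0 := by simp [polar]
  rw [ht, h0] at h1
  simp only [h] at h1
  fin_cases j <;> simpa using h1.symm

/-- Having a dual family makes `v` a basis, so a radical vector of the pulled-back form would pair
to zero with the dual family, and its coordinates would vanish. -/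
theorem pf_pull {v w : Fin 4 → Fin 4 → Bool}
    (h : ∀ i j, D.polar (v i) (w j) = if i = j then 1 else 0) : (D.pull v).pf = 1 := by
  by_contra hne
  have h0 : (D.pull v).pf = 0 := by
    cases e : (D.pull v).pf
    · rfl
    · exact absurd e hne
  obtain ⟨t, ht, hrad⟩ := exists_radical h0
  refine ht (funext fun j => ?_)
  obtain ⟨t', ht'⟩ := (independent_of_polar h).surjective (w j)
  have h1 := hrad t'
  rw [polar_pull, ht', D.polar_comb_left] at h1
  simp only [h] at h1
  fin_cases j <;> simpa using h1

end QuadraticData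

namespace LiftRelations

open QuadraticData

variable {G : Type*} [Group G] {D : QuadraticData} {g : Fin 4 → G} {z u : G}
  (h : LiftRelations D g z u)

theorem lift_vertical (b : Bool) (c : ZMod 3) :
    h.lift ⟨0, b, c⟩ = cpow u c * bpow z b := by
  simp [lift_apply, fn]

theorem lift_stdBasis (i : Fin 4) : h.lift ⟨stdBasis i, 0, 0⟩ = g i := by
  have e : ∀ j, bpow (g j) (stdBasis i j) = if j = i then g j else 1 := fun j => by
    by_cases hj : j = i
    · subst hj; simp [stdBasis]
    · simp [stdBasis, hj]
  simp only [lift_apply, fn, e]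
  fin_cases i <;> simp

end LiftRelations

namespace ModelGroup

open QuadraticData

variable {D : QuadraticData}

/-- The lift of a vector. -/
def ofVec (D : QuadraticData) (v : Fin 4 → Bool) (s : Bool) : ModelGroup D := ⟨v, s, 0⟩

theorem bpow_zed (b : Bool) : bpow (zed D) b = ⟨0, b, 0⟩ := by cases b <;> rfl

theorem bpow_ofVec (v : Fin 4 → Bool) (s b : Bool) :
    bpow (ofVec D v s) b = ⟨fun j => b * v j, b * s, 0⟩ := by
  cases b
  · ext1
    · funext j; exact (zero_mul _).symm
    · exact (zero_mul _).symm
    · rfl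
  · ext1
    · funext j; exact (one_mul _).symm
    · exact (one_mul _).symm
    · rfl

theorem cub_pow (n : ℕ) : cub D ^ n = ⟨0, 0, n⟩ := by
  induction n with
  | zero => ext1 <;> simp
  | succ n ih =>
    rw [pow_succ, ih]
    ext1
    · simp [cub]
    · simp [cub, D.bil_zero_left]
    · simp [cub, D.char_zero, signOf_zero]

theorem cpow_cub (c : ZMod 3) : cpow (cub D) c = ⟨0, 0, c⟩ := by
  rw [cpow, cub_pow, ZMod.natCast_zmod_val]

/-- The lifts may carry arbitrary signs `s i`: central involutions do not affect squares,
commutators or the action on the subgroup of order 3. -/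
theorem liftRelations_pull (v : Fin 4 → Fin 4 → Bool) (s : Fin 4 → Bool) :
    LiftRelations (D.pull v) (fun i => ofVec D (v i) (s i)) (zed D) (cub D) := by
  have hc : ∀ (v w : Fin 4 → Bool) (s t : Bool),
      ⁅ofVec D v s, ofVec D w t⁆ = bpow (zed D) (D.polar v w) := fun v w s t => by
    rw [commutator_eq, bpow_zed]; simp [ofVec]
  refine ⟨fun i => zed_commute _, zed_commute _, zed_mul_zed, ?_, fun i => ?_,
    hc _ _ _ _, hc _ _ _ _, hc _ _ _ _, hc _ _ _ _, hc _ _ _ _, hc _ _ _ _, fun i => ?_⟩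
  · ext1
    · simp [cub, pow_succ]
    · simp [cub, pow_succ, D.bil_zero_left]
    · simp only [cub, pow_succ, pow_zero, one_mul, mul_c, mul_v, add_zero, D.char_zero,
        signOf_zero, one_c]
      decide
  · rw [bpow_zed]
    ext1
    · funext j; exact BooleanRing.add_self _
    · change s i + s i + D.bil (v i) (v i) = D.quad (v i)
      rw [BooleanRing.add_self, zero_add]; rfl
    · simp [ofVec]
  · rw [mul_inv_eq_iff_eq_mul]
    change _ = cond (D.char (v i)) (cub D)⁻¹ (cub D) * _
    cases e : D.char (v i)
    all_goals
      ext1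
      · simp [ofVec, cub]
      · simp [ofVec, cub, D.bil_zero_left, D.bil_zero_right]
      · simp [ofVec, cub, D.char_zero, signOf_zero, e, show signOf true = -1 from rfl,
          show signOf false = 1 from rfl]

variable (D) in
theorem fn_eq (v : Fin 4 → Fin 4 → Bool) (s : Fin 4 → Bool) {D' : QuadraticData}
    (x : ModelGroup D') :
    (LiftRelations.fn (fun i => ofVec D (v i) (s i)) (zed D) (cub D) x).v = comb x.v v ∧
    (LiftRelations.fn (fun i => ofVec D (v i) (s i)) (zed D) (cub D) x).c = x.c := by
  simp only [LiftRelations.fn, bpow_zed, bpow_ofVec, cpow_cub, mul_v, mul_c]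
  refine ⟨?_, by simp⟩
  funext j
  simp [comb, add_assoc]

theorem fn_stdBasis (x : ModelGroup D) :
    LiftRelations.fn (fun i => ofVec D (stdBasis i) 0) (zed D) (cub D) x = x := by
  have h := fn_eq D stdBasis 0 x
  ext1
  · exact h.1.trans (comb_stdBasis _)
  · simp only [LiftRelations.fn, bpow_zed, bpow_ofVec, cpow_cub, mul_s, mul_v]
    simp [bil, stdBasis]
  · exact h.2

/-- The homomorphism between model groups given by a change of variables. -/
def pullHom (D : QuadraticData) (v : Fin 4 → Fin 4 → Bool) (s : Fin 4 → Bool) :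
    ModelGroup (D.pull v) →* ModelGroup D :=
  (liftRelations_pull v s).lift

theorem pullHom_v (v : Fin 4 → Fin 4 → Bool) (s : Fin 4 → Bool) (x : ModelGroup (D.pull v)) :
    (pullHom D v s x).v = comb x.v v := (fn_eq D v s x).1

theorem pullHom_c (v : Fin 4 → Fin 4 → Bool) (s : Fin 4 → Bool) (x : ModelGroup (D.pull v)) :
    (pullHom D v s x).c = x.c := (fn_eq D v s x).2

theorem pullHom_vertical (v : Fin 4 → Fin 4 → Bool) (s : Fin 4 → Bool) (b : Bool) (c : ZMod 3) :
    pullHom D v s ⟨0, b, c⟩ = ⟨0, b, c⟩ := by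
  rw [pullHom, LiftRelations.lift_apply]
  simp only [LiftRelations.fn, bpow_zed, cpow_cub]
  ext1 <;> simp [bil_zero_left, char_zero, signOf_zero]

theorem pullHom_stdBasis (v : Fin 4 → Fin 4 → Bool) (s : Fin 4 → Bool) (i : Fin 4) :
    pullHom D v s (ofVec _ (stdBasis i) 0) = ofVec D (v i) (s i) :=
  (liftRelations_pull v s).lift_stdBasis i

theorem pullHom_injective {v : Fin 4 → Fin 4 → Bool} (hv : Independent v) (s : Fin 4 → Bool) :
    Function.Injective (pullHom D v s) := by
  rw [injective_iff_map_eq_one]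
  intro x hx
  have h1 : x.v = 0 := hv _ (by rw [← pullHom_v v s, hx]; rfl)
  obtain ⟨_, b, c⟩ := x
  obtain rfl : _ = 0 := h1
  rw [pullHom_vertical] at hx
  have hs : b = 0 := congrArg ModelGroup.s hx
  have hc : c = 0 := congrArg ModelGroup.c hx
  rw [hs, hc]; rfl

/-- Independent vectors give an isomorphism of model groups. -/
noncomputable def pullEquiv (D : QuadraticData) {v : Fin 4 → Fin 4 → Bool} (hv : Independent v)
    (s : Fin 4 → Bool) : ModelGroup (D.pull v) ≃* ModelGroup D :=
  MulEquiv.ofBijective (pullHom D v s) ((Nat.bijective_iff_injective_and_card _).mpr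
    ⟨pullHom_injective hv s, by rw [card, card]⟩)

theorem pullEquiv_apply {v : Fin 4 → Fin 4 → Bool} (hv : Independent v) (s : Fin 4 → Bool)
    (x : ModelGroup (D.pull v)) : pullEquiv D hv s x = pullHom D v s x := rfl

/-- The normal subgroup of order three. -/
def cubSubgroup (D : QuadraticData) : Subgroup (ModelGroup D) where
  carrier := {x | x.v = 0 ∧ x.s = 0}
  one_mem' := ⟨rfl, rfl⟩
  mul_mem' {x y} hx hy := ⟨by simp [hx.1, hy.1], by simp [hx.1, hx.2, hy.2, D.bil_zero_left]⟩
  inv_mem' {x} hx := ⟨hx.1, by simp [hx.1, hx.2, D.bil_zero_left]⟩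

theorem mem_cubSubgroup {x : ModelGroup D} : x ∈ cubSubgroup D ↔ x.v = 0 ∧ x.s = 0 := Iff.rfl

theorem add_self_vec (v : Fin 4 → Bool) : v + v = 0 := by
  funext j; exact BooleanRing.add_self _

instance : (cubSubgroup D).Normal := by
  refine ⟨fun x hx g => ⟨?_, ?_⟩⟩
  · simp [hx.1, add_self_vec]
  · simp only [mul_s, mul_v, inv_s, inv_v, hx.1, hx.2, D.bil_zero_right, add_zero]
    have : g.s + (g.s + D.bil g.v g.v) + D.bil g.v g.v =
      (g.s + g.s) + (D.bil g.v g.v + D.bil g.v g.v) := by ring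
    rw [this, BooleanRing.add_self, BooleanRing.add_self, add_zero]

theorem card_cubSubgroup : Nat.card (cubSubgroup D) = 3 := by
  have e : cubSubgroup D ≃ ZMod 3 :=
    { toFun := fun x => x.1.c
      invFun := fun c => ⟨⟨0, 0, c⟩, rfl, rfl⟩
      left_inv := fun x => Subtype.ext (ModelGroup.ext x.2.1.symm x.2.2.symm rfl)
      right_inv := fun _ => rfl }
  rw [Nat.card_congr e]; simp

theorem orderOf_zed : orderOf (zed D) = 2 :=
  orderOf_eq_prime (by rw [pow_two, zed_mul_zed]) zed_ne_one

instance normal_zpowers_zed : (Subgroup.zpowers (zed D)).Normal := by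
  refine ⟨fun x hx g => ?_⟩
  rwa [← (commute_of_mem_zpowers zed_commute hx g).eq, mul_inv_cancel_right]

/-- The monolith lies in two normal subgroups of coprime orders, 2 and 3. -/
theorem not_isMonolithic : ¬ IsMonolithic (ModelGroup D) := by
  rw [IsMonolithic, not_not, eq_bot_iff]
  intro x hx
  have h1 : x ∈ cubSubgroup D := by
    refine Subgroup.mem_sInf.mp hx _ ⟨inferInstance, fun e => ?_⟩
    have := card_cubSubgroup (D := D)
    rw [e] at this; simp at this
  have h2 : x ∈ Subgroup.zpowers (zed D) := by
    refine Subgroup.mem_sInf.mp hx _ ⟨inferInstance, fun e => ?_⟩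
    exact zed_ne_one (Subgroup.zpowers_eq_bot.mp e)
  rw [Subgroup.mem_bot]
  refine (mem_zpowers_of_orderOf_two orderOf_zed h2).resolve_right fun e => ?_
  have := h1.2
  rw [e] at this
  exact absurd this (by simp [zed])

end ModelGroup

theorem KodairaTuple.ConjugacyRelations.z_eq_zed {D : QuadraticData}
    {S : KodairaTuple 2 (ModelGroup D)} (h : S.ConjugacyRelations) (hz : S.z ≠ 1) :
    S.z = ModelGroup.zed D :=
  (mem_zpowers_of_orderOf_two ModelGroup.orderOf_zed
    (h.z_mem_of_card_two (ModelGroup.card D)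
      (by rw [Nat.card_zpowers, ModelGroup.orderOf_zed]))).resolve_left hz

/-! ### Prestructures on model groups -/

namespace KodairaTuple

/-- The tuple with `(r₁₁, t₁₁, r₁₂, t₁₂) = a` and `(t₂₁, r₂₁, t₂₂, r₂₂) = b`. -/
def ofPairs {G : Type*} (a b : Fin 4 → G) (z : G) : KodairaTuple 2 G :=
  ⟨![a 0, a 2], ![a 1, a 3], ![b 1, b 3], ![b 0, b 2], z⟩

/-- The sequence `(r₁₁, t₁₁, r₁₂, t₁₂)`. -/
def fst {G : Type*} (S : KodairaTuple 2 G) : Fin 4 → G := ![S.r₁ 0, S.t₁ 0, S.r₁ 1, S.t₁ 1]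

/-- The sequence `(t₂₁, r₂₁, t₂₂, r₂₂)`. -/
def snd {G : Type*} (S : KodairaTuple 2 G) : Fin 4 → G := ![S.t₂ 0, S.r₂ 0, S.t₂ 1, S.r₂ 1]

theorem ofPairs_fst_snd {G : Type*} (S : KodairaTuple 2 G) : ofPairs S.fst S.snd S.z = S := by
  ext j
  iterate 4 (fin_cases j <;> rfl)
  rfl

theorem map_ofPairs {G G' : Type*} (φ : G → G') (a b : Fin 4 → G) (z : G) :
    (ofPairs a b z).map φ = ofPairs (fun i => φ (a i)) (fun i => φ (b i)) (φ z) := by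
  ext j
  iterate 4 (fin_cases j <;> rfl)
  rfl

theorem ofPairs_injective {G : Type*} {a b a' b' : Fin 4 → G} {z z' : G}
    (h : ofPairs a b z = ofPairs a' b' z') : a = a' ∧ b = b' ∧ z = z' := by
  have h1 := congrArg fst h
  have h2 := congrArg snd h
  refine ⟨?_, ?_, congrArg KodairaTuple.z h⟩
  · funext i
    have := congrFun h1 i
    fin_cases i <;> exact this
  · funext i
    have := congrFun h2 i
    fin_cases i <;> exact this

variable {G : Type*} [Group G]

theorem smul_eq_map {b : ℕ} (α : MulAut G) (S : KodairaTuple b G) : α • S = S.map α := rfl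

theorem map_map {b : ℕ} {G G' G'' : Type*} (φ : G → G') (ψ : G' → G'') (S : KodairaTuple b G) :
    (S.map φ).map ψ = S.map (fun x => ψ (φ x)) := rfl

/-- For a central involution the whole list of relations is duality of two families, in the order
chosen in `ofPairs`. -/
theorem conjugacyRelations_ofPairs_iff {a b : Fin 4 → G} {z : G} (hz : ∀ g, Commute z g)
    (hzz : z * z = 1) :
    (ofPairs a b z).ConjugacyRelations ↔ ∀ i j, ⁅a i, b j⁆ = if i = j then z else 1 := by
  have hinv : z⁻¹ = z := inv_eq_of_mul_eq_one_left hzz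
  constructor
  · intro h i j
    let ι : Fin 4 → Fin 2 ⊕ Fin 2 := ![Sum.inl 0, Sum.inr 0, Sum.inl 1, Sum.inr 1]
    have ha : ∀ i, a i = Sum.elim (ofPairs a b z).r₁ (ofPairs a b z).t₁ (ι i) := by
      intro i; fin_cases i <;> rfl
    have hb : ∀ i, b i = Sum.elim (ofPairs a b z).t₂ (ofPairs a b z).r₂ (ι i) := by
      intro i; fin_cases i <;> rfl
    rw [ha, hb]
    by_cases hij : i = j
    · subst hij
      rcases h.pairing_eq hz (ι i) with e | e <;> rw [e, if_pos rfl]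
      · rfl
      · exact hinv
    · rw [if_neg hij, h.pairing_ne hz _ _ ?_]
      intro e
      apply hij
      revert e
      have : Function.Injective ι := by decide
      exact fun e => this e
  · intro h
    have hc : ∀ g : G, ⁅g, z⁆ = 1 := fun g => commutatorElement_eq_one_iff_commute.mpr (hz g).symm
    have cz : ∀ g : G, g⁻¹ * z * g = z := fun g => by
      rw [← (hz g⁻¹).eq, inv_mul_cancel_right]
    have cz' : ∀ x y : G, z⁻¹ * x * y⁻¹ * z * y * x⁻¹ = 1 := fun x y => by
      rw [mul_assoc _ z y, (hz y).eq, hinv]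
      calc z * x * y⁻¹ * (y * z) * x⁻¹ = z * (x * z) * x⁻¹ := by group
        _ = z * z := by rw [← (hz x).eq]; group
        _ = 1 := hzz
    have cz'' : ∀ x y : G,
        x⁻¹ * z * x * z⁻¹ * y * z * x⁻¹ * z⁻¹ * x * y⁻¹ = 1 := fun x y => by
      rw [cz]
      calc z * z⁻¹ * y * z * x⁻¹ * z⁻¹ * x * y⁻¹ = y * z * (x⁻¹ * z⁻¹ * x) * y⁻¹ := by group
        _ = 1 := by rw [hinv, cz, mul_assoc y, hzz]; group
    have h' : ∀ i j, i ≠ j → ⁅a i, b j⁆ = 1 := fun i j hij => by rw [h, if_neg hij]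
    have h'' : ∀ i, ⁅a i, b i⁆ = z := fun i => by rw [h, if_pos rfl]
    constructor <;> intro j
    · intro k hjk; fin_cases j <;> fin_cases k <;> exact h' _ _ (by decide)
    · fin_cases j <;> exact h' _ _ (by decide)
    · intro k hjk
      rw [show (ofPairs a b z).z = z from rfl, cz']
      fin_cases j <;> fin_cases k <;> exact h' _ _ (by decide)
    · intro k hjk; fin_cases j <;> fin_cases k <;> first | exact h' _ _ (by decide) | simp at hjk
    · rw [show (ofPairs a b z).z = z from rfl, hinv]
      fin_cases j <;> exact h'' _
    · intro k hjk
      rw [show (ofPairs a b z).z = z from rfl, hinv,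
        commutatorElement_eq_one_iff_commute.mpr (hz _)]
      fin_cases j <;> fin_cases k <;> first | exact h' _ _ (by decide) | simp at hjk
    · rw [show (ofPairs a b z).z = z from rfl, hc, hc]
    · intro k hjk; fin_cases j <;> fin_cases k <;> first | exact h' _ _ (by decide) | simp at hjk
    · rw [show (ofPairs a b z).z = z from rfl, cz]
      fin_cases j <;> exact h'' _
    · intro k hjk
      rw [show (ofPairs a b z).z = z from rfl, hc]
      fin_cases j <;> fin_cases k <;> first | exact h' _ _ (by decide) | simp at hjk
    · intro k hjk; fin_cases j <;> fin_cases k <;> exact h' _ _ (by decide)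
    · rw [show (ofPairs a b z).z = z from rfl, hc]
      fin_cases j <;> exact h' _ _ (by decide)
    · intro k hjk
      rw [show (ofPairs a b z).z = z from rfl, cz'']
      fin_cases j <;> fin_cases k <;> exact h' _ _ (by decide)
    · rw [show (ofPairs a b z).z = z from rfl, hc, hc]

theorem exists_isPrestructure_iff [Finite G] {S : KodairaTuple 2 G} :
    (∃ n, IsPrestructure n S) ↔ S.z ≠ 1 ∧ S.ConjugacyRelations := by
  constructor
  · rintro ⟨n, h⟩
    refine ⟨fun e => ?_, h.conjugacy⟩
    have h1 := h.order_z
    have h2 := h.two_le_type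
    rw [e, orderOf_one] at h1
    omega
  · rintro ⟨hz, h⟩
    refine ⟨orderOf S.z, ?_, rfl, h⟩
    have h1 := orderOf_pos S.z
    have h2 : orderOf S.z ≠ 1 := fun e => hz (orderOf_eq_one_iff.mp e)
    omega

end KodairaTuple

/-! ### Reduction of prestructures to standard tuples. -/

namespace ModelGroup

open KodairaTuple QuadraticData

variable {D D' : QuadraticData}

/-- The standard tuple in a model group. -/
def stdTuple (D : QuadraticData) (s : Fin 4 → Bool) (c d : Fin 4 → ZMod 3) :
    KodairaTuple 2 (ModelGroup D) :=
  ofPairs (fun i => ⟨stdBasis i, 0, c i⟩) (fun j => ⟨D.dual j, s j, d j⟩) (zed D)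

/-- The condition on the components of order three of a prestructure. -/
def Admissible (D : QuadraticData) (c d : Fin 4 → ZMod 3) : Prop := D.f = 0 ∨ c = 0 ∧ d = 0

theorem char_eq_zero (h : D.f = 0) (v : Fin 4 → Bool) : D.char v = 0 := by
  simp [QuadraticData.char, h]

theorem stdTuple_conjugacyRelations (h : D.pf = 1) (s : Fin 4 → Bool) {c d : Fin 4 → ZMod 3}
    (hcd : Admissible D c d) : (stdTuple D s c d).ConjugacyRelations := by
  refine (conjugacyRelations_ofPairs_iff zed_commute zed_mul_zed).mpr fun i j => ?_
  rw [commutator_eq]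
  have e : (c i + signOf (D.char (stdBasis i)) * d j - d j -
      signOf (D.char (D.dual j)) * c i) = 0 := by
    rcases hcd with hf | ⟨rfl, rfl⟩
    · simp [char_eq_zero hf, signOf_zero]
    · simp
  simp only [e, polar_stdBasis_dual h]
  split_ifs <;> rfl

theorem mk_eq_mul (v : Fin 4 → Bool) (s : Bool) (c : ZMod 3) :
    (⟨v, s, c⟩ : ModelGroup D) = ⟨0, 0, c⟩ * ⟨v, s, 0⟩ := by
  ext1
  · simp
  · simp [D.bil_zero_left]
  · simp

theorem pullHom_mk_stdBasis (v : Fin 4 → Fin 4 → Bool) (s : Fin 4 → Bool) (i : Fin 4)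
    (c : ZMod 3) : pullHom D v s ⟨stdBasis i, 0, c⟩ = ⟨v i, s i, c⟩ := by
  have h := pullHom_stdBasis (D := D) v s i
  rw [ofVec, ofVec] at h
  rw [mk_eq_mul, map_mul, pullHom_vertical, h, ← mk_eq_mul]

/-- A prestructure on a model group without components of order three, up to those allowed, is
carried to a standard tuple by a change of variables. -/
theorem exists_stdTuple_of_admissible {a b : Fin 4 → ModelGroup D}
    (h : ∀ i j, ⁅a i, b j⁆ = if i = j then zed D else 1)
    (hcd : Admissible D (fun i => (a i).c) fun i => (b i).c) :
    ∃ (D' : QuadraticData) (e : ModelGroup D' ≃* ModelGroup D) (s : Fin 4 → Bool)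
      (c d : Fin 4 → ZMod 3), D'.pf = 1 ∧ Admissible D' c d ∧
      (stdTuple D' s c d).map e = ofPairs a b (zed D) := by
  have hp : ∀ i j, D.polar (a i).v (b j).v = if i = j then 1 else 0 := fun i j => by
    have := congrArg ModelGroup.s (h i j)
    rw [commutator_eq] at this
    rw [show D.polar (a i).v (b j).v = _ from this]
    split_ifs <;> rfl
  set v : Fin 4 → Fin 4 → Bool := fun i => (a i).v with hv
  have hind := independent_of_polar hp
  have hpf : (D.pull v).pf = 1 := pf_pull hp
  have he := pullEquiv_apply (D := D) hind fun i => (a i).s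
  generalize pullEquiv D hind (fun i => (a i).s) = e at he
  refine ⟨D.pull v, e, fun j => (e.symm (b j)).s, fun i => (a i).c,
    fun i => (b i).c, hpf, ?_, ?_⟩
  · refine hcd.imp_left fun hf => ?_
    funext i
    exact char_eq_zero hf _
  · have h1 : ∀ i, e ⟨stdBasis i, 0, (a i).c⟩ = a i := fun i =>
      (he _).trans (pullHom_mk_stdBasis v (fun i => (a i).s) i (a i).c)
    have h2 : ∀ j, (⟨(D.pull v).dual j, (e.symm (b j)).s, (b j).c⟩ : ModelGroup (D.pull v)) =
        e.symm (b j) := by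
      intro j
      have e1 : e (e.symm (b j)) = b j := e.apply_symm_apply _
      rw [he] at e1
      have e2 : comb (e.symm (b j)).v v = (b j).v := by
        rw [← pullHom_v, e1]
      have e3 : (e.symm (b j)).c = (b j).c := by
        rw [← pullHom_c (D := D) v (fun i => (a i).s), e1]
      have e4 : (e.symm (b j)).v = (D.pull v).dual j := by
        refine eq_of_polar_stdBasis hpf fun i => ?_
        rw [polar_stdBasis_dual hpf, polar_pull, stdBasis_comb, e2]
        exact hp i j
      exact ModelGroup.ext e4.symm rfl e3.symm
    have h3 : e (zed (D.pull v)) = zed D := (he _).trans (pullHom_vertical _ _ 1 0)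
    rw [stdTuple, map_ofPairs, h3]
    congr 1
    · funext i; exact h1 i
    · funext j; rw [h2, e.apply_symm_apply]

/-- A family with a dual family is a basis, and a non-zero character cannot vanish on a basis. -/
theorem exists_char_ne_zero {v w : Fin 4 → Fin 4 → Bool} (hf : D.f ≠ 0)
    (hp : ∀ i j, D.polar (v i) (w j) = if i = j then 1 else 0) : ∃ i, D.char (v i) = 1 := by
  by_contra hcon
  push Not at hcon
  have h0 : ∀ i, D.char (v i) = 0 := fun i => by
    have := hcon i
    revert this
    cases D.char (v i)
    · exact fun _ => rfl
    · exact fun h => absurd rfl h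
  apply hf
  funext i
  obtain ⟨t, ht⟩ := (independent_of_polar hp).surjective (stdBasis i)
  have h1 := D.char_comb t v
  rw [ht] at h1
  simp only [h0, mul_zero, add_zero] at h1
  fin_cases i <;> simpa [QuadraticData.char, stdBasis] using h1

theorem add_self_eq_zero_iff (x : ZMod 3) (h : x + x = 0) : x = 0 := by
  revert x; decide

/-- Every prestructure on a model group is carried to a standard tuple by a change of variables
and an inner automorphism. -/
theorem exists_stdTuple {S : KodairaTuple 2 (ModelGroup D)} (h : S.ConjugacyRelations)
    (hz : S.z ≠ 1) :
    ∃ (α : MulAut (ModelGroup D)) (D' : QuadraticData) (e : ModelGroup D' ≃* ModelGroup D)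
      (s : Fin 4 → Bool) (c d : Fin 4 → ZMod 3), D'.pf = 1 ∧ Admissible D' c d ∧
      (stdTuple D' s c d).map e = α • S := by
  have hzed := h.z_eq_zed hz
  have key : ∀ T : KodairaTuple 2 (ModelGroup D), T.ConjugacyRelations → T.z = zed D →
      ∀ i j, ⁅T.fst i, T.snd j⁆ = if i = j then zed D else 1 := fun T hT hzT => by
    rw [← ofPairs_fst_snd T, hzT] at hT
    exact (conjugacyRelations_ofPairs_iff zed_commute zed_mul_zed).mp hT
  by_cases hf : D.f = 0
  · obtain ⟨D', e, s, c, d, h1, h2, h3⟩ :=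
      exists_stdTuple_of_admissible (key S h hzed) (Or.inl hf)
    rw [← hzed, ofPairs_fst_snd] at h3
    exact ⟨1, D', e, s, c, d, h1, h2, h3⟩
  have hp : ∀ T : KodairaTuple 2 (ModelGroup D), T.ConjugacyRelations → T.z = zed D →
      ∀ i j, D.polar (T.fst i).v (T.snd j).v = if i = j then 1 else 0 := fun T hT hzT i j => by
    have := congrArg ModelGroup.s (key T hT hzT i j)
    rw [commutator_eq] at this
    rw [show D.polar (T.fst i).v (T.snd j).v = _ from this]
    split_ifs <;> rfl
  obtain ⟨i, hi⟩ := exists_char_ne_zero hf (hp S h hzed)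
  -- Entry `i` inverts the subgroup of order 3, so conjugation by an element with component `k` adds
  -- `2k` to its component. With `k` equal to the component itself the result is `3k = 0`.
  let α : MulAut (ModelGroup D) := MulAut.conj ⟨0, 0, (S.fst i).c⟩
  have hα : (α • S).ConjugacyRelations := h.map α.toMonoidHom
  have hαz : (α • S).z = zed D := by
    change α S.z = zed D
    rw [hzed, MulAut.conj_apply, ← (zed_commute _).eq, mul_inv_cancel_right]
  have hfst : (α • S).fst i = α (S.fst i) := by fin_cases i <;> rfl
  have hαv : ((α • S).fst i).v = (S.fst i).v := by
    rw [hfst, MulAut.conj_apply]; simp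
  have hαc : ((α • S).fst i).c = 0 := by
    rw [hfst, MulAut.conj_apply]
    simp only [mul_c, mul_v, inv_c, D.char_zero, signOf_zero, zero_add, hi,
      show signOf 1 = -1 from rfl]
    generalize (S.fst i).c = x
    revert x; decide
  have hk := key _ hα hαz
  -- All commutators between the halves have no component in `ℤ/3`. Against the inverting entry with
  -- component 0 this reads `-2d = 0`. An inverting entry of the second half then clears the first
  -- half in the same way.
  have hd : ∀ j, ((α • S).snd j).c = 0 := fun j => by
    have := congrArg ModelGroup.c (hk i j)
    rw [commutator_eq] at this
    simp only [hαc, hαv, hi, show signOf 1 = -1 from rfl] at this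
    have h0 : (if i = j then zed D else 1).c = 0 := by split_ifs <;> rfl
    rw [h0] at this
    refine add_self_eq_zero_iff _ ?_
    linear_combination -this
  obtain ⟨j, hj⟩ := exists_char_ne_zero (v := fun j => ((α • S).snd j).v)
    (w := fun j => ((α • S).fst j).v) hf (fun i j => by
      rw [D.polar_comm, hp _ hα hαz]; simp only [eq_comm])
  have hc : ∀ i, ((α • S).fst i).c = 0 := fun i => by
    have := congrArg ModelGroup.c (hk i j)
    rw [commutator_eq] at this
    simp only [hd, hj, show signOf 1 = -1 from rfl] at this
    have h0 : (if i = j then zed D else 1).c = 0 := by split_ifs <;> rfl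
    rw [h0] at this
    refine add_self_eq_zero_iff _ ?_
    linear_combination this
  obtain ⟨D', e, s, c, d, h1, h2, h3⟩ :=
    exists_stdTuple_of_admissible hk (Or.inr ⟨funext hc, funext hd⟩)
  rw [← hαz, ofPairs_fst_snd] at h3
  exact ⟨α, D', e, s, c, d, h1, h2, h3⟩

end ModelGroup

/-! ### Rigidity of standard tuples. -/

namespace ModelGroup

open KodairaTuple QuadraticData

variable {D D' : QuadraticData}

theorem liftRelations_stdBasis (D : QuadraticData) :
    LiftRelations D (fun i => ofVec D (stdBasis i) 0) (zed D) (cub D) := by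
  have h := liftRelations_pull (D := D) stdBasis 0
  rw [pull_stdBasis] at h
  exact h

theorem bpow_zed_injective {a b : Bool} (h : bpow (zed D) a = bpow (zed D) b) : a = b := by
  rw [bpow_zed, bpow_zed] at h
  exact congrArg ModelGroup.s h

theorem vertical_eq_pow (c : ZMod 3) : (⟨0, 0, c⟩ : ModelGroup D) = cub D ^ c.val := by
  rw [cub_pow, ZMod.natCast_zmod_val]

/-- The exponent 9 is 0 modulo 3 and 1 modulo 4, so on these elements the ninth power is the
projection to the 2-part. -/
theorem pow_nine (v : Fin 4 → Bool) (s : Bool) {c : ZMod 3} (h : D.f = 0 ∨ c = 0) :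
    (⟨v, s, c⟩ : ModelGroup D) ^ 9 = ⟨v, s, 0⟩ := by
  have h1 : (⟨0, 0, c⟩ : ModelGroup D) ^ 3 = 1 :=
    pow_three_of_mem card_cubSubgroup (mem_cubSubgroup.mpr ⟨rfl, rfl⟩)
  have h2 : (⟨v, s, 0⟩ : ModelGroup D) ^ 2 = ⟨0, D.bil v v, 0⟩ := by
    rw [pow_two]
    ext1
    · exact add_self_vec v
    · change s + s + D.bil v v = D.bil v v
      rw [BooleanRing.add_self, zero_add]
    · simp
  have h4 : (⟨v, s, 0⟩ : ModelGroup D) ^ 4 = 1 := by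
    rw [show 4 = 2 * 2 from rfl, pow_mul, h2, pow_two]
    ext1
    · simp
    · change D.bil v v + D.bil v v + D.bil 0 0 = 0
      rw [BooleanRing.add_self, D.bil_zero_left, add_zero]
    · simp
  have hc : Commute (⟨0, 0, c⟩ : ModelGroup D) ⟨v, s, 0⟩ := by
    rw [← commutatorElement_eq_one_iff_commute, commutator_eq]
    ext1
    · rfl
    · simp [polar]
    · rcases h with hf | rfl
      · simp [char_eq_zero hf, signOf_zero]
      · simp
  rw [mk_eq_mul, hc.mul_pow, show 9 = 3 * 3 from rfl, pow_mul, h1, one_pow, one_mul]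
  calc (⟨v, s, 0⟩ : ModelGroup D) ^ (3 * 3) = (⟨v, s, 0⟩ ^ 4) ^ 2 * ⟨v, s, 0⟩ := by group
    _ = _ := by rw [h4, one_pow, one_mul]

/-- The subgroup of order 3 consists of all solutions of `x ^ 3 = 1`, so isomorphisms preserve it
and act on it by a sign. -/
theorem map_cub (e : ModelGroup D ≃* ModelGroup D') : ∃ k : ZMod 3, (k = 1 ∨ k = -1) ∧
    ∀ c, e ⟨0, 0, c⟩ = ⟨0, 0, k * c⟩ := by
  have h1 : e (cub D) ∈ cubSubgroup D' := by
    refine mem_of_pow_three_eq_one (card D') card_cubSubgroup ?_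
    rw [← map_pow, pow_three_of_mem (card_cubSubgroup (D := D)) (mem_cubSubgroup.mpr ⟨rfl, rfl⟩),
      map_one]
  have h2 : e (cub D) = ⟨0, 0, (e (cub D)).c⟩ := ModelGroup.ext h1.1 h1.2 rfl
  refine ⟨(e (cub D)).c, ?_, fun c => ?_⟩
  · have : (e (cub D)).c ≠ 0 := by
      intro h0
      rw [h0] at h2
      have h3 : cub D = 1 := by rw [← map_eq_one_iff e e.injective, h2]; rfl
      exact absurd (congrArg ModelGroup.c h3) (by simp [cub])
    revert this
    generalize (e (cub D)).c = k
    revert k; decide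
  · rw [vertical_eq_pow, map_pow, h2]
    have : ∀ n : ℕ, (⟨0, 0, (e (cub D)).c⟩ : ModelGroup D') ^ n = ⟨0, 0, (e (cub D)).c * n⟩ := by
      intro n
      induction n with
      | zero => ext1 <;> simp
      | succ n ih =>
        rw [pow_succ, ih]
        ext1
        · simp
        · simp [D'.bil_zero_left]
        · simp only [mul_c, D'.char_zero, signOf_zero]; push_cast; ring
    rw [this, ZMod.natCast_zmod_val]

/-- The standard tuple determines its parameters up to a common sign. -/
theorem stdTuple_injective {s s' : Fin 4 → Bool} {c d c' d' : Fin 4 → ZMod 3}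
    (hcd : Admissible D c d) (hcd' : Admissible D' c' d') (e : ModelGroup D ≃* ModelGroup D')
    (h : (stdTuple D s c d).map e = stdTuple D' s' c' d') :
    D = D' ∧ s = s' ∧ ((c', d') = (c, d) ∨ (c', d') = -(c, d)) := by
  rw [stdTuple, map_ofPairs] at h
  obtain ⟨h1, h2, h3⟩ := ofPairs_injective h
  -- Ninth powers remove the components in `ℤ/3`, so `e` matches the standard lifts of the basis.
  -- Commutators, squares and the action on order 3 then recover `a`, `q` and `f`.
  have hx : ∀ i, e (ofVec D (stdBasis i) 0) = ofVec D' (stdBasis i) 0 := fun i => by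
    have h4 : e ⟨stdBasis i, 0, c i⟩ ^ 9 = ⟨stdBasis i, 0, c' i⟩ ^ 9 :=
      congrArg (· ^ 9) (congrFun h1 i)
    rw [← map_pow, pow_nine _ _ (hcd.imp_right fun h => congrFun h.1 i),
      pow_nine _ _ (hcd'.imp_right fun h => congrFun h.1 i)] at h4
    exact h4
  obtain ⟨k, hk, hcub⟩ := map_cub e
  have hL := liftRelations_stdBasis D
  have hL' := liftRelations_stdBasis D'
  have hb : ∀ b, e (bpow (zed D) b) = bpow (zed D') b := fun b => by
    rw [← h3]; exact map_bpow e.toMonoidHom _ b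
  have hcomm : ∀ i j a a', ⁅ofVec D (stdBasis i) 0, ofVec D (stdBasis j) 0⁆ = bpow (zed D) a →
      ⁅ofVec D' (stdBasis i) 0, ofVec D' (stdBasis j) 0⁆ = bpow (zed D') a' → a = a' := by
    intro i j a a' h5 h6
    have := congrArg e h5
    rw [map_commutatorElement, hx, hx, h6, hb] at this
    exact (bpow_zed_injective this).symm
  have hD : D = D' := by
    ext i
    · fin_cases i
      · exact hcomm _ _ _ _ hL.comm₀₁ hL'.comm₀₁
      · exact hcomm _ _ _ _ hL.comm₀₂ hL'.comm₀₂
      · exact hcomm _ _ _ _ hL.comm₀₃ hL'.comm₀₃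
      · exact hcomm _ _ _ _ hL.comm₁₂ hL'.comm₁₂
      · exact hcomm _ _ _ _ hL.comm₁₃ hL'.comm₁₃
      · exact hcomm _ _ _ _ hL.comm₂₃ hL'.comm₂₃
    · have h5 := congrArg e (hL.sq i)
      rw [map_mul, hx, hb] at h5
      exact bpow_zed_injective (h5.symm.trans (hL'.sq i))
    · have h5 : ∀ (D : QuadraticData) (c : ZMod 3),
          ofVec D (stdBasis i) 0 * ⟨0, 0, c⟩ * (ofVec D (stdBasis i) 0)⁻¹ =
            ⟨0, 0, signOf (D.f i) * c⟩ := by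
        intro D c
        have hf : D.char (stdBasis i) = D.f i := by
          fin_cases i <;> simp [QuadraticData.char, stdBasis]
        rw [mul_inv_eq_iff_eq_mul]
        ext1
        · simp [ofVec]
        · simp [ofVec, D.bil_zero_left, D.bil_zero_right]
        · simp [ofVec, hf]
      have h6 := congrArg e (h5 D 1)
      rw [map_mul, map_mul, map_inv, hx, hcub, hcub, h5] at h6
      have h7 : signOf (D'.f i) * (k * 1) = k * (signOf (D.f i) * 1) := congrArg ModelGroup.c h6
      revert h7 hk
      generalize D.f i = x
      generalize D'.f i = y
      clear * -
      revert k x y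
      decide
  subst hD
  -- Once the data agree, `e` fixes the lifts of the basis and `zed`, so the only freedom left is
  -- the sign `k`.
  have hall : ∀ v s c, e ⟨v, s, c⟩ = ⟨v, s, k * c⟩ := by
    intro v s c
    rw [mk_eq_mul, map_mul, hcub, mk_eq_mul v s (k * c)]
    congr 1
    have h4 := fn_stdBasis (⟨v, s, 0⟩ : ModelGroup D)
    have h5 : e (LiftRelations.fn (fun i => ofVec D (stdBasis i) 0) (zed D) (cub D)
        (⟨v, s, 0⟩ : ModelGroup D)) = LiftRelations.fn (fun i => ofVec D (stdBasis i) 0) (zed D)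
        (cub D) (⟨v, s, 0⟩ : ModelGroup D) := by
      have hm : ∀ x b, e (bpow x b) = bpow (e x) b := fun x b => map_bpow e.toMonoidHom x b
      simp only [LiftRelations.fn, cpow_zero, one_mul, map_mul, hb, hm, hx]
    rwa [h4] at h5
  have hc' : ∀ i, c' i = k * c i := fun i => by
    have : e ⟨stdBasis i, 0, c i⟩ = ⟨stdBasis i, 0, c' i⟩ := congrFun h1 i
    rw [hall] at this
    exact (congrArg ModelGroup.c this).symm
  have hd' : ∀ i, s i = s' i ∧ d' i = k * d i := fun i => by
    have : e ⟨D.dual i, s i, d i⟩ = ⟨D.dual i, s' i, d' i⟩ := congrFun h2 i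
    rw [hall] at this
    exact ⟨congrArg ModelGroup.s this, (congrArg ModelGroup.c this).symm⟩
  refine ⟨rfl, funext fun i => (hd' i).1, ?_⟩
  rcases hk with rfl | rfl
  · left
    exact Prod.ext (funext fun i => (hc' i).trans (one_mul _))
      (funext fun i => (hd' i).2.trans (one_mul _))
  · right
    exact Prod.ext (funext fun i => by simp [hc' i]) (funext fun i => by simp [(hd' i).2])

/-- The automorphism inverting the normal subgroup of order three. -/
def invertCub (D : QuadraticData) : MulAut (ModelGroup D) where
  toFun x := ⟨x.v, x.s, -x.c⟩
  invFun x := ⟨x.v, x.s, -x.c⟩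
  left_inv x := by ext1 <;> simp
  right_inv x := by ext1 <;> simp
  map_mul' x y := by
    ext1
    · rfl
    · rfl
    · simp only [mul_c]; ring

theorem stdTuple_neg (s : Fin 4 → Bool) (c d : Fin 4 → ZMod 3) :
    (stdTuple D s c d).map (invertCub D) = stdTuple D s (-c) (-d) := by
  rw [stdTuple, map_ofPairs]
  have : invertCub D (zed D) = zed D := ModelGroup.ext rfl rfl neg_zero
  rw [this]
  rfl

/-! ### Orbits of tuples -/

/-- The components of order three. -/
abbrev CubicPart := (Fin 4 → ZMod 3) × (Fin 4 → ZMod 3)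

/-- A choice of representatives of pairs of opposite elements. -/
noncomputable def signRepresentatives : Set CubicPart :=
  {x | Fintype.equivFin CubicPart x ≤ Fintype.equivFin CubicPart (-x)}

theorem mem_or_neg_mem_signRepresentatives (x : CubicPart) :
    x ∈ signRepresentatives ∨ -x ∈ signRepresentatives := by
  simp only [signRepresentatives, Set.mem_ofPred_eq, neg_neg]
  exact le_total _ _

theorem eq_of_mem_signRepresentatives {x : CubicPart} (h : x ∈ signRepresentatives)
    (h' : -x ∈ signRepresentatives) : -x = x := by
  simp only [signRepresentatives, Set.mem_ofPred_eq, neg_neg] at h h'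
  exact (Fintype.equivFin CubicPart).injective (le_antisymm h' h)

theorem eq_zero_of_neg_eq {x : CubicPart} (h : -x = x) : x = 0 := by
  have key : ∀ a : ZMod 3, -a = a → a = 0 := by decide
  refine Prod.ext (funext fun i => ?_) (funext fun i => ?_)
  · exact key _ (congrFun (congrArg Prod.fst h) i)
  · exact key _ (congrFun (congrArg Prod.snd h) i)

theorem zero_mem_signRepresentatives : (0 : CubicPart) ∈ signRepresentatives := by
  simp [signRepresentatives]

/-- There are `3 ^ 8 = 6561` components, and only 0 is its own opposite, so the number of
representatives is `(6561 + 1) / 2`. -/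
theorem ncard_signRepresentatives : signRepresentatives.ncard = 3281 := by
  have hu : signRepresentatives ∪ -signRepresentatives = Set.univ :=
    Set.eq_univ_of_forall fun x => (mem_or_neg_mem_signRepresentatives x).imp id Set.mem_neg.mpr
  have hi : signRepresentatives ∩ -signRepresentatives = {0} := by
    ext x
    constructor
    · rintro ⟨h, h'⟩
      exact eq_zero_of_neg_eq (eq_of_mem_signRepresentatives h (Set.mem_neg.mp h'))
    · rintro rfl
      exact ⟨zero_mem_signRepresentatives,
        Set.mem_neg.mpr (by rw [neg_zero]; exact zero_mem_signRepresentatives)⟩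
  have h1 := Set.ncard_union_add_ncard_inter signRepresentatives (-signRepresentatives)
  have h2 : (-signRepresentatives).ncard = signRepresentatives.ncard := by
    rw [← Set.image_neg_eq_neg]
    exact Set.ncard_image_of_injective _ neg_injective
  rw [hu, hi, h2, Set.ncard_univ, Set.ncard_singleton] at h1
  have h3 : Nat.card CubicPart = 6561 := by
    rw [Nat.card_eq_fintype_card]
    simp [ZMod.card]
  omega

end ModelGroup

/-! ### Orbits and their parameters. -/

namespace ModelGroup

open KodairaTuple QuadraticData

variable {D D' : QuadraticData}

theorem commutator_cub (x : ModelGroup D) : ⁅x, cub D⁆ = ⟨0, 0, signOf (D.char x.v) - 1⟩ := by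
  rw [commutator_eq]
  ext1
  · rfl
  · simp [cub, polar]
  · simp only [cub, D.char_zero, signOf_zero]; ring

theorem f_eq_zero_iff : D.f = 0 ↔ ∀ x : ModelGroup D, Commute x (cub D) := by
  constructor
  · intro h x
    rw [← commutatorElement_eq_one_iff_commute, commutator_cub, char_eq_zero h, signOf_zero, sub_self]
    rfl
  · intro h
    funext i
    have h1 := congrArg ModelGroup.c
      ((commutator_cub _).symm.trans
        (commutatorElement_eq_one_iff_commute.mpr (h (ofVec D (stdBasis i) 0))))
    have h2 : D.char (stdBasis i) = D.f i := by
      fin_cases i <;> simp [QuadraticData.char, stdBasis]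
    have h3 : signOf (D.f i) - 1 = 0 := by rw [← h2]; exact h1
    revert h3
    change _ → D.f i = false
    generalize D.f i = y
    revert y; decide

/-- Vanishing of `f` means that the subgroup of order 3 is central, a property preserved by
isomorphisms. -/
theorem f_eq_zero_of_equiv (e : ModelGroup D ≃* ModelGroup D') (h : D.f = 0) : D'.f = 0 := by
  rw [f_eq_zero_iff] at h ⊢
  intro x
  obtain ⟨k, hk, hcub⟩ := map_cub e.symm
  have h1 : Commute (e.symm x) (e.symm (cub D')) := by
    rw [show cub D' = ⟨0, 0, 1⟩ from rfl, hcub, vertical_eq_pow]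
    exact (h _).pow_right _
  exact (commute_map_iff e.symm.injective).mp h1

variable {G : Type*} [Group G]

/-- The tuples of `G` isomorphic to a given standard tuple. -/
def stdOrbit (G : Type*) [Group G] (x : QuadraticData × (Fin 4 → Bool) × CubicPart) :
    Set (KodairaTuple 2 G) :=
  {S | ∃ e : ModelGroup x.1 ≃* G, S = (stdTuple x.1 x.2.1 x.2.2.1 x.2.2.2).map e}

theorem orbit_eq_stdOrbit {x : QuadraticData × (Fin 4 → Bool) × CubicPart}
    {S : KodairaTuple 2 G} (h : S ∈ stdOrbit G x) : MulAction.orbit (MulAut G) S = stdOrbit G x := by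
  obtain ⟨e, rfl⟩ := h
  ext T
  constructor
  · rintro ⟨α, rfl⟩
    exact ⟨e.trans α, rfl⟩
  · rintro ⟨e', rfl⟩
    refine ⟨e.symm.trans e', ?_⟩
    change ((stdTuple x.1 x.2.1 x.2.2.1 x.2.2.2).map e).map (e.symm.trans e') = _
    rw [map_map]
    simp

/-- The parameters of standard tuples isomorphic to tuples of `G`, with a choice of sign. -/
def parameters (G : Type*) [Group G] : Set (QuadraticData × (Fin 4 → Bool) × CubicPart) :=
  {x | x.1.pf = 1 ∧ Nonempty (ModelGroup x.1 ≃* G) ∧ Admissible x.1 x.2.2.1 x.2.2.2 ∧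
    x.2.2 ∈ signRepresentatives}

/-- Rigidity leaves only a common sign undetermined, and the choice of representatives fixes it. -/
theorem stdOrbit_injOn : Set.InjOn (stdOrbit G) (parameters G) := by
  rintro ⟨D, s, c, d⟩ ⟨-, ⟨e⟩, ha, hr⟩ ⟨D', s', c', d'⟩ ⟨-, -, ha', hr'⟩ h
  have h1 : (stdTuple D s c d).map e ∈ stdOrbit G (D', s', c', d') := by
    rw [← h]; exact ⟨e, rfl⟩
  obtain ⟨e', he'⟩ := h1
  have h2 : (stdTuple D s c d).map (e.trans e'.symm) = stdTuple D' s' c' d' := by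
    change ((stdTuple D s c d).map e).map e'.symm = _
    rw [he', map_map]
    simp [KodairaTuple.map]
  obtain ⟨rfl, rfl, h3 | h3⟩ := stdTuple_injective ha ha' _ h2
  · rw [h3]
  · have h4 : -(c, d) = (c, d) := eq_of_mem_signRepresentatives hr (h3 ▸ hr')
    rw [h4] at h3
    rw [h3]

theorem exists_mem_parameters (e₀ : ModelGroup D ≃* G) {S : KodairaTuple 2 G}
    (hz : S.z ≠ 1) (h : S.ConjugacyRelations) : ∃ x ∈ parameters G, S ∈ stdOrbit G x := by
  have h1 : (S.map e₀.symm).ConjugacyRelations := h.map e₀.symm.toMonoidHom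
  have h2 : (S.map e₀.symm).z ≠ 1 := fun e => hz ((map_eq_one_iff _ e₀.symm.injective).mp e)
  obtain ⟨α, D', e, s, c, d, hpf, had, heq⟩ := exists_stdTuple h1 h2
  have h3 : S = (stdTuple D' s c d).map ((e.trans α.symm).trans e₀) := by
    have h4 : (((stdTuple D' s c d).map e).map α.symm).map e₀ = S := by
      rw [heq, smul_eq_map, map_map, map_map]
      simp [KodairaTuple.map]
    exact h4.symm
  rcases mem_or_neg_mem_signRepresentatives (c, d) with hr | hr
  · exact ⟨(D', s, c, d), ⟨hpf, ⟨(e.trans α.symm).trans e₀⟩, had, hr⟩, _, h3⟩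
  -- If the opposite components are the chosen ones, the automorphism inverting the subgroup of
  -- order 3 is composed in.
  · refine ⟨(D', s, -c, -d), ⟨hpf, ⟨(e.trans α.symm).trans e₀⟩, ?_, hr⟩,
      (invertCub D').trans ((e.trans α.symm).trans e₀), ?_⟩
    · exact had.imp_right fun h => ⟨by simp [h.1], by simp [h.2]⟩
    · rw [h3]
      conv_lhs => rw [show c = - -c by simp, show d = - -d by simp, ← stdTuple_neg]
      rfl

/-- The orbits of tuples correspond to parameters of standard tuples. -/
theorem numberUpToAut_eq (e₀ : ModelGroup D ≃* G) {P : KodairaTuple 2 G → Prop}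
    (hP : ∀ S, P S → S.z ≠ 1 ∧ S.ConjugacyRelations) {Q : QuadraticData → Prop}
    {K : Set CubicPart} (hK : ∀ (D' : QuadraticData) (e : ModelGroup D' ≃* G)
      (s : Fin 4 → Bool) (c d : Fin 4 → ZMod 3), D'.pf = 1 →
      (Admissible D' c d ∧ (c, d) ∈ signRepresentatives ∧ P ((stdTuple D' s c d).map e) ↔
        Q D' ∧ (c, d) ∈ K)) :
    numberUpToAut P =
      {D' : QuadraticData | D'.pf = 1 ∧ Nonempty (ModelGroup D' ≃* G) ∧ Q D'}.ncard *
        (16 * K.ncard) := by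
  -- The parameter set is a product; its middle factor, the signs of the lifts of the dual basis, is
  -- unrestricted and yields the 16.
  set A : Set (QuadraticData × (Fin 4 → Bool) × CubicPart) :=
    {D' : QuadraticData | D'.pf = 1 ∧ Nonempty (ModelGroup D' ≃* G) ∧ Q D'} ×ˢ
      ((Set.univ : Set (Fin 4 → Bool)) ×ˢ K) with hA
  have hsub : A ⊆ parameters G := by
    rintro ⟨D', s, c, d⟩ ⟨⟨hpf, ⟨e⟩, hQ⟩, -, hk⟩
    obtain ⟨h1, h2, -⟩ := (hK D' e s c d hpf).mpr ⟨hQ, hk⟩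
    exact ⟨hpf, ⟨e⟩, h1, h2⟩
  have himg : {O : Set (KodairaTuple 2 G) | ∃ S, P S ∧ O = MulAction.orbit (MulAut G) S} =
      stdOrbit G '' A := by
    ext O
    constructor
    · rintro ⟨S, hS, rfl⟩
      obtain ⟨⟨D', s, c, d⟩, hx, hSx⟩ := exists_mem_parameters e₀ (hP S hS).1 (hP S hS).2
      refine ⟨_, ?_, (orbit_eq_stdOrbit hSx).symm⟩
      obtain ⟨hpf, hne, had, hr⟩ := hx
      obtain ⟨e, rfl⟩ := hSx
      obtain ⟨hQ, hk⟩ := (hK D' e s c d hpf).mp ⟨had, hr, hS⟩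
      exact ⟨⟨hpf, hne, hQ⟩, trivial, hk⟩
    · rintro ⟨⟨D', s, c, d⟩, ⟨⟨hpf, ⟨e⟩, hQ⟩, -, hk⟩, rfl⟩
      obtain ⟨-, -, h3⟩ := (hK D' e s c d hpf).mpr ⟨hQ, hk⟩
      exact ⟨_, h3, (orbit_eq_stdOrbit ⟨e, rfl⟩).symm⟩
  rw [numberUpToAut, himg, (stdOrbit_injOn.mono hsub).ncard_image, hA, Set.ncard_prod,
    Set.ncard_prod, Set.ncard_univ]
  simp

end ModelGroup

/-! ### Diagonal double Kodaira structures -/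

namespace KodairaTuple

variable {b : ℕ} {G G' : Type*} [Group G] [Group G']

theorem generates_map_iff (e : G ≃* G') (S : KodairaTuple b G) :
    (S.map e).Generates ↔ S.Generates := by
  have h : (Set.range (S.map e).r₁ ∪ Set.range (S.map e).t₁ ∪ Set.range (S.map e).r₂ ∪
      Set.range (S.map e).t₂ ∪ {(S.map e).z}) = e.toMonoidHom '' (Set.range S.r₁ ∪
      Set.range S.t₁ ∪ Set.range S.r₂ ∪ Set.range S.t₂ ∪ {S.z}) := by
    simp only [Set.image_union, ← Set.range_comp, Set.image_singleton]
    rfl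
  rw [Generates, h, ← MonoidHom.map_closure]
  constructor
  · intro h
    exact (Subgroup.map_injective e.injective) (h.trans (Subgroup.map_top_of_surjective _
      e.surjective).symm)
  · intro h
    rw [h]
    exact Subgroup.map_top_of_surjective _ e.surjective

theorem surfaceRelations_map_iff (e : G ≃* G') (S : KodairaTuple b G) :
    (S.map e).SurfaceRelations ↔ S.SurfaceRelations := by
  have h1 : ((List.finRange b).reverse.map fun j =>
      ⁅((S.map e).r₁ j)⁻¹, ((S.map e).t₁ j)⁻¹⁆ * ((S.map e).t₁ j)⁻¹).prod *
      ((List.finRange b).map fun j => (S.map e).t₁ j).prod =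
      e (((List.finRange b).reverse.map fun j => ⁅(S.r₁ j)⁻¹, (S.t₁ j)⁻¹⁆ * (S.t₁ j)⁻¹).prod *
      ((List.finRange b).map fun j => S.t₁ j).prod) := by
    simp only [map_mul, map_list_prod, List.map_map]
    congr 3
    funext j
    simp [map_commutatorElement, KodairaTuple.map]
  have h2 : ((List.finRange b).map fun j =>
      ⁅((S.map e).r₂ j)⁻¹, (S.map e).t₂ j⁆ * (S.map e).t₂ j).prod *
      ((List.finRange b).reverse.map fun j => ((S.map e).t₂ j)⁻¹).prod =
      e (((List.finRange b).map fun j => ⁅(S.r₂ j)⁻¹, S.t₂ j⁆ * S.t₂ j).prod *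
      ((List.finRange b).reverse.map fun j => (S.t₂ j)⁻¹).prod) := by
    simp only [map_mul, map_list_prod, List.map_map]
    congr 3
    · funext j
      simp [map_commutatorElement, KodairaTuple.map]
    · funext j
      simp [KodairaTuple.map]
  constructor
  · rintro ⟨h3, h4⟩
    rw [h1] at h3
    rw [h2] at h4
    exact ⟨e.injective h3, e.injective (h4.trans (map_inv e S.z).symm)⟩
  · rintro ⟨h3, h4⟩
    refine ⟨?_, ?_⟩
    · rw [h1, h3]; rfl
    · rw [h2, h4]; exact map_inv e S.z

/-- The commutators are central and can be pulled out; what remains of each surface word telescopes.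
Since `z⁻¹ = z`, both right-hand sides are `z`. -/
theorem surfaceRelations_ofPairs_iff {a b : Fin 4 → G} {z : G} (hz : ∀ g, Commute z g)
    (hzz : z * z = 1) {p₀ p₁ q₀ q₁ : Bool} (h₀ : ⁅(a 0)⁻¹, (a 1)⁻¹⁆ = bpow z p₀)
    (h₁ : ⁅(a 2)⁻¹, (a 3)⁻¹⁆ = bpow z p₁) (k₀ : ⁅(b 1)⁻¹, b 0⁆ = bpow z q₀)
    (k₁ : ⁅(b 3)⁻¹, b 2⁆ = bpow z q₁) :
    (ofPairs a b z).SurfaceRelations ↔ bpow z (p₀ + p₁) = z ∧ bpow z (q₀ + q₁) = z := by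
  have hinv : z⁻¹ = z := inv_eq_of_mul_eq_one_left hzz
  have hb : ∀ p x, Commute (bpow z p) x := fun p x => commute_bpow (hz x) p
  have e1 : ∀ x y : G, bpow z p₁ * x⁻¹ * (bpow z p₀ * y⁻¹) * (y * x) = bpow z (p₀ + p₁) := by
    intro x y
    calc _ = bpow z p₁ * (x⁻¹ * bpow z p₀) * x := by group
      _ = _ := by rw [← (hb p₀ _).eq, bpow_add hzz, (hb p₀ (bpow z p₁)).eq]; group
  have e2 : ∀ x y : G, bpow z q₀ * x * (bpow z q₁ * y) * (y⁻¹ * x⁻¹) = bpow z (q₀ + q₁) := by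
    intro x y
    calc _ = bpow z q₀ * (x * bpow z q₁) * x⁻¹ := by group
      _ = _ := by rw [← (hb q₁ _).eq, bpow_add hzz]; group
  have l : List.finRange 2 = [0, 1] := rfl
  constructor
  · rintro ⟨f, g⟩
    simp only [l, List.reverse_cons, List.reverse_nil, List.nil_append, List.cons_append,
      List.map_cons, List.map_nil, List.prod_cons, List.prod_nil, mul_one, ofPairs,
      Matrix.cons_val_zero, Matrix.cons_val_one, h₀, h₁, k₀, k₁, e1, e2, hinv] at f g
    exact ⟨f, g⟩
  · rintro ⟨f, g⟩
    constructor
    all_goals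
      simp only [l, List.reverse_cons, List.reverse_nil, List.nil_append, List.cons_append,
        List.map_cons, List.map_nil, List.prod_cons, List.prod_nil, mul_one, ofPairs,
        Matrix.cons_val_zero, Matrix.cons_val_one, h₀, h₁, k₀, k₁, e1, e2, hinv]
      assumption

end KodairaTuple

/-! ### Surface relations and generation for standard tuples. -/

namespace ModelGroup

open KodairaTuple QuadraticData

variable {D : QuadraticData}

/-- The Gram matrix of the dual basis is the Pfaffian adjoint, which exchanges complementary
entries. This is why the two surface relations impose the same condition. -/
theorem polar_dual (h : D.pf = 1) : D.polar (D.dual 1) (D.dual 0) = D.a 5 ∧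
    D.polar (D.dual 3) (D.dual 2) = D.a 0 := by
  have h' : D.a 0 * D.a 5 + D.a 1 * D.a 4 + D.a 2 * D.a 3 = 1 := h
  revert h'
  simp only [polar, dual, Matrix.cons_val]
  generalize D.a 0 = a
  generalize D.a 1 = b
  generalize D.a 2 = c
  generalize D.a 3 = d
  generalize D.a 4 = e
  generalize D.a 5 = f
  revert a b c d e f
  decide +kernel

theorem bpow_zed_eq_zed_iff (b : Bool) : bpow (zed D) b = zed D ↔ b = 1 :=
  ⟨fun h => bpow_zed_injective (h.trans (bpow_one _).symm), fun h => by rw [h, bpow_one]⟩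

theorem stdTuple_surfaceRelations_iff (hpf : D.pf = 1) (hf : D.f = 0) (s : Fin 4 → Bool)
    (c d : Fin 4 → ZMod 3) : (stdTuple D s c d).SurfaceRelations ↔ D.a 0 + D.a 5 = 1 := by
  have hc : ∀ x y : ModelGroup D, ⁅x, y⁆ = bpow (zed D) (D.polar x.v y.v) := by
    intro x y
    rw [commutator_eq, bpow_zed]
    simp [char_eq_zero hf, signOf_zero]
  rw [stdTuple, surfaceRelations_ofPairs_iff zed_commute zed_mul_zed (hc _ _) (hc _ _) (hc _ _)
    (hc _ _)]
  simp only [bpow_zed_eq_zed_iff, inv_v, polar_dual hpf]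
  have h1 : D.polar (stdBasis 0) (stdBasis 1) = D.a 0 := by simp [polar, stdBasis]
  have h2 : D.polar (stdBasis 2) (stdBasis 3) = D.a 5 := by simp [polar, stdBasis]
  rw [h1, h2, add_comm (D.a 5), and_self]

theorem stdTuple_zero_not_generates (s : Fin 4 → Bool) : ¬ (stdTuple D s 0 0).Generates := by
  let H : Subgroup (ModelGroup D) :=
    { carrier := {x | x.c = 0}
      one_mem' := rfl
      mul_mem' := fun {x y} (hx : x.c = 0) (hy : y.c = 0) => by
        change (x * y).c = 0
        simp [hx, hy]
      inv_mem' := fun {x} (hx : x.c = 0) => by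
        change (x⁻¹).c = 0
        simp [hx] }
  intro h
  have h1 : (⊤ : Subgroup (ModelGroup D)) ≤ H := by
    rw [← h, Subgroup.closure_le]
    have h2 : ∀ j : Fin 2, (stdTuple D s 0 0).r₁ j ∈ H ∧ (stdTuple D s 0 0).t₁ j ∈ H ∧
        (stdTuple D s 0 0).r₂ j ∈ H ∧ (stdTuple D s 0 0).t₂ j ∈ H := by
      intro j
      fin_cases j <;> exact ⟨rfl, rfl, rfl, rfl⟩
    rintro x ((((⟨j, rfl⟩ | ⟨j, rfl⟩) | ⟨j, rfl⟩) | ⟨j, rfl⟩) | rfl)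
    · exact (h2 j).1
    · exact (h2 j).2.1
    · exact (h2 j).2.2.1
    · exact (h2 j).2.2.2
    · rfl
  have h3 : (cub D).c = 0 := h1 (Subgroup.mem_top (cub D))
  exact absurd h3 (by simp [cub])

/-- Ninth powers extract the 2-parts of the entries, which generate the complement; dividing by them
exposes a non-zero component in `ℤ/3`. -/
theorem stdTuple_generates (hf : D.f = 0) (s : Fin 4 → Bool)
    {c d : Fin 4 → ZMod 3} (h : (c, d) ≠ 0) : (stdTuple D s c d).Generates := by
  rw [Generates]
  set C := Subgroup.closure (Set.range (stdTuple D s c d).r₁ ∪ Set.range (stdTuple D s c d).t₁ ∪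
    Set.range (stdTuple D s c d).r₂ ∪ Set.range (stdTuple D s c d).t₂ ∪ {(stdTuple D s c d).z})
    with hC
  have hr₁ : ∀ j, (stdTuple D s c d).r₁ j ∈ C := fun j =>
    Subgroup.subset_closure (Or.inl (Or.inl (Or.inl (Or.inl ⟨j, rfl⟩))))
  have ht₁ : ∀ j, (stdTuple D s c d).t₁ j ∈ C := fun j =>
    Subgroup.subset_closure (Or.inl (Or.inl (Or.inl (Or.inr ⟨j, rfl⟩))))
  have hr₂ : ∀ j, (stdTuple D s c d).r₂ j ∈ C := fun j =>
    Subgroup.subset_closure (Or.inl (Or.inl (Or.inr ⟨j, rfl⟩)))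
  have ht₂ : ∀ j, (stdTuple D s c d).t₂ j ∈ C := fun j =>
    Subgroup.subset_closure (Or.inl (Or.inr ⟨j, rfl⟩))
  have hz : zed D ∈ C := Subgroup.subset_closure (Or.inr rfl)
  have ha : ∀ i, (⟨stdBasis i, 0, c i⟩ : ModelGroup D) ∈ C := by
    intro i
    fin_cases i
    exacts [hr₁ 0, ht₁ 0, hr₁ 1, ht₁ 1]
  have hb : ∀ i, (⟨D.dual i, s i, d i⟩ : ModelGroup D) ∈ C := by
    intro i
    fin_cases i
    exacts [ht₂ 0, hr₂ 0, ht₂ 1, hr₂ 1]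
  have hvert : ∀ (v : Fin 4 → Bool) (b : Bool) (k : ZMod 3), (⟨v, b, k⟩ : ModelGroup D) ∈ C →
      (⟨0, 0, k⟩ : ModelGroup D) ∈ C := fun v b k hm => by
    have h1 := C.pow_mem hm 9
    rw [pow_nine v b (Or.inl hf)] at h1
    rw [mk_eq_mul] at hm
    exact (C.mul_mem_cancel_right h1).mp hm
  have hk : ∃ k : ZMod 3, k ≠ 0 ∧ (⟨0, 0, k⟩ : ModelGroup D) ∈ C := by
    by_contra hcon
    push Not at hcon
    refine h (Prod.ext (funext fun i => ?_) (funext fun i => ?_))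
    · by_contra h0
      exact hcon _ h0 (hvert _ _ _ (ha i))
    · by_contra h0
      exact hcon _ h0 (hvert _ _ _ (hb i))
  obtain ⟨k, hk0, hk⟩ := hk
  have hcub : cub D ∈ C := by
    have h1 : k = 1 ∨ k = -1 := by
      clear hk; revert k; decide
    rcases h1 with rfl | rfl
    · exact hk
    · have h2 := C.inv_mem hk
      have h3 : (⟨0, 0, -1⟩ : ModelGroup D)⁻¹ = cub D := by
        ext1
        · rfl
        · simp [cub, D.bil_zero_left]
        · simp [cub, D.char_zero, signOf_zero]
      rwa [h3] at h2
  rw [eq_top_iff]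
  intro x _
  rw [← fn_stdBasis x]
  have hbp : ∀ (g : ModelGroup D) (b : Bool), g ∈ C → bpow g b ∈ C := fun g b hg => by
    cases b
    · exact C.one_mem
    · exact hg
  have hg : ∀ i, ofVec D (stdBasis i) 0 ∈ C := fun i => by
    have h1 := C.pow_mem (ha i) 9
    rwa [pow_nine _ _ (Or.inl hf)] at h1
  exact C.mul_mem (C.mul_mem (C.pow_mem hcub _) (C.mul_mem (hbp _ _ (hg 0))
    (C.mul_mem (hbp _ _ (hg 1)) (C.mul_mem (hbp _ _ (hg 2)) (hbp _ _ (hg 3)))))) (hbp _ _ hz)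

variable {G : Type*} [Group G]

/-- The number of quadratic data whose model group is isomorphic to `G`. -/
noncomputable def numberOfData (G : Type*) [Group G] (Q : QuadraticData → Prop) : ℕ :=
  {D : QuadraticData | D.pf = 1 ∧ Nonempty (ModelGroup D ≃* G) ∧ Q D}.ncard

theorem map_stdTuple_conjugacyRelations (h : D.pf = 1) (e : ModelGroup D ≃* G)
    (s : Fin 4 → Bool) {c d : Fin 4 → ZMod 3} (hcd : Admissible D c d) :
    ((stdTuple D s c d).map e).z ≠ 1 ∧ ((stdTuple D s c d).map e).ConjugacyRelations :=
  ⟨fun h => zed_ne_one ((map_eq_one_iff _ e.injective).mp h),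
    (stdTuple_conjugacyRelations h s hcd).map e.toMonoidHom⟩

theorem numberOfPrestructures_eq_of_f_eq_zero (e₀ : ModelGroup D ≃* G) (hf : D.f = 0) :
    numberOfPrestructures G = numberOfData G (fun _ => True) * (16 * 3281) := by
  have : Finite G := Finite.of_equiv _ e₀.toEquiv
  rw [← ncard_signRepresentatives]
  refine numberUpToAut_eq e₀ (fun S h => exists_isPrestructure_iff.mp h) fun D' e s c d hpf => ?_
  have ha : Admissible D' c d := Or.inl (f_eq_zero_of_equiv (e₀.trans e.symm) hf)
  rw [exists_isPrestructure_iff]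
  exact ⟨fun h => ⟨trivial, h.2.1⟩,
    fun h => ⟨ha, h.2, map_stdTuple_conjugacyRelations hpf e s ha⟩⟩

theorem numberOfPrestructures_eq_of_f_ne_zero (e₀ : ModelGroup D ≃* G) (hf : D.f ≠ 0) :
    numberOfPrestructures G = numberOfData G (fun _ => True) * 16 := by
  have : Finite G := Finite.of_equiv _ e₀.toEquiv
  have h1 := numberUpToAut_eq e₀ (P := fun S => ∃ n, IsPrestructure n S) (Q := fun _ => True)
    (K := {0}) (fun S h => exists_isPrestructure_iff.mp h) fun D' e s c d hpf => ?_
  · rw [Set.ncard_singleton, mul_one] at h1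
    exact h1
  have hf' : D'.f ≠ 0 := fun h => hf (f_eq_zero_of_equiv (e.trans e₀.symm) h)
  rw [exists_isPrestructure_iff]
  constructor
  · rintro ⟨h, -⟩
    obtain ⟨rfl, rfl⟩ := h.resolve_left hf'
    exact ⟨trivial, rfl⟩
  · rintro ⟨-, h⟩
    obtain ⟨rfl, rfl⟩ := Prod.mk.inj h
    exact ⟨Or.inr ⟨rfl, rfl⟩, zero_mem_signRepresentatives,
      map_stdTuple_conjugacyRelations hpf e s (Or.inr ⟨rfl, rfl⟩)⟩

theorem isDiagonalDoubleKodairaStructure_map_iff (hpf : D.pf = 1) (hf : D.f = 0)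
    (e : ModelGroup D ≃* G) (s : Fin 4 → Bool) (c d : Fin 4 → ZMod 3) :
    IsDiagonalDoubleKodairaStructure 2 2 ((stdTuple D s c d).map e) ↔
      D.a 0 + D.a 5 = 1 ∧ (c, d) ≠ 0 := by
  constructor
  · intro h
    have h1 := h.surface
    have h2 := h.generates
    rw [surfaceRelations_map_iff, stdTuple_surfaceRelations_iff hpf hf] at h1
    rw [generates_map_iff] at h2
    refine ⟨h1, fun h0 => ?_⟩
    obtain ⟨rfl, rfl⟩ := Prod.mk.inj h0
    exact stdTuple_zero_not_generates s h2
  · rintro ⟨h1, h2⟩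
    refine ⟨le_rfl, le_rfl, ?_, ?_, ?_,
      (map_stdTuple_conjugacyRelations hpf e s (Or.inl hf)).2⟩
    · exact (orderOf_injective e.toMonoidHom e.injective _).trans orderOf_zed
    · rw [generates_map_iff]
      exact stdTuple_generates hf s h2
    · rw [surfaceRelations_map_iff, stdTuple_surfaceRelations_iff hpf hf]
      exact h1

theorem z_ne_one_of_structure {b n : ℕ} {S : KodairaTuple b G}
    (h : IsDiagonalDoubleKodairaStructure b n S) : S.z ≠ 1 := fun e => by
  have h1 := h.order_z
  have h2 := h.two_le_type
  rw [e, orderOf_one] at h1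
  omega

theorem numberOfStructures_eq_of_f_eq_zero (e₀ : ModelGroup D ≃* G) (hf : D.f = 0) :
    numberOfDiagonalDoubleKodairaStructures G 2 2 =
      numberOfData G (fun D => D.a 0 + D.a 5 = 1) * (16 * 3280) := by
  have hcard : (signRepresentatives \ {0}).ncard = 3280 := by
    rw [Set.ncard_sdiff_singleton_of_mem zero_mem_signRepresentatives, ncard_signRepresentatives]
  rw [← hcard]
  refine numberUpToAut_eq e₀ (fun S h => ⟨z_ne_one_of_structure h, h.conjugacy⟩)
    fun D' e s c d hpf => ?_
  have hf' := f_eq_zero_of_equiv (e₀.trans e.symm) hf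
  rw [isDiagonalDoubleKodairaStructure_map_iff hpf hf']
  exact ⟨fun h => ⟨h.2.2.1, h.2.1, h.2.2.2⟩, fun h => ⟨Or.inl hf', h.2.1, h.1, h.2.2⟩⟩

/-- For `f ≠ 0` every prestructure is isomorphic to a standard tuple without components in `ℤ/3`,
which lies in a complement. -/
theorem not_isDiagonalDoubleKodairaStructure (e₀ : ModelGroup D ≃* G) (hf : D.f ≠ 0) {n : ℕ}
    (S : KodairaTuple 2 G) : ¬ IsDiagonalDoubleKodairaStructure 2 n S := by
  intro h
  obtain ⟨⟨D', s, c, d⟩, ⟨hpf, -, had, -⟩, e, rfl⟩ :=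
    exists_mem_parameters e₀ (z_ne_one_of_structure h) h.conjugacy
  have hf' : D'.f ≠ 0 := fun h => hf (f_eq_zero_of_equiv (e.trans e₀.symm) h)
  obtain ⟨rfl, rfl⟩ := had.resolve_left hf'
  exact stdTuple_zero_not_generates s ((generates_map_iff e _).mp h.generates)

end ModelGroup

/-! ### Classification of quadratic data -/

/-- The sum over all vectors with entries in `𝔽₂`, in a form suitable for evaluation. -/
def sumVec : (n : ℕ) → ((Fin n → Bool) → ℕ) → ℕ
  | 0, f => f Fin.elim0
  | n + 1, f => sumVec n (fun v => f (Fin.cons false v)) + sumVec n (fun v => f (Fin.cons true v))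

theorem sum_eq_sumVec (n : ℕ) (f : (Fin n → Bool) → ℕ) : ∑ v, f v = sumVec n f := by
  induction n with
  | zero =>
    rw [Fintype.sum_unique]
    exact congrArg f (Subsingleton.elim _ _)
  | succ n ih =>
    rw [sumVec, ← ih, ← ih, ← (Fin.consEquiv fun _ => Bool).sum_comp, Fintype.sum_prod_type,
      Fintype.sum_bool, add_comm]
    rfl

/-- Some vector with entries in `𝔽₂` satisfies `p`. -/
def anyVec : (n : ℕ) → ((Fin n → Bool) → Bool) → Bool
  | 0, p => p Fin.elim0
  | n + 1, p => anyVec n (fun v => p (Fin.cons true v)) || anyVec n (fun v => p (Fin.cons false v))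

/-- All vectors with entries in `𝔽₂` satisfy `p`. -/
def allVec : (n : ℕ) → ((Fin n → Bool) → Bool) → Bool
  | 0, p => p Fin.elim0
  | n + 1, p => allVec n (fun v => p (Fin.cons false v)) && allVec n (fun v => p (Fin.cons true v))

theorem exists_of_anyVec {n : ℕ} {p : (Fin n → Bool) → Bool} (h : anyVec n p = true) :
    ∃ v, p v = true := by
  induction n with
  | zero => exact ⟨_, h⟩
  | succ n ih =>
    rcases (Bool.or_eq_true _ _).mp h with h | h
    · obtain ⟨v, hv⟩ := ih h; exact ⟨_, hv⟩
    · obtain ⟨v, hv⟩ := ih h; exact ⟨_, hv⟩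

theorem forall_of_allVec {n : ℕ} {p : (Fin n → Bool) → Bool} (h : allVec n p = true)
    (v : Fin n → Bool) : p v = true := by
  induction n with
  | zero => rw [Subsingleton.elim v Fin.elim0]; exact h
  | succ n ih =>
    obtain ⟨h1, h2⟩ := (Bool.and_eq_true _ _).mp h
    rw [← Fin.cons_self_tail v]
    cases v 0
    · exact ih (p := fun v => p (Fin.cons false v)) h1 (Fin.tail v)
    · exact ih (p := fun v => p (Fin.cons true v)) h2 (Fin.tail v)

/-! ### Invariants and normal forms of quadratic data. -/

namespace QuadraticData

/-- The value at `w` of the quadratic form with the values `q` on the basis vectors. -/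
def evalQuad (a : Fin 6 → Bool) (q w : Fin 4 → Bool) : Bool :=
  (q 0 && w 0) ^^ (q 1 && w 1) ^^ (q 2 && w 2) ^^ (q 3 && w 3) ^^
  (a 0 && w 1 && w 0) ^^ (a 1 && w 2 && w 0) ^^ (a 2 && w 3 && w 0) ^^
  (a 3 && w 2 && w 1) ^^ (a 4 && w 3 && w 1) ^^ (a 5 && w 3 && w 2)

/-- The vector dual to the linear form `f`. -/
def dualVec (a : Fin 6 → Bool) (f : Fin 4 → Bool) : Fin 4 → Bool :=
  ![(f 1 && a 5) ^^ (f 2 && a 4) ^^ (f 3 && a 3), (f 0 && a 5) ^^ (f 2 && a 2) ^^ (f 3 && a 1),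
    (f 0 && a 4) ^^ (f 1 && a 2) ^^ (f 3 && a 0), (f 0 && a 3) ^^ (f 1 && a 1) ^^ (f 2 && a 0)]

/-- The linear form does not vanish. -/
def ramified (f : Fin 4 → Bool) : Bool := f 0 || f 1 || f 2 || f 3

/-- The Arf invariant of a quadratic form with non-degenerate polar form. -/
def arf (a : Fin 6 → Bool) (q : Fin 4 → Bool) : Bool :=
  (a 0 && a 1 && a 2 && a 3 && a 4 && a 5) ^^
    evalQuad a (fun _ => false) (dualVec a q)

/-- Equality of elements of `𝔽₂`, as a function. -/
def eqb (x y : Bool) : Bool := !(x ^^ y)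

theorem eq_of_eqb {x y : Bool} (h : eqb x y = true) : x = y := by revert x y; decide

/-- The Arf invariant, the ramification of the linear form, and the value of the quadratic form at
the vector dual to the linear form. -/
def invariants (D : QuadraticData) : Bool × Bool × Bool :=
  (arf D.a D.q, ramified D.f, evalQuad D.a D.q (dualVec D.a D.f))

/-- The polar form with the coefficients `a`. -/
def evalPolar (a : Fin 6 → Bool) (v w : Fin 4 → Bool) : Bool :=
  (a 0 && ((v 0 && w 1) ^^ (v 1 && w 0))) ^^ (a 1 && ((v 0 && w 2) ^^ (v 2 && w 0))) ^^
  (a 2 && ((v 0 && w 3) ^^ (v 3 && w 0))) ^^ (a 3 && ((v 1 && w 2) ^^ (v 2 && w 1))) ^^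
  (a 4 && ((v 1 && w 3) ^^ (v 3 && w 1))) ^^ (a 5 && ((v 2 && w 3) ^^ (v 3 && w 2)))

/-- The linear form with the coefficients `f`. -/
def evalChar (f v : Fin 4 → Bool) : Bool :=
  (f 0 && v 0) ^^ (f 1 && v 1) ^^ (f 2 && v 2) ^^ (f 3 && v 3)

theorem char_eq_evalChar (D : QuadraticData) (v : Fin 4 → Bool) :
    D.char v = evalChar D.f v := rfl

theorem quad_eq_evalQuad (D : QuadraticData) (v : Fin 4 → Bool) :
    D.quad v = evalQuad D.a D.q v := by
  have h : ∀ x y : Bool, x * y * y = x * y := fun x y => by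
    rw [mul_assoc, show y * y = y from Bool.and_self y]
  rw [quad, bil, h, h, h, h]
  rfl

/-- The coefficients of the standard hyperbolic form. -/
def hyperbolic : Fin 6 → Bool := ![false, false, true, true, false, false]

/-- The coefficients of the polar form of the extra-special groups of order `32` in their
presentations. -/
def zigzag : Fin 6 → Bool := ![true, false, true, true, false, false]

/-- The data of `G(96, 211)`. -/
def data211 : QuadraticData := ⟨hyperbolic, fun _ => false, ![true, false, false, false]⟩

/-- The data of `G(96, 214)`. -/
def data214 : QuadraticData :=
  ⟨hyperbolic, ![false, true, true, false], ![true, false, false, false]⟩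

/-- The data of `G(96, 216)`. -/
def data216 : QuadraticData :=
  ⟨hyperbolic, ![false, false, false, true], ![true, false, false, false]⟩

/-- The data of `G(96, 217)`. -/
def data217 : QuadraticData :=
  ⟨hyperbolic, ![false, true, true, true], ![true, false, false, false]⟩

/-- The data of `G(96, 224)`. -/
def data224 : QuadraticData := ⟨zigzag, fun _ => false, fun _ => false⟩

/-- The data of `G(96, 225)`. -/
def data225 : QuadraticData := ⟨zigzag, ![false, true, true, false], fun _ => false⟩

/-- The data in the list with given invariants. -/
def representative : Bool × Bool × Bool → QuadraticData
  | (false, true, false) => data211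
  | (true, true, false) => data214
  | (false, true, true) => data216
  | (true, true, true) => data217
  | (false, false, _) => data224
  | (true, false, _) => data225

/-- The value of a function on `𝔽₂`, evaluated after its argument. -/
def forceBool (b : Bool) (k : Bool → Bool) : Bool := cond b (k true) (k false)

/-- The value of a function at a vector, evaluated after the entries of the vector. -/
def force (v : Fin 4 → Bool) (k : (Fin 4 → Bool) → Bool) : Bool :=
  forceBool (v 0) fun x₀ => forceBool (v 1) fun x₁ => forceBool (v 2) fun x₂ =>
    forceBool (v 3) fun x₃ => k ![x₀, x₁, x₂, x₃]

theorem force_eq (v : Fin 4 → Bool) (k : (Fin 4 → Bool) → Bool) : force v k = k v := by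
  have h : ∀ b k, forceBool b k = k b := fun b k => by cases b <;> rfl
  simp only [force, h]
  congr 1
  funext i
  fin_cases i <;> rfl

/-- A check that all non-degenerate polar forms become hyperbolic after a change of basis which
preserves the invariants. -/
def checkHyperbolic : Bool :=
  allVec 6 fun a => !((a 0 && a 5) ^^ (a 1 && a 4) ^^ (a 2 && a 3)) ||
    anyVec 4 fun v₀ => anyVec 4 fun v₃ => evalPolar a v₀ v₃ &&
      anyVec 4 fun v₁ => !evalPolar a v₀ v₁ && !evalPolar a v₁ v₃ &&
        anyVec 4 fun v₂ => !evalPolar a v₀ v₂ && !evalPolar a v₂ v₃ && evalPolar a v₁ v₂ &&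
          allVec 4 fun q => force ![evalQuad a q v₀, evalQuad a q v₁, evalQuad a q v₂,
            evalQuad a q v₃] fun q' => eqb (arf a q) (arf hyperbolic q') &&
              allVec 4 fun f => force ![evalChar f v₀, evalChar f v₁, evalChar f v₂, evalChar f v₃]
                fun f' => eqb (ramified f) (ramified f') && force (dualVec a f) fun w =>
                  force (dualVec hyperbolic f') fun w' =>
                    eqb (evalQuad a q w) (evalQuad hyperbolic q' w')

/-- A check that all data with hyperbolic polar form become data of the list after a change of
basis. -/
def checkRepresentative : Bool :=
  allVec 4 fun q => allVec 4 fun f =>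
    let T := representative (invariants ⟨hyperbolic, q, f⟩)
    anyVec 4 fun v₀ => eqb (evalQuad hyperbolic q v₀) (T.q 0) && eqb (evalChar f v₀) (T.f 0) &&
    anyVec 4 fun v₁ => eqb (evalQuad hyperbolic q v₁) (T.q 1) && eqb (evalChar f v₁) (T.f 1) &&
      eqb (evalPolar hyperbolic v₀ v₁) (T.a 0) &&
    anyVec 4 fun v₂ => eqb (evalQuad hyperbolic q v₂) (T.q 2) && eqb (evalChar f v₂) (T.f 2) &&
      eqb (evalPolar hyperbolic v₀ v₂) (T.a 1) && eqb (evalPolar hyperbolic v₁ v₂) (T.a 3) &&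
    anyVec 4 fun v₃ => eqb (evalQuad hyperbolic q v₃) (T.q 3) && eqb (evalChar f v₃) (T.f 3) &&
      eqb (evalPolar hyperbolic v₀ v₃) (T.a 2) && eqb (evalPolar hyperbolic v₁ v₃) (T.a 4) &&
      eqb (evalPolar hyperbolic v₂ v₃) (T.a 5)

theorem checkHyperbolic_eq_true : checkHyperbolic = true := by decide +kernel

theorem checkRepresentative_eq_true : checkRepresentative = true := by decide +kernel

end QuadraticData

/-! ### Reduction to the normal forms. -/

namespace QuadraticData

variable {D : QuadraticData}

/-- A linear relation would be a radical vector of the pulled-back form. Hence the finite searches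
need not test independence. -/
theorem independent_of_pf_pull {v : Fin 4 → Fin 4 → Bool} (h : (D.pull v).pf = 1) :
    Independent v := by
  intro t ht
  have h0 : ∀ (D : QuadraticData) (w : Fin 4 → Bool), D.polar w 0 = 0 := fun D w => by
    simp [polar]
  refine eq_of_polar_stdBasis h fun i => ?_
  rw [polar_pull, ht, h0, h0]

/-- Splitting first the hyperbolic form off the general case keeps the searches small. Invariance is
checked only for the basis found here; that the classes are not isomorphic is shown separately by
counting square roots of 1. -/
theorem exists_pull_hyperbolic (h : D.pf = 1) : ∃ v, (D.pull v).a = hyperbolic ∧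
    (D.pull v).invariants = D.invariants := by
  have h1 := forall_of_allVec checkHyperbolic_eq_true D.a
  have h2 : ((D.a 0 && D.a 5) ^^ (D.a 1 && D.a 4) ^^ (D.a 2 && D.a 3)) = true := h
  rw [h2, Bool.not_true, Bool.false_or] at h1
  obtain ⟨v₀, h1⟩ := exists_of_anyVec h1
  obtain ⟨v₃, h1⟩ := exists_of_anyVec h1
  obtain ⟨h03, h1⟩ := (Bool.and_eq_true _ _).mp h1
  obtain ⟨v₁, h1⟩ := exists_of_anyVec h1
  obtain ⟨h1', h1⟩ := (Bool.and_eq_true _ _).mp h1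
  obtain ⟨h01, h13⟩ := (Bool.and_eq_true _ _).mp h1'
  obtain ⟨v₂, h1⟩ := exists_of_anyVec h1
  obtain ⟨h1', h1⟩ := (Bool.and_eq_true _ _).mp h1
  obtain ⟨h1', h12⟩ := (Bool.and_eq_true _ _).mp h1'
  obtain ⟨h02, h23⟩ := (Bool.and_eq_true _ _).mp h1'
  have h4 := forall_of_allVec h1 D.q
  rw [force_eq] at h4
  obtain ⟨harf, h4⟩ := (Bool.and_eq_true _ _).mp h4
  have h5 := forall_of_allVec h4 D.f
  rw [force_eq] at h5
  obtain ⟨hram, h5⟩ := (Bool.and_eq_true _ _).mp h5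
  rw [force_eq, force_eq] at h5
  rw [Bool.not_eq_true'] at h01 h13 h02 h23
  have ha : (D.pull ![v₀, v₁, v₂, v₃]).a = hyperbolic := by
    funext i
    fin_cases i
    exacts [h01, h02, h03, h12, h13, h23]
  have hq : (D.pull ![v₀, v₁, v₂, v₃]).q = ![evalQuad D.a D.q v₀, evalQuad D.a D.q v₁,
      evalQuad D.a D.q v₂, evalQuad D.a D.q v₃] := by
    funext i
    fin_cases i <;> exact quad_eq_evalQuad _ _
  have hf : (D.pull ![v₀, v₁, v₂, v₃]).f = ![evalChar D.f v₀, evalChar D.f v₁,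
      evalChar D.f v₂, evalChar D.f v₃] := by
    funext i
    fin_cases i <;> rfl
  refine ⟨![v₀, v₁, v₂, v₃], ha, ?_⟩
  rw [invariants, invariants, ha, hq, hf, ← eq_of_eqb harf, ← eq_of_eqb hram, ← eq_of_eqb h5]

theorem exists_pull_representative (h : D.a = hyperbolic) :
    ∃ v, D.pull v = representative D.invariants := by
  obtain ⟨a, q, f⟩ := D
  obtain rfl : a = hyperbolic := h
  have h1 := forall_of_allVec (forall_of_allVec checkRepresentative_eq_true q) f
  simp only at h1
  obtain ⟨v₀, h1⟩ := exists_of_anyVec h1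
  obtain ⟨h0, h1⟩ := (Bool.and_eq_true _ _).mp h1
  obtain ⟨v₁, h1⟩ := exists_of_anyVec h1
  obtain ⟨h10, h1⟩ := (Bool.and_eq_true _ _).mp h1
  obtain ⟨v₂, h1⟩ := exists_of_anyVec h1
  obtain ⟨h20, h1⟩ := (Bool.and_eq_true _ _).mp h1
  obtain ⟨v₃, h1⟩ := exists_of_anyVec h1
  simp only [Bool.and_eq_true] at h0 h10 h20 h1
  refine ⟨![v₀, v₁, v₂, v₃], ?_⟩
  ext i
  · fin_cases i
    exacts [eq_of_eqb h10.2, eq_of_eqb h20.1.2, eq_of_eqb h1.1.1.2, eq_of_eqb h20.2,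
      eq_of_eqb h1.1.2, eq_of_eqb h1.2]
  · refine (quad_eq_evalQuad _ _).trans ?_
    fin_cases i
    exacts [eq_of_eqb h0.1, eq_of_eqb h10.1.1, eq_of_eqb h20.1.1.1, eq_of_eqb h1.1.1.1.1]
  · fin_cases i
    exacts [eq_of_eqb h0.2, eq_of_eqb h10.1.2, eq_of_eqb h20.1.1.2, eq_of_eqb h1.1.1.1.2]

theorem pf_representative (x : Bool × Bool × Bool) : (representative x).pf = 1 := by
  revert x
  decide

end QuadraticData

/-! ### Isomorphism classes of model groups. -/

namespace ModelGroup

open QuadraticData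

variable {D D' : QuadraticData}

theorem nonempty_mulEquiv_representative (h : D.pf = 1) :
    Nonempty (ModelGroup D ≃* ModelGroup (representative D.invariants)) := by
  obtain ⟨v, ha, hinv⟩ := exists_pull_hyperbolic h
  have hpf : (D.pull v).pf = 1 := by rw [pf, ha]; rfl
  obtain ⟨w, hw⟩ := exists_pull_representative ha
  have hpf' : ((D.pull v).pull w).pf = 1 := by rw [hw]; exact pf_representative _
  have e := (pullEquiv _ (independent_of_pf_pull hpf') 0).trans
    (pullEquiv D (independent_of_pf_pull hpf) 0)
  rw [hw, hinv] at e
  exact ⟨e.symm⟩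

/-- The number of elements with trivial square. -/
def squareRoots (D : QuadraticData) : ℕ :=
  sumVec 4 fun v => cond (evalQuad D.a D.q v) 0 (cond (evalChar D.f v) 6 2)

/-- Over an isotropic `v` the sign is free. The component in `ℤ/3` is free if `v` acts by inversion
and must vanish otherwise, which accounts for the weights 6 and 2. -/
theorem card_sq_eq_one (D : QuadraticData) :
    Nat.card {x : ModelGroup D // x * x = 1} = squareRoots D := by
  have h1 : ∀ x : ModelGroup D, x * x = 1 ↔ D.quad x.v = 0 ∧ (D.char x.v = 1 ∨ x.c = 0) := by
    intro x
    have h2 : ∀ (c : ZMod 3) (b : Bool), c + signOf b * c = 0 ↔ b = true ∨ c = 0 := by decide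
    have h3 : ∀ a b : Bool, a + a + b = b := by decide
    rw [ModelGroup.ext_iff, mul_v, mul_s, mul_c, h3, add_self_vec]
    exact ⟨fun h => ⟨h.2.1, (h2 _ _).mp h.2.2⟩, fun h => ⟨rfl, h.1, (h2 _ _).mpr h.2⟩⟩
  have h2 : Nat.card {x : ModelGroup D // x * x = 1} = Nat.card {y : (Fin 4 → Bool) × Bool × ZMod 3 //
      D.quad y.1 = 0 ∧ (D.char y.1 = 1 ∨ y.2.2 = 0)} :=
    Nat.card_congr ((equivProd D).subtypeEquiv fun x => h1 x)
  rw [h2, Nat.card_eq_fintype_card, Fintype.card_subtype, Finset.card_filter, Fintype.sum_prod_type,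
    sum_eq_sumVec, squareRoots]
  congr 1
  funext v
  have h3 : ∀ a b : Bool, (∑ y : Bool × ZMod 3, if a = 0 ∧ (b = 1 ∨ y.2 = 0) then 1 else 0) =
      cond a 0 (cond b 6 2) := by decide
  exact (h3 (D.quad v) (D.char v)).trans (by rw [quad_eq_evalQuad, char_eq_evalChar])

theorem squareRoots_eq_of_equiv (e : ModelGroup D ≃* ModelGroup D') :
    squareRoots D = squareRoots D' := by
  rw [← card_sq_eq_one, ← card_sq_eq_one]
  refine Nat.card_congr (e.toEquiv.subtypeEquiv fun x => ?_)
  change _ ↔ e x * e x = 1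
  rw [← map_mul, map_eq_one_iff e e.injective]

theorem f_eq_zero_iff_ramified : D.f = 0 ↔ ramified D.f = false := by
  constructor
  · intro h; rw [h]; rfl
  · intro h
    simp only [ramified, Bool.or_eq_false_iff] at h
    funext i
    fin_cases i
    exacts [h.1.1.1, h.1.1.2, h.1.2, h.2]

theorem ramified_eq_of_equiv (e : ModelGroup D ≃* ModelGroup D') :
    ramified D.f = ramified D'.f := by
  have h : D.f = 0 ↔ D'.f = 0 := ⟨f_eq_zero_of_equiv e, f_eq_zero_of_equiv e.symm⟩
  rw [f_eq_zero_iff_ramified, f_eq_zero_iff_ramified] at h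
  revert h
  cases ramified D.f <;> cases ramified D'.f <;> simp

theorem representative_invariants_representative (x : Bool × Bool × Bool) :
    representative (representative x).invariants = representative x := by
  obtain ⟨_ | _, _ | _, _ | _⟩ := x <;> rfl

/-- The list ignores the third invariant when `f = 0`. Nothing is lost, because the vector dual to
`f` is then 0. -/
theorem invariants_representative_invariants (D : QuadraticData) :
    (representative D.invariants).invariants = D.invariants := by
  have h1 : ∀ x y t : Bool, (y = false → t = false) →
      (representative (x, y, t)).invariants = (x, y, t) := by decide
  refine h1 _ _ _ fun h => ?_
  have h2 : D.f = fun _ => false := f_eq_zero_iff_ramified.mpr h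
  rw [h2]
  simp [dualVec, evalQuad]

/-- The model groups of the data in the list are distinguished by the existence of ramification and
the number of square roots of the identity. -/
theorem invariants_representative_eq_of_equiv {x y : Bool × Bool × Bool}
    (e : ModelGroup (representative x) ≃* ModelGroup (representative y)) :
    (representative x).invariants = (representative y).invariants := by
  have h : ∀ x y : Bool × Bool × Bool, squareRoots (representative x) =
      squareRoots (representative y) → ramified (representative x).f = ramified (representative y).f →
      (representative x).invariants = (representative y).invariants := by decide +kernel
  exact h x y (squareRoots_eq_of_equiv e) (ramified_eq_of_equiv e)

/-- Turns the count of data presenting a given group into a count of data with prescribed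
invariants. -/
theorem nonempty_mulEquiv_representative_iff (h : D.pf = 1) (x : Bool × Bool × Bool) :
    Nonempty (ModelGroup D ≃* ModelGroup (representative x)) ↔
      D.invariants = (representative x).invariants := by
  obtain ⟨e⟩ := nonempty_mulEquiv_representative h
  constructor
  · rintro ⟨e'⟩
    rw [← invariants_representative_invariants D]
    exact invariants_representative_eq_of_equiv (e.symm.trans e')
  · intro h1
    rw [h1, representative_invariants_representative] at e
    exact ⟨e⟩

variable {G : Type*} [Group G]

/-- The number of data with given invariants whose polar form satisfies `p`, in a form suitable for
evaluation. -/
def countData (p : (Fin 6 → Bool) → Bool) : Bool × Bool × Bool → ℕ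
  | (x, y, t) => sumVec 6 fun a => cond (((a 0 && a 5) ^^ (a 1 && a 4) ^^ (a 2 && a 3)) && p a)
    (sumVec 4 fun f => cond (eqb (ramified f) y) (sumVec 4 fun q =>
      cond (eqb (evalQuad a q (dualVec a f)) t && eqb (arf a q) x) 1 0) 0) 0

theorem numberOfData_eq (x : Bool × Bool × Bool) (e : ModelGroup (representative x) ≃* G)
    (p : (Fin 6 → Bool) → Bool) :
    numberOfData G (fun D => p D.a = true) = countData p (representative x).invariants := by
  have h1 : {D : QuadraticData | D.pf = 1 ∧ Nonempty (ModelGroup D ≃* G) ∧ p D.a = true} =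
      {D : QuadraticData | D.pf = 1 ∧ D.invariants = (representative x).invariants ∧
        p D.a = true} := by
    ext D
    refine and_congr_right fun hpf => and_congr_left fun _ => ?_
    rw [← nonempty_mulEquiv_representative_iff hpf]
    exact ⟨fun ⟨e'⟩ => ⟨e'.trans e.symm⟩, fun ⟨e'⟩ => ⟨e'.trans e⟩⟩
  let ε : QuadraticData ≃ (Fin 6 → Bool) × (Fin 4 → Bool) × (Fin 4 → Bool) :=
    { toFun := fun D => (D.a, D.f, D.q)
      invFun := fun y => ⟨y.1, y.2.2, y.2.1⟩
      left_inv := fun _ => rfl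
      right_inv := fun _ => rfl }
  generalize (representative x).invariants = i at h1
  rw [numberOfData, h1, ← Nat.card_coe_set_eq]
  have h2 : Nat.card {D : QuadraticData | D.pf = 1 ∧ D.invariants = i ∧ p D.a = true} =
      Nat.card {y : (Fin 6 → Bool) × (Fin 4 → Bool) × (Fin 4 → Bool) //
        (ε.symm y).pf = 1 ∧ (ε.symm y).invariants = i ∧ p y.1 = true} :=
    Nat.card_congr (ε.subtypeEquiv fun D => Iff.rfl)
  obtain ⟨x, y, t⟩ := i
  have hcond : ∀ (n : ℕ) (b : Bool) (f : (Fin n → Bool) → ℕ),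
      cond b (∑ v, f v) 0 = ∑ v, cond b (f v) 0 := fun n b f => by cases b <;> simp
  have key : ∀ P p A R T x y t : Bool,
      (if P = 1 ∧ (A, R, T) = (x, y, t) ∧ p = true then 1 else 0) =
      cond (P && p) (cond (eqb R y) (cond (eqb T t && eqb A x) 1 0) 0) 0 := by decide
  rw [h2, Nat.card_eq_fintype_card, Fintype.card_subtype, Finset.card_filter, Fintype.sum_prod_type]
  simp only [countData, ← sum_eq_sumVec, hcond]
  refine Finset.sum_congr rfl fun a _ => ?_
  rw [Fintype.sum_prod_type]
  refine Finset.sum_congr rfl fun f _ => Finset.sum_congr rfl fun q _ => ?_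
  exact key _ _ _ _ _ _ _ _

end ModelGroup

/-! ### The numerical counts. -/

namespace ModelGroup

open QuadraticData

variable {G : Type*} [Group G]

theorem numberOfData_true {x y t : Bool} (e : ModelGroup (representative (x, y, t)) ≃* G)
    (h : (representative (x, y, t)).invariants = (x, y, t)) :
    numberOfData G (fun _ => True) = countData (fun _ => true) (x, y, t) := by
  rw [← h, ← numberOfData_eq (x, y, t) e]
  simp

theorem f_ne_zero_of_ramified {D : QuadraticData} (h : ramified D.f = true) : D.f ≠ 0 := fun h0 => by
  rw [f_eq_zero_iff_ramified.mp h0] at h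
  exact absurd h (by decide)

theorem numberOfPrestructures_of_ramified {x t : Bool}
    (e : ModelGroup (representative (x, true, t)) ≃* G) :
    numberOfPrestructures G = countData (fun _ => true) (x, true, t) * 16 := by
  rw [numberOfPrestructures_eq_of_f_ne_zero e (f_ne_zero_of_ramified _), numberOfData_true e]
  · cases x <;> cases t <;> rfl
  · cases x <;> cases t <;> rfl

theorem numberOfPrestructures_of_unramified {x : Bool}
    (e : ModelGroup (representative (x, false, false)) ≃* G) :
    numberOfPrestructures G = countData (fun _ => true) (x, false, false) * (16 * 3281) := by
  rw [numberOfPrestructures_eq_of_f_eq_zero e (f_eq_zero_iff_ramified.mpr _), numberOfData_true e]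
  · cases x <;> rfl
  · cases x <;> rfl

theorem numberOfStructures_of_unramified {x : Bool}
    (e : ModelGroup (representative (x, false, false)) ≃* G) :
    numberOfDiagonalDoubleKodairaStructures G 2 2 =
      countData (fun a => a 0 ^^ a 5) (x, false, false) * (16 * 3280) := by
  have h := numberOfData_eq _ e (fun a => a 0 ^^ a 5)
  rw [show (representative (x, false, false)).invariants = (x, false, false) by cases x <;> rfl] at h
  rw [numberOfStructures_eq_of_f_eq_zero e (f_eq_zero_iff_ramified.mpr (by cases x <;> rfl)), ← h]
  rfl

theorem numberOfStructures_of_ramified {x t : Bool}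
    (e : ModelGroup (representative (x, true, t)) ≃* G) :
    numberOfDiagonalDoubleKodairaStructures G 2 2 = 0 := by
  have hf := f_ne_zero_of_ramified (D := representative (x, true, t)) (by cases x <;> cases t <;> rfl)
  have h : {O : Set (KodairaTuple 2 G) | ∃ S, IsDiagonalDoubleKodairaStructure 2 2 S ∧
      O = MulAction.orbit (MulAut G) S} = ∅ :=
    Set.eq_empty_of_forall_notMem fun O ⟨S, hS, _⟩ =>
      not_isDiagonalDoubleKodairaStructure e hf S hS
  rw [numberOfDiagonalDoubleKodairaStructures, KodairaTuple.numberUpToAut, h, Set.ncard_empty]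

/-- There are 28 non-degenerate polar forms, each with 10 quadratic forms of Arf invariant 0 and 6
of Arf invariant 1. Non-zero characters correspond to non-zero vectors, on which the form takes the
values 0 and 1 respectively 9 and 6 times for Arf invariant 0, and 5 and 10 times for Arf invariant
1. -/
theorem countData_prestructures : countData (fun _ => true) (false, true, false) = 2520 ∧
    countData (fun _ => true) (false, true, true) = 1680 ∧
    countData (fun _ => true) (true, true, false) = 840 ∧
    countData (fun _ => true) (true, true, true) = 1680 ∧
    countData (fun _ => true) (false, false, false) = 280 ∧
    countData (fun _ => true) (true, false, false) = 168 := by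
  refine ⟨?_, ?_, ?_, ?_, ?_, ?_⟩ <;> decide +kernel

/-- The condition `a₀ + a₅ = 1` makes `a₀ a₅` vanish and leaves 12 of the 28 polar forms, each with
10 or 6 quadratic forms. -/
theorem countData_structures : countData (fun a => a 0 ^^ a 5) (false, false, false) = 120 ∧
    countData (fun a => a 0 ^^ a 5) (true, false, false) = 72 := by
  refine ⟨?_, ?_⟩ <;> decide +kernel

end ModelGroup

/-! ### Groups with prestructures are model groups -/

section

variable {G : Type*} [Group G]

/-- A normal subgroup of order three of a group of order `96` has a complement, which gives a
section of the quotient map. -/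
theorem exists_section (hG : Nat.card G = 96) {N : Subgroup G} [N.Normal] (hN : Nat.card N = 3) :
    ∃ σ : G ⧸ N →* G, ∀ x, (σ x : G ⧸ N) = x := by
  have := finite_of_card (by norm_num) hG
  have hind : N.index = 32 := card_quotient_of_card_three hG hN
  obtain ⟨H, hH⟩ := Subgroup.exists_left_complement'_of_coprime (N := N)
    (by rw [hN, hind]; norm_num)
  refine ⟨H.subtype.comp hH.QuotientMulEquiv.toMonoidHom, fun x => ?_⟩
  exact hH.QuotientMulEquiv.symm_apply_apply x

theorem pow_two_of_orderOf {z : G} (hz : orderOf z = 2) : z ^ 2 = 1 :=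
  orderOf_dvd_iff_pow_eq_one.mp (by rw [hz])

theorem eq_or_eq_inv_of_card_three {N : Subgroup G} (hN : Nat.card N = 3) {u x : G} (hu : u ∈ N)
    (hu1 : u ≠ 1) (hx : x ∈ N) (hx1 : x ≠ 1) : x = u ∨ x = u⁻¹ := by
  classical
  have hfin := finite_of_card (by norm_num) hN
  have h3 := pow_three_of_mem hN hu
  have ho : orderOf u = 3 := orderOf_eq_prime h3 hu1
  have hle : Subgroup.zpowers u ≤ N := by rwa [Subgroup.zpowers_le]
  have heq : Subgroup.zpowers u = N :=
    Subgroup.eq_of_le_of_card_ge hle (by rw [Nat.card_zpowers, hN, ho])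
  rw [← heq] at hx
  have hfo : IsOfFinOrder u := isOfFinOrder_iff_pow_eq_one.mpr ⟨3, by norm_num, h3⟩
  obtain ⟨n, hn, rfl⟩ := Finset.mem_image.mp (hfo.mem_zpowers_iff_mem_range_orderOf.mp hx)
  rw [ho, Finset.mem_range] at hn
  interval_cases n
  · exact absurd (pow_zero u) hx1
  · exact Or.inl (pow_one u)
  · right
    rw [← mul_eq_one_iff_eq_inv, ← pow_succ]
    exact h3

theorem commutatorElement_bpow {a b z : G} (h : ⁅a, b⁆ = z) (t : Bool) :
    ⁅bpow a t, b⁆ = bpow z t := by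
  cases t
  · exact commutatorElement_one_left b
  · exact h

theorem commutatorElement_mul_left_eq_bpow {x y b z : G} (hz : ∀ g, Commute z g) (hzz : z * z = 1)
    {s t : Bool} (hx : ⁅x, b⁆ = bpow z s) (hy : ⁅y, b⁆ = bpow z t) :
    ⁅x * y, b⁆ = bpow z (s + t) := by
  have h1 : ⁅x * y, b⁆ = x * ⁅y, b⁆ * x⁻¹ * ⁅x, b⁆ := by
    simp only [commutatorElement_def]; group
  rw [h1, hx, hy, bpow_add hzz, ← (commute_bpow (hz x) t).eq, mul_inv_cancel_right,
    (commute_bpow (hz (bpow z s)) t).eq]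

end

/-! ### Coordinates on a group with a prestructure. -/

namespace ModelGroup

open KodairaTuple QuadraticData

variable {G : Type*} [Group G]

theorem exists_bpow_of_mem_zpowers {z x : G} (hz : orderOf z = 2)
    (hx : x ∈ Subgroup.zpowers z) : ∃ b, x = bpow z b := by
  rcases mem_zpowers_of_orderOf_two hz hx with h | h
  · exact ⟨false, h⟩
  · exact ⟨true, h⟩

/-- The first half is moved into a complement of `N` by the section. Squares and commutators there
are powers of `z` by the case of order 32, and each lift fixes or inverts the generator `u` of `N`.
-/
theorem exists_liftRelations (hG : Nat.card G = 96) {N : Subgroup G} [N.Normal]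
    (hN : Nat.card N = 3) {S : KodairaTuple 2 G} (h : S.ConjugacyRelations) (hz : S.z ≠ 1)
    (hcen : ∀ g, Commute S.z g) (hord : orderOf S.z = 2) :
    ∃ (D : QuadraticData) (g : Fin 4 → G) (u : G), LiftRelations D g S.z u ∧
      (∀ i, (g i : G ⧸ N) = S.fst i) ∧ u ∈ N ∧ u ≠ 1 := by
  obtain ⟨σ, hσ⟩ := exists_section hG hN
  have hz2 : S.z ^ 2 = 1 := pow_two_of_orderOf hord
  have hzN : S.z ∉ N := fun hm => by
    have h3 := pow_three_of_mem hN hm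
    rw [pow_succ, hz2, one_mul] at h3
    exact hz h3
  set T := S.map (QuotientGroup.mk' N) with hT
  have hTc : T.ConjugacyRelations := h.map _
  have hTz : T.z ≠ 1 := fun e => hzN ((QuotientGroup.eq_one_iff _).mp e)
  have hcard := card_quotient_of_card_three hG hN
  have hTo := (hTc.central_of_card_thirtyTwo hcard hTz).2
  -- The two elements differ by an element of `N` whose square is 1, because `z` is a central
  -- involution. Such an element is trivial.
  have hσz : σ T.z = S.z := by
    have h1 : (S.z)⁻¹ * σ T.z ∈ N := by
      rw [← QuotientGroup.eq]
      exact (hσ T.z).symm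
    have h2 : ((S.z)⁻¹ * σ T.z) ^ 2 = 1 := by
      rw [(hcen _).inv_left.mul_pow, inv_pow, hz2, ← map_pow, pow_two_of_orderOf hTo]
      simp
    have h3 := pow_three_of_mem hN h1
    rw [pow_succ, h2, one_mul] at h3
    exact (inv_mul_eq_one.mp h3).symm
  obtain ⟨u, huN, hu⟩ : ∃ u ∈ N, u ≠ 1 := by
    have : Nontrivial N := by
      have := finite_of_card (by norm_num) hG
      exact Finite.one_lt_card_iff_nontrivial.mp (by omega)
    obtain ⟨u, hu⟩ := exists_ne (1 : N)
    exact ⟨u, u.2, fun e => hu (Subtype.ext e)⟩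
  have hu3 := pow_three_of_mem hN huN
  have hmemN : ∀ x ∈ N, x ≠ 1 → x = u ∨ x = u⁻¹ := fun x hx hx1 =>
    eq_or_eq_inv_of_card_three hN huN hu hx hx1
  have hbz : ∀ b, σ (bpow T.z b) = bpow S.z b := fun b => by rw [map_bpow, hσz]
  choose q hq using fun i => exists_bpow_of_mem_zpowers hTo (hTc.sq_mem hcard hTz (T.fst i))
  choose a ha using fun i j =>
    exists_bpow_of_mem_zpowers hTo (hTc.commutator_mem hcard hTz (T.fst i) (T.fst j))
  have hact : ∀ i, ∃ f : Bool, σ (T.fst i) * u * (σ (T.fst i))⁻¹ = cond f u⁻¹ u := by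
    intro i
    have h1 : σ (T.fst i) * u * (σ (T.fst i))⁻¹ ≠ 1 := fun e => hu (by simpa using e)
    rcases hmemN _ (Subgroup.Normal.conj_mem ‹_› u huN _) h1 with h2 | h2
    · exact ⟨false, h2⟩
    · exact ⟨true, h2⟩
  choose f hf using hact
  have hcomm : ∀ i j, ⁅σ (T.fst i), σ (T.fst j)⁆ = bpow S.z (a i j) := fun i j => by
    rw [← map_commutatorElement, ha, hbz]
  refine ⟨⟨![a 0 1, a 0 2, a 0 3, a 1 2, a 1 3, a 2 3], q, f⟩, fun i => σ (T.fst i), u,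
    ⟨fun i => hcen _, hcen _, by rw [← pow_two, hz2], hu3, fun i => ?_, hcomm _ _, hcomm _ _,
      hcomm _ _, hcomm _ _, hcomm _ _, hcomm _ _, hf⟩, fun i => ?_, huN, hu⟩
  · rw [← map_mul, ← pow_two, hq, hbz]
  · rw [hσ]
    fin_cases i <;> rfl

theorem exists_equiv (hG : Nat.card G = 96) (hmon : ¬ IsMonolithic G) {S : KodairaTuple 2 G}
    (h : S.ConjugacyRelations) (hz : S.z ≠ 1) :
    ∃ D : QuadraticData, D.pf = 1 ∧ Nonempty (ModelGroup D ≃* G) := by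
  obtain ⟨⟨N, hNn, hN⟩, hcen, hord⟩ := h.exists_normal_card_three hG hmon hz
  obtain ⟨D, g, u, hL, hg, huN, hu⟩ := exists_liftRelations hG hN h hz hcen hord
  have hzz : S.z * S.z = 1 := hL.z_z
  have hzN : S.z ∉ N := fun hm => by
    have h3 := pow_three_of_mem hN hm
    rw [pow_succ, pow_two, hzz, one_mul] at h3
    exact hz h3
  set π := QuotientGroup.mk' N
  have hfs : ∀ i j, ⁅π (S.fst i), π (S.snd j)⁆ = if i = j then π S.z else 1 := fun i j => by
    have h1 := h
    rw [← ofPairs_fst_snd S] at h1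
    rw [← map_commutatorElement, (conjugacyRelations_ofPairs_iff hcen hzz).mp h1 i j]
    split_ifs
    · rfl
    · exact map_one π
  have hπz : ∀ y, Commute (π S.z) y := fun y => by
    obtain ⟨x, rfl⟩ := QuotientGroup.mk'_surjective N y
    exact (hcen x).map π
  have hπzz : π S.z * π S.z = 1 := by rw [← map_mul, hzz, map_one]
  have hbp : ∀ s, bpow (π S.z) s = 1 → s = 0 := fun s hs => by
    cases s
    · rfl
    · exact absurd ((QuotientGroup.eq_one_iff _).mp hs) hzN
  have hπu : π u = 1 := (QuotientGroup.eq_one_iff _).mpr huN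
  have hπg : ∀ i, π (g i) = π (S.fst i) := hg
  have hinj : Function.Injective hL.lift := by
    rw [injective_iff_map_eq_one]
    intro x hx
    have h1 : π (hL.lift x) = (bpow (π (S.fst 0)) (x.v 0) * (bpow (π (S.fst 1)) (x.v 1) *
        (bpow (π (S.fst 2)) (x.v 2) * bpow (π (S.fst 3)) (x.v 3)))) * bpow (π S.z) x.s := by
      rw [LiftRelations.lift_apply]
      simp only [LiftRelations.fn, map_mul, map_bpow, map_cpow, hπu, hπg]
      simp [cpow]
    have h2 : ∀ i j t, ⁅bpow (π (S.fst i)) t, π (S.snd j)⁆ =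
        bpow (π S.z) (if i = j then t else 0) := fun i j t => by
      rw [commutatorElement_bpow (hfs i j)]
      split_ifs
      · rfl
      · cases t <;> rfl
    have h3 : ∀ j, ⁅bpow (π S.z) x.s, π (S.snd j)⁆ = bpow (π S.z) 0 := fun j =>
      commutatorElement_eq_one_iff_commute.mpr (commute_bpow (hπz _) _)
    have hv : x.v = 0 := by
      funext j
      -- Modulo `N`, the commutator with the `j`-th element of the second half reads off the
      -- coordinate `x.v j`.
      have h4 := commutatorElement_mul_left_eq_bpow hπz hπzz
        (commutatorElement_mul_left_eq_bpow hπz hπzz (h2 0 j (x.v 0))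
        (commutatorElement_mul_left_eq_bpow hπz hπzz (h2 1 j (x.v 1))
        (commutatorElement_mul_left_eq_bpow hπz hπzz (h2 2 j (x.v 2)) (h2 3 j (x.v 3))))) (h3 j)
      rw [← h1, hx, map_one, commutatorElement_one_left] at h4
      have h5 := hbp _ h4.symm
      fin_cases j <;> simpa using h5
    obtain ⟨v, s, c⟩ := x
    obtain rfl : v = 0 := hv
    rw [hL.lift_vertical] at hx
    have hs : s = 0 := hbp s (by
      have h6 := congrArg π hx
      rw [map_mul, map_cpow, map_bpow, hπu] at h6
      simpa [cpow] using h6)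
    subst hs
    rw [bpow_zero, mul_one, cpow] at hx
    have hc : c = 0 := by
      have ho : orderOf u = 3 := orderOf_eq_prime hL.u_u hu
      have h7 := orderOf_dvd_of_pow_eq_one hx
      rw [ho] at h7
      have h8 := ZMod.val_lt c
      have h9 : c.val = 0 := by omega
      exact (ZMod.val_eq_zero c).mp h9
    subst hc
    rfl
  have hfin := finite_of_card (by norm_num) hG
  let e : ModelGroup D ≃* G := MulEquiv.ofBijective hL.lift
    ((Nat.bijective_iff_injective_and_card _).mpr ⟨hinj, by rw [card, hG]⟩)
  -- Non-degeneracy comes from transporting the prestructure to the model group and passing to its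
  -- standard tuple, whose data have Pfaffian 1.
  obtain ⟨-, D', e', -, -, -, hpf, -, -⟩ := exists_stdTuple (h.map e.symm.toMonoidHom)
    (fun h0 => hz ((map_eq_one_iff _ e.symm.injective).mp h0))
  exact ⟨D', hpf, ⟨e'.trans e⟩⟩

end ModelGroup

/-! ### Presentations of the model groups -/

namespace SmallGroups

variable {m : ℕ} {e : Fin m → ℕ} {q : Fin m → FreeGroup (Fin m)}
  {c : Fin m → Fin m → FreeGroup (Fin m)} {G : Type*} [Group G]

/-- The images of the generators satisfy the relations. -/
theorem lift_relators_eq_one {g : Fin m → G} (hpow : ∀ i, g i ^ e i = FreeGroup.lift g (q i))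
    (hcomm : ∀ i j, i < j → ⁅g i, g j⁆ = FreeGroup.lift g (c i j)) :
    ∀ r ∈ relators e q c, FreeGroup.lift g r = 1 := by
  rintro r (⟨i, rfl⟩ | ⟨i, j, hij, rfl⟩)
  · rw [map_mul, map_inv, map_pow, FreeGroup.lift_apply_of, hpow, mul_inv_cancel]
  · rw [map_mul, map_inv, map_commutatorElement, FreeGroup.lift_apply_of, FreeGroup.lift_apply_of,
      hcomm i j hij, mul_inv_cancel]

theorem lift_of_eq_mk (w : FreeGroup (Fin m)) :
    FreeGroup.lift (PresentedGroup.of (rels := relators e q c)) w =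
      PresentedGroup.mk (relators e q c) w := by
  have : FreeGroup.lift (PresentedGroup.of (rels := relators e q c)) =
      PresentedGroup.mk (relators e q c) := by
    ext i
    simp [PresentedGroup.of]
  rw [this]

theorem of_pow (i : Fin m) : (PresentedGroup.of i : PresentedGroup (relators e q c)) ^ e i =
    FreeGroup.lift PresentedGroup.of (q i) := by
  rw [lift_of_eq_mk, ← mul_inv_eq_one, PresentedGroup.of, ← map_pow, ← map_inv, ← map_mul]
  exact PresentedGroup.one_of_mem (Or.inl ⟨i, rfl⟩)

theorem of_comm {i j : Fin m} (hij : i < j) :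
    ⁅(PresentedGroup.of i : PresentedGroup (relators e q c)),
      (PresentedGroup.of j : PresentedGroup (relators e q c))⁆ =
    FreeGroup.lift PresentedGroup.of (c i j) := by
  rw [lift_of_eq_mk, ← mul_inv_eq_one, PresentedGroup.of, PresentedGroup.of,
    ← map_commutatorElement, ← map_inv, ← map_mul]
  exact PresentedGroup.one_of_mem (Or.inr ⟨i, j, hij, rfl⟩)

theorem lift_bpow (g : Fin m → G) (i : Fin m) (b : Bool) :
    FreeGroup.lift g (bpow (x i) b) = bpow (g i) b := by
  rw [map_bpow, FreeGroup.lift_apply_of]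

/-- The exponents of the generators of the groups of order `96`. -/
abbrev exponents96 : Fin 6 → ℕ := ![2, 2, 2, 2, 2, 3]

/-- The exponents of the generators of the groups of order `32`. -/
abbrev exponents32 : Fin 5 → ℕ := ![2, 2, 2, 2, 2]

/-- The words `q` and `c` present the model group of `D`. -/
structure Presents96 (D : QuadraticData) (q : Fin 6 → FreeGroup (Fin 6))
    (c : Fin 6 → Fin 6 → FreeGroup (Fin 6)) : Prop where
  q_g : ∀ i : Fin 4, q (i.castAdd 2) = bpow (x 4) (D.q i)
  q_z : q 4 = 1
  q_u : q 5 = 1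
  c₀₁ : c 0 1 = bpow (x 4) (D.a 0)
  c₀₂ : c 0 2 = bpow (x 4) (D.a 1)
  c₀₃ : c 0 3 = bpow (x 4) (D.a 2)
  c₁₂ : c 1 2 = bpow (x 4) (D.a 3)
  c₁₃ : c 1 3 = bpow (x 4) (D.a 4)
  c₂₃ : c 2 3 = bpow (x 4) (D.a 5)
  c_z : ∀ i : Fin 4, c (i.castAdd 2) 4 = 1
  c_u : ∀ i : Fin 4, c (i.castAdd 2) 5 = bpow (x 5) (D.f i)
  c_zu : c 4 5 = 1

/-- The words `q` and `c` present the quotient by `ℤ/3` of the model group of `D`. -/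
structure Presents32 (D : QuadraticData) (q : Fin 5 → FreeGroup (Fin 5))
    (c : Fin 5 → Fin 5 → FreeGroup (Fin 5)) : Prop where
  q_g : ∀ i : Fin 4, q (i.castAdd 1) = bpow (x 4) (D.q i)
  q_z : q 4 = 1
  c₀₁ : c 0 1 = bpow (x 4) (D.a 0)
  c₀₂ : c 0 2 = bpow (x 4) (D.a 1)
  c₀₃ : c 0 3 = bpow (x 4) (D.a 2)
  c₁₂ : c 1 2 = bpow (x 4) (D.a 3)
  c₁₃ : c 1 3 = bpow (x 4) (D.a 4)
  c₂₃ : c 2 3 = bpow (x 4) (D.a 5)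
  c_z : ∀ i : Fin 4, c (i.castAdd 1) 4 = 1

theorem forall_lt_six {P : Fin 6 → Fin 6 → Prop} (h₀₁ : P 0 1) (h₀₂ : P 0 2) (h₀₃ : P 0 3)
    (h₁₂ : P 1 2) (h₁₃ : P 1 3) (h₂₃ : P 2 3) (hz : ∀ i : Fin 4, P (i.castAdd 2) 4)
    (hu : ∀ i : Fin 4, P (i.castAdd 2) 5) (hzu : P 4 5) : ∀ i j, i < j → P i j := by
  intro i j hij
  fin_cases i <;> fin_cases j <;> first
    | exact absurd hij (by decide) | assumption
    | exact hz 0 | exact hz 1 | exact hz 2 | exact hz 3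
    | exact hu 0 | exact hu 1 | exact hu 2 | exact hu 3

theorem forall_lt_five {P : Fin 5 → Fin 5 → Prop} (h₀₁ : P 0 1) (h₀₂ : P 0 2) (h₀₃ : P 0 3)
    (h₁₂ : P 1 2) (h₁₃ : P 1 3) (h₂₃ : P 2 3) (hz : ∀ i : Fin 4, P (i.castAdd 1) 4) :
    ∀ i j, i < j → P i j := by
  intro i j hij
  fin_cases i <;> fin_cases j <;> first
    | exact absurd hij (by decide) | assumption
    | exact hz 0 | exact hz 1 | exact hz 2 | exact hz 3

end SmallGroups

/-! ### Isomorphisms with presented groups. -/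

namespace ModelGroup

open QuadraticData SmallGroups

variable {D : QuadraticData}

theorem map_fn {G G' : Type*} [Group G] [Group G'] (φ : G →* G') (g : Fin 4 → G) (z u : G)
    (y : ModelGroup D) : φ (LiftRelations.fn g z u y) =
      LiftRelations.fn (fun i => φ (g i)) (φ z) (φ u) y := by
  simp only [LiftRelations.fn, map_mul, map_bpow, map_cpow]

theorem commutator_eq_bpow_of_act {G : Type*} [Group G] {g u : G} {f : Bool} (hu : u ^ 3 = 1)
    (h : g * u * g⁻¹ = cond f u⁻¹ u) : ⁅g, u⁆ = bpow u f := by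
  rw [commutatorElement_def, h]
  cases f
  · exact mul_inv_cancel u
  · change u⁻¹ * u⁻¹ = u
    rw [← mul_inv_rev, inv_eq_iff_mul_eq_one, ← pow_two, ← pow_succ]
    exact hu

theorem act_of_commutator_eq_bpow {G : Type*} [Group G] {g u : G} {f : Bool} (hu : u ^ 3 = 1)
    (h : ⁅g, u⁆ = bpow u f) : g * u * g⁻¹ = cond f u⁻¹ u := by
  rw [commutatorElement_def, mul_inv_eq_iff_eq_mul] at h
  rw [h]
  cases f
  · exact one_mul u
  · change u * u = u⁻¹
    rw [← mul_eq_one_iff_eq_inv, ← pow_two, ← pow_succ]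
    exact hu

section Order96

variable {q : Fin 6 → FreeGroup (Fin 6)} {c : Fin 6 → Fin 6 → FreeGroup (Fin 6)}

theorem liftRelations_of_presents96 (h : Presents96 D q c) :
    LiftRelations D (fun i => (PresentedGroup.of (i.castAdd 2) :
      PresentedGroup (relators exponents96 q c))) (PresentedGroup.of 4) (PresentedGroup.of 5) := by
  have hp : ∀ i, _ := of_pow (e := exponents96) (q := q) (c := c)
  have hc : ∀ i j, i < j → _ := fun i j => of_comm (e := exponents96) (q := q) (c := c) (i := i)
    (j := j)
  have he : ∀ i : Fin 4, exponents96 (i.castAdd 2) = 2 := by decide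
  refine ⟨fun i => ?_, ?_, ?_, ?_, fun i => ?_, ?_, ?_, ?_, ?_, ?_, ?_, fun i => ?_⟩
  · refine (commutatorElement_eq_one_iff_commute.mp ?_).symm
    rw [hc _ _ (by revert i; decide), h.c_z, map_one]
  · refine commutatorElement_eq_one_iff_commute.mp ?_
    rw [hc _ _ (by decide), h.c_zu, map_one]
  · rw [← pow_two]
    exact (hp 4).trans (by rw [h.q_z, map_one])
  · exact (hp 5).trans (by rw [h.q_u, map_one])
  · have h1 := hp (i.castAdd 2)
    rw [he, h.q_g, lift_bpow, pow_two] at h1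
    exact h1
  · exact (hc 0 1 (by decide)).trans (by rw [h.c₀₁, lift_bpow])
  · exact (hc 0 2 (by decide)).trans (by rw [h.c₀₂, lift_bpow])
  · exact (hc 0 3 (by decide)).trans (by rw [h.c₀₃, lift_bpow])
  · exact (hc 1 2 (by decide)).trans (by rw [h.c₁₂, lift_bpow])
  · exact (hc 1 3 (by decide)).trans (by rw [h.c₁₃, lift_bpow])
  · exact (hc 2 3 (by decide)).trans (by rw [h.c₂₃, lift_bpow])
  · have h1 := hc (i.castAdd 2) 5 (by revert i; decide)
    rw [h.c_u, lift_bpow] at h1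
    exact act_of_commutator_eq_bpow ((hp 5).trans (by rw [h.q_u, map_one])) h1

/-- The generators of the model group. -/
def generators96 (D : QuadraticData) : Fin 6 → ModelGroup D :=
  ![ofVec D (stdBasis 0) 0, ofVec D (stdBasis 1) 0, ofVec D (stdBasis 2) 0,
    ofVec D (stdBasis 3) 0, zed D, cub D]

theorem generators96_castAdd (i : Fin 4) :
    generators96 D (i.castAdd 2) = ofVec D (stdBasis i) 0 := by
  fin_cases i <;> rfl

theorem presents96_relators (h : Presents96 D q c) :
    ∀ r ∈ relators exponents96 q c, FreeGroup.lift (generators96 D) r = 1 := by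
  have hL := liftRelations_stdBasis D
  refine lift_relators_eq_one ?_ ?_
  · have h4 : ∀ i : Fin 4, generators96 D (i.castAdd 2) ^ exponents96 (i.castAdd 2) =
        FreeGroup.lift (generators96 D) (q (i.castAdd 2)) := by
      intro i
      have he : ∀ i : Fin 4, exponents96 (i.castAdd 2) = 2 := by decide
      rw [he, h.q_g, lift_bpow, generators96_castAdd, pow_two]
      exact hL.sq i
    intro i
    fin_cases i
    · exact h4 0
    · exact h4 1
    · exact h4 2
    · exact h4 3
    · exact ((pow_two _).trans hL.z_z).trans ((congrArg _ h.q_z).trans (map_one _)).symm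
    · exact hL.u_u.trans ((congrArg _ h.q_u).trans (map_one _)).symm
  · refine forall_lt_six ?_ ?_ ?_ ?_ ?_ ?_ (fun i => ?_) (fun i => ?_) ?_
    · exact hL.comm₀₁.trans (by rw [h.c₀₁, lift_bpow]; rfl)
    · exact hL.comm₀₂.trans (by rw [h.c₀₂, lift_bpow]; rfl)
    · exact hL.comm₀₃.trans (by rw [h.c₀₃, lift_bpow]; rfl)
    · exact hL.comm₁₂.trans (by rw [h.c₁₂, lift_bpow]; rfl)
    · exact hL.comm₁₃.trans (by rw [h.c₁₃, lift_bpow]; rfl)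
    · exact hL.comm₂₃.trans (by rw [h.c₂₃, lift_bpow]; rfl)
    · rw [h.c_z, map_one, commutatorElement_eq_one_iff_commute]
      exact (zed_commute _).symm
    · rw [h.c_u, lift_bpow, generators96_castAdd]
      exact commutator_eq_bpow_of_act hL.u_u (hL.act i)
    · rw [h.c_zu, map_one, commutatorElement_eq_one_iff_commute]
      exact zed_commute _

/-- The model group is given by its presentation. -/
theorem nonempty_mulEquiv_presentedGroup (h : Presents96 D q c) :
    Nonempty (ModelGroup D ≃* PresentedGroup (relators exponents96 q c)) := by
  have hL := liftRelations_of_presents96 h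
  let φ : PresentedGroup (relators exponents96 q c) →* ModelGroup D :=
    PresentedGroup.toGroup (presents96_relators h)
  have hφ : ∀ i, φ (PresentedGroup.of i) = generators96 D i := fun i => PresentedGroup.toGroup.of _
  refine ⟨MonoidHom.toMulEquiv hL.lift φ ?_ ?_⟩
  · ext1 y
    change φ (hL.lift y) = y
    rw [LiftRelations.lift_apply, map_fn]
    simp only [hφ, generators96_castAdd]
    exact fn_stdBasis y
  · refine PresentedGroup.ext fun i => ?_
    change hL.lift (φ (PresentedGroup.of i)) = PresentedGroup.of i
    rw [hφ]
    have hz : hL.lift (zed D) = PresentedGroup.of 4 := by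
      rw [zed, hL.lift_vertical, cpow_zero, one_mul]; rfl
    have hu : hL.lift (cub D) = PresentedGroup.of 5 := by
      rw [cub, hL.lift_vertical, cpow_one, bpow_zero, mul_one]
    fin_cases i
    · exact hL.lift_stdBasis 0
    · exact hL.lift_stdBasis 1
    · exact hL.lift_stdBasis 2
    · exact hL.lift_stdBasis 3
    · exact hz
    · exact hu

end Order96

section Order32

variable {q : Fin 5 → FreeGroup (Fin 5)} {c : Fin 5 → Fin 5 → FreeGroup (Fin 5)}

/-- The generator of order 3 is sent to 1, so the relations hold whatever `f` is. -/
theorem liftRelations_of_presents32 (h : Presents32 D q c) :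
    LiftRelations D (fun i => (PresentedGroup.of (i.castAdd 1) :
      PresentedGroup (relators exponents32 q c))) (PresentedGroup.of 4) 1 := by
  have hp : ∀ i, _ := of_pow (e := exponents32) (q := q) (c := c)
  have hc : ∀ i j, i < j → _ := fun i j => of_comm (e := exponents32) (q := q) (c := c) (i := i)
    (j := j)
  have he : ∀ i : Fin 4, exponents32 (i.castAdd 1) = 2 := by decide
  refine ⟨fun i => ?_, Commute.one_right _, ?_, one_pow 3, fun i => ?_, ?_, ?_, ?_, ?_, ?_, ?_,
    fun i => ?_⟩
  · refine (commutatorElement_eq_one_iff_commute.mp ?_).symm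
    rw [hc _ _ (by revert i; decide), h.c_z, map_one]
  · rw [← pow_two]
    exact (hp 4).trans (by rw [h.q_z, map_one])
  · have h1 := hp (i.castAdd 1)
    rw [he, h.q_g, lift_bpow, pow_two] at h1
    exact h1
  · exact (hc 0 1 (by decide)).trans (by rw [h.c₀₁, lift_bpow])
  · exact (hc 0 2 (by decide)).trans (by rw [h.c₀₂, lift_bpow])
  · exact (hc 0 3 (by decide)).trans (by rw [h.c₀₃, lift_bpow])
  · exact (hc 1 2 (by decide)).trans (by rw [h.c₁₂, lift_bpow])
  · exact (hc 1 3 (by decide)).trans (by rw [h.c₁₃, lift_bpow])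
  · exact (hc 2 3 (by decide)).trans (by rw [h.c₂₃, lift_bpow])
  · cases D.f i <;> simp

/-- The generators of a complement of the normal subgroup of order three. -/
def generators32 (D : QuadraticData) : Fin 5 → ModelGroup D :=
  ![ofVec D (stdBasis 0) 0, ofVec D (stdBasis 1) 0, ofVec D (stdBasis 2) 0,
    ofVec D (stdBasis 3) 0, zed D]

theorem generators32_castAdd (i : Fin 4) :
    generators32 D (i.castAdd 1) = ofVec D (stdBasis i) 0 := by
  fin_cases i <;> rfl

theorem presents32_relators (h : Presents32 D q c) :
    ∀ r ∈ relators exponents32 q c, FreeGroup.lift (generators32 D) r = 1 := by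
  have hL := liftRelations_stdBasis D
  refine lift_relators_eq_one ?_ ?_
  · have h4 : ∀ i : Fin 4, generators32 D (i.castAdd 1) ^ exponents32 (i.castAdd 1) =
        FreeGroup.lift (generators32 D) (q (i.castAdd 1)) := by
      intro i
      have he : ∀ i : Fin 4, exponents32 (i.castAdd 1) = 2 := by decide
      rw [he, h.q_g, lift_bpow, generators32_castAdd, pow_two]
      exact hL.sq i
    intro i
    fin_cases i
    · exact h4 0
    · exact h4 1
    · exact h4 2
    · exact h4 3
    · exact ((pow_two _).trans hL.z_z).trans ((congrArg _ h.q_z).trans (map_one _)).symm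
  · refine forall_lt_five ?_ ?_ ?_ ?_ ?_ ?_ fun i => ?_
    · exact hL.comm₀₁.trans (by rw [h.c₀₁, lift_bpow]; rfl)
    · exact hL.comm₀₂.trans (by rw [h.c₀₂, lift_bpow]; rfl)
    · exact hL.comm₀₃.trans (by rw [h.c₀₃, lift_bpow]; rfl)
    · exact hL.comm₁₂.trans (by rw [h.c₁₂, lift_bpow]; rfl)
    · exact hL.comm₁₃.trans (by rw [h.c₁₃, lift_bpow]; rfl)
    · exact hL.comm₂₃.trans (by rw [h.c₂₃, lift_bpow]; rfl)
    · rw [h.c_z, map_one, commutatorElement_eq_one_iff_commute]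
      exact (zed_commute _).symm

theorem lift_presents32_surjective (h : Presents32 D q c) :
    Function.Surjective (liftRelations_of_presents32 h).lift := by
  have hL := liftRelations_of_presents32 h
  rw [← MonoidHom.range_eq_top, eq_top_iff, ← PresentedGroup.closure_range_of, Subgroup.closure_le]
  rintro _ ⟨i, rfl⟩
  have hz : hL.lift (zed D) = PresentedGroup.of 4 := by
    rw [zed, hL.lift_vertical, cpow_zero, one_mul]; rfl
  fin_cases i
  · exact ⟨_, hL.lift_stdBasis 0⟩
  · exact ⟨_, hL.lift_stdBasis 1⟩
  · exact ⟨_, hL.lift_stdBasis 2⟩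
  · exact ⟨_, hL.lift_stdBasis 3⟩
  · exact ⟨_, hz⟩

/-- Mapping the presented group back to the complement, the composite only erases the component in
`ℤ/3`, so nothing else can be killed. -/
theorem lift_presents32_eq_one_iff (h : Presents32 D q c) (y : ModelGroup D) :
    (liftRelations_of_presents32 h).lift y = 1 ↔ y ∈ cubSubgroup D := by
  have hL := liftRelations_of_presents32 h
  constructor
  · intro hy
    let φ : PresentedGroup (relators exponents32 q c) →* ModelGroup D :=
      PresentedGroup.toGroup (presents32_relators h)
    have hφ : ∀ i, φ (PresentedGroup.of i) = generators32 D i :=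
      fun i => PresentedGroup.toGroup.of _
    have h1 := congrArg φ hy
    rw [LiftRelations.lift_apply, map_fn] at h1
    simp only [hφ, generators32_castAdd, map_one] at h1
    have h2 : LiftRelations.fn (fun i => ofVec D (stdBasis i) 0) (zed D) 1 y = ⟨y.v, y.s, 0⟩ := by
      refine Eq.trans ?_ (fn_stdBasis ⟨y.v, y.s, 0⟩)
      simp [LiftRelations.fn, cpow]
    have h3 := h2.symm.trans h1
    exact ⟨congrArg ModelGroup.v h3, congrArg ModelGroup.s h3⟩
  · rintro ⟨hv, hs⟩
    obtain ⟨v, s, k⟩ := y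
    obtain rfl : v = 0 := hv
    obtain rfl : s = 0 := hs
    rw [LiftRelations.lift_vertical]
    simp [cpow]

/-- The quotient by the normal subgroup of order three is given by its presentation. -/
theorem nonempty_quotient_mulEquiv {G : Type*} [Group G] (h : Presents32 D q c)
    (e : ModelGroup D ≃* G) {N : Subgroup G} [N.Normal] (hN : Nat.card N = 3) :
    Nonempty (G ⧸ N ≃* PresentedGroup (relators exponents32 q c)) := by
  have hG : Nat.card G = 96 := (Nat.card_congr e.symm.toEquiv).trans (card D)
  let φ := (liftRelations_of_presents32 h).lift.comp e.symm.toMonoidHom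
  -- Both subgroups consist of the elements with trivial cube.
  have hker : N = φ.ker := by
    ext y
    rw [MonoidHom.mem_ker]
    change _ ↔ (liftRelations_of_presents32 h).lift (e.symm y) = 1
    rw [lift_presents32_eq_one_iff h]
    constructor
    · intro hy
      refine mem_of_pow_three_eq_one (card D) card_cubSubgroup ?_
      rw [← map_pow, pow_three_of_mem hN hy, map_one]
    · intro hy
      refine mem_of_pow_three_eq_one hG hN ?_
      rw [← map_eq_one_iff e.symm e.symm.injective, map_pow]
      exact pow_three_of_mem card_cubSubgroup hy
  exact ⟨(QuotientGroup.quotientMulEquivOfEq hker).trans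
    (QuotientGroup.quotientKerEquivOfSurjective φ
      ((lift_presents32_surjective h).comp e.symm.surjective))⟩

end Order32

end ModelGroup

/-! ### The six groups -/

theorem IsMonolithic.of_equiv {G G' : Type*} [Group G] [Group G'] (e : G ≃* G')
    (h : IsMonolithic G') : IsMonolithic G := by
  obtain ⟨y, hy, hy1⟩ := (monolith G').bot_or_exists_ne_one.resolve_left h
  intro hbot
  refine hy1 ?_
  rw [← map_eq_one_iff e.symm e.symm.injective, ← Subgroup.mem_bot, ← hbot]
  refine Subgroup.mem_sInf.mpr fun N ⟨hN, hne⟩ => ?_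
  have h1 : y ∈ N.comap e.symm.toMonoidHom := by
    refine Subgroup.mem_sInf.mp hy _ ⟨hN.comap _, fun h0 => hne ?_⟩
    rw [eq_bot_iff]
    intro w hw
    have h2 : e w ∈ N.comap e.symm.toMonoidHom := by simpa using hw
    rw [h0, Subgroup.mem_bot, map_eq_one_iff e e.injective] at h2
    exact h2
  exact h1

section

variable {G : Type*} [Group G]

theorem exists_hasExtraSpecialQuotient32 (hG : Nat.card G = 96) (hmon : ¬ IsMonolithic G)
    {S : KodairaTuple 2 G} (h : S.ConjugacyRelations) (hz : S.z ≠ 1) :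
    ∃ N : Subgroup G, N.Normal ∧ Nat.card N = 3 ∧ HasExtraSpecialQuotient32 N := by
  obtain ⟨⟨N, hN, hN3⟩, -, hord⟩ := h.exists_normal_card_three hG hmon hz
  refine ⟨N, hN, hN3, h.hasExtraSpecialQuotient32 hG hN3 fun hm => hz ?_⟩
  have h1 := pow_three_of_mem hN3 hm
  rwa [pow_succ, pow_two_of_orderOf hord, one_mul] at h1

theorem IsPrestructure.z_ne_one {n : ℕ} {S : KodairaTuple 2 G} (h : IsPrestructure n S) :
    S.z ≠ 1 := fun e => by
  have h1 := h.order_z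
  have h2 := h.two_le_type
  rw [e, orderOf_one] at h1
  omega

theorem AdmitsDiagonalDoubleKodairaStructure.type_eq (hG : Nat.card G = 96)
    (hmon : ¬ IsMonolithic G) {b n : ℕ} (h : AdmitsDiagonalDoubleKodairaStructure G b n) :
    b = 2 ∧ n = 2 := by
  obtain ⟨S, hS⟩ := h
  have hz := ModelGroup.z_ne_one_of_structure hS
  obtain rfl : b = 2 := le_antisymm (hS.conjugacy.genus_le_two hG hmon hz) hS.two_le_genus
  refine ⟨rfl, ?_⟩
  rw [← hS.order_z]
  exact (hS.conjugacy.exists_normal_card_three hG hmon hz).2.2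

end

/-! ### Verification of the table. -/

namespace ModelGroup

open QuadraticData SmallGroups

variable {G : Type*} [Group G] {D : QuadraticData}

theorem card_of_equiv (e : ModelGroup D ≃* G) : Nat.card G = 96 :=
  (Nat.card_congr e.symm.toEquiv).trans (card D)

theorem not_isMonolithic_of_equiv (e : ModelGroup D ≃* G) : ¬ IsMonolithic G :=
  fun h => not_isMonolithic (h.of_equiv e)

theorem isTableRow {q : Fin 5 → FreeGroup (Fin 5)} {c : Fin 5 → Fin 5 → FreeGroup (Fin 5)}
    (hpf : D.pf = 1) (h : Presents32 D q c) (e : ModelGroup D ≃* G) {m d : ℕ}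
    (hm : numberOfPrestructures G = m) (hd : numberOfDiagonalDoubleKodairaStructures G 2 2 = d) :
    IsTableRow G (PresentedGroup (relators exponents32 q c)) m d := by
  have hG := card_of_equiv e
  have hmon := not_isMonolithic_of_equiv e
  obtain ⟨hz, hS⟩ := map_stdTuple_conjugacyRelations hpf e 0 (c := 0) (d := 0) (Or.inr ⟨rfl, rfl⟩)
  refine ⟨hG, hmon, ⟨_, le_rfl, (hS.exists_normal_card_three hG hmon hz).2.2, hS⟩, ?_, ?_, hm, hd,
    fun b n hb hbn => ?_⟩
  · obtain ⟨N, -, -, hN⟩ := exists_hasExtraSpecialQuotient32 hG hmon hS hz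
    exact ⟨N, hN⟩
  · intro N hN
    have h3 := hN.card_eq_three hG
    obtain ⟨hn, -⟩ := hN
    exact ⟨hn, nonempty_quotient_mulEquiv h e h3⟩
  · have := (hbn.type_eq hG hmon).1
    omega

/-- Data whose quadratic form is that of the presentations of the groups of order `32`. -/
def extensionData : Bool × Bool × Bool → QuadraticData
  | (x, y, t) => ⟨zigzag, cond x ![false, true, true, false] fun _ => false,
      cond y (cond t ![true, true, false, true] ![false, true, false, true]) fun _ => false⟩

theorem pf_extensionData (i : Bool × Bool × Bool) : (extensionData i).pf = 1 := by
  revert i; decide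

/-- The ramified groups of order 96 are presented with the hyperbolic form, those of order 32 with
the zigzag form. Data with equal invariants and the zigzag form connect the two. -/
theorem nonempty_mulEquiv_extensionData (i : Bool × Bool × Bool) :
    Nonempty (ModelGroup (extensionData i) ≃* ModelGroup (representative i)) := by
  rw [nonempty_mulEquiv_representative_iff (pf_extensionData i)]
  revert i; decide

theorem presents32_49 (y t : Bool) :
    Presents32 (extensionData (false, y, t)) ![1, 1, 1, 1, 1] comm32 :=
  ⟨fun i => by fin_cases i <;> rfl, rfl, rfl, rfl, rfl, rfl, rfl, rfl,
    fun i => by fin_cases i <;> rfl⟩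

theorem presents32_50 (y t : Bool) :
    Presents32 (extensionData (true, y, t)) ![1, x 4, x 4, 1, 1] comm32 :=
  ⟨fun i => by fin_cases i <;> rfl, rfl, rfl, rfl, rfl, rfl, rfl, rfl,
    fun i => by fin_cases i <;> rfl⟩

theorem nonempty_equiv_211 : Nonempty (ModelGroup data211 ≃* G96_211) :=
  nonempty_mulEquiv_presentedGroup ⟨fun i => by fin_cases i <;> rfl, rfl, rfl, rfl, rfl, rfl, rfl,
    rfl, rfl, fun i => by fin_cases i <;> rfl, fun i => by fin_cases i <;> rfl, rfl⟩

theorem nonempty_equiv_214 : Nonempty (ModelGroup data214 ≃* G96_214) :=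
  nonempty_mulEquiv_presentedGroup ⟨fun i => by fin_cases i <;> rfl, rfl, rfl, rfl, rfl, rfl, rfl,
    rfl, rfl, fun i => by fin_cases i <;> rfl, fun i => by fin_cases i <;> rfl, rfl⟩

theorem nonempty_equiv_216 : Nonempty (ModelGroup data216 ≃* G96_216) :=
  nonempty_mulEquiv_presentedGroup ⟨fun i => by fin_cases i <;> rfl, rfl, rfl, rfl, rfl, rfl, rfl,
    rfl, rfl, fun i => by fin_cases i <;> rfl, fun i => by fin_cases i <;> rfl, rfl⟩

theorem nonempty_equiv_217 : Nonempty (ModelGroup data217 ≃* G96_217) :=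
  nonempty_mulEquiv_presentedGroup ⟨fun i => by fin_cases i <;> rfl, rfl, rfl, rfl, rfl, rfl, rfl,
    rfl, rfl, fun i => by fin_cases i <;> rfl, fun i => by fin_cases i <;> rfl, rfl⟩

theorem nonempty_equiv_224 : Nonempty (ModelGroup data224 ≃* G96_224) :=
  nonempty_mulEquiv_presentedGroup ⟨fun i => by fin_cases i <;> rfl, rfl, rfl, rfl, rfl, rfl, rfl,
    rfl, rfl, fun i => by fin_cases i <;> rfl, fun i => by fin_cases i <;> rfl, rfl⟩

theorem nonempty_equiv_225 : Nonempty (ModelGroup data225 ≃* G96_225) :=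
  nonempty_mulEquiv_presentedGroup ⟨fun i => by fin_cases i <;> rfl, rfl, rfl, rfl, rfl, rfl, rfl,
    rfl, rfl, fun i => by fin_cases i <;> rfl, fun i => by fin_cases i <;> rfl, rfl⟩

theorem quotientIsoTo_49 {y t : Bool} (e : ModelGroup (representative (false, y, t)) ≃* G)
    {N : Subgroup G} (hn : N.Normal) (hN : Nat.card N = 3) : QuotientIsoTo N G32_49 := by
  obtain ⟨e'⟩ := nonempty_mulEquiv_extensionData (false, y, t)
  exact ⟨hn, nonempty_quotient_mulEquiv (presents32_49 y t) (e'.trans e) hN⟩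

theorem quotientIsoTo_50 {y t : Bool} (e : ModelGroup (representative (true, y, t)) ≃* G)
    {N : Subgroup G} (hn : N.Normal) (hN : Nat.card N = 3) : QuotientIsoTo N G32_50 := by
  obtain ⟨e'⟩ := nonempty_mulEquiv_extensionData (true, y, t)
  exact ⟨hn, nonempty_quotient_mulEquiv (presents32_50 y t) (e'.trans e) hN⟩

theorem isTableRow_49 {y t : Bool} (e : ModelGroup (representative (false, y, t)) ≃* G) {m d : ℕ}
    (hm : numberOfPrestructures G = m) (hd : numberOfDiagonalDoubleKodairaStructures G 2 2 = d) :
    IsTableRow G G32_49 m d := by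
  obtain ⟨e'⟩ := nonempty_mulEquiv_extensionData (false, y, t)
  exact isTableRow (pf_extensionData _) (presents32_49 y t) (e'.trans e) hm hd

theorem isTableRow_50 {y t : Bool} (e : ModelGroup (representative (true, y, t)) ≃* G) {m d : ℕ}
    (hm : numberOfPrestructures G = m) (hd : numberOfDiagonalDoubleKodairaStructures G 2 2 = d) :
    IsTableRow G G32_50 m d := by
  obtain ⟨e'⟩ := nonempty_mulEquiv_extensionData (true, y, t)
  exact isTableRow (pf_extensionData _) (presents32_50 y t) (e'.trans e) hm hd

theorem not_admits_of_ramified {x t : Bool} (e : ModelGroup (representative (x, true, t)) ≃* G)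
    (b n : ℕ) : ¬ AdmitsDiagonalDoubleKodairaStructure G b n := by
  intro h
  obtain ⟨rfl, rfl⟩ := h.type_eq (card_of_equiv e) (not_isMonolithic_of_equiv e)
  obtain ⟨S, hS⟩ := h
  exact not_isDiagonalDoubleKodairaStructure e
    (f_ne_zero_of_ramified (by cases x <;> cases t <;> rfl)) S hS

theorem admits_iff_of_unramified {x : Bool}
    (e : ModelGroup (representative (x, false, false)) ≃* G) (b n : ℕ) :
    AdmitsDiagonalDoubleKodairaStructure G b n ↔ b = 2 ∧ n = 2 := by
  refine ⟨fun h => h.type_eq (card_of_equiv e) (not_isMonolithic_of_equiv e), ?_⟩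
  rintro ⟨rfl, rfl⟩
  -- Any non-zero components in `ℤ/3` serve for generation, and the zigzag form has `a₀ = 1` and `a₅
  -- = 0`, as the surface relations require.
  refine ⟨_, (isDiagonalDoubleKodairaStructure_map_iff (pf_representative _) ?_ e 0
    (fun _ => 1) 0).mpr ⟨by cases x <;> rfl, fun h => ?_⟩⟩
  · rw [f_eq_zero_iff_ramified]
    cases x <;> rfl
  · exact absurd (congrFun (congrArg Prod.fst h) 0) (by simp)

/-- The classification of non-monolithic groups of order `96` with prestructures. -/
theorem exists_representative_equiv (hG : Nat.card G = 96) (hmon : ¬ IsMonolithic G)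
    {S : KodairaTuple 2 G} (h : S.ConjugacyRelations) (hz : S.z ≠ 1) :
    ∃ i, Nonempty (ModelGroup (representative i) ≃* G) := by
  obtain ⟨D, hpf, ⟨e⟩⟩ := exists_equiv hG hmon h hz
  obtain ⟨e'⟩ := nonempty_mulEquiv_representative hpf
  exact ⟨_, ⟨e'.symm.trans e⟩⟩

end ModelGroup

theorem proposition5p6 :
    -- every non-monolithic group of order 96 with a prestructure of type n
    (∀ (G : Type*) [Group G] (n : ℕ),
      Nat.card G = 96 → ¬ IsMonolithic G → AdmitsPrestructure G n →
        n = 2 ∧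
        ∃ N : Subgroup G, HasExtraSpecialQuotient32 N ∧
          (∀ N' : Subgroup G, HasExtraSpecialQuotient32 N' → N' = N) ∧
          (Nonempty (G ≃* SmallGroups.G96_211) ∧ QuotientIsoTo N SmallGroups.G32_49 ∨
           Nonempty (G ≃* SmallGroups.G96_216) ∧ QuotientIsoTo N SmallGroups.G32_49 ∨
           Nonempty (G ≃* SmallGroups.G96_224) ∧ QuotientIsoTo N SmallGroups.G32_49 ∨
           Nonempty (G ≃* SmallGroups.G96_214) ∧ QuotientIsoTo N SmallGroups.G32_50 ∨
           Nonempty (G ≃* SmallGroups.G96_217) ∧ QuotientIsoTo N SmallGroups.G32_50 ∨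
           Nonempty (G ≃* SmallGroups.G96_225) ∧ QuotientIsoTo N SmallGroups.G32_50)) ∧
    -- all six pairs occur, with the stated counts, and no structures with b ≥ 3
    IsTableRow SmallGroups.G96_211 SmallGroups.G32_49 40320 0 ∧
    IsTableRow SmallGroups.G96_216 SmallGroups.G32_49 26880 0 ∧
    IsTableRow SmallGroups.G96_224 SmallGroups.G32_49 14698880 6297600 ∧
    IsTableRow SmallGroups.G96_214 SmallGroups.G32_50 13440 0 ∧
    IsTableRow SmallGroups.G96_217 SmallGroups.G32_50 26880 0 ∧
    IsTableRow SmallGroups.G96_225 SmallGroups.G32_50 8819328 3778560 ∧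
    -- diagonal double Kodaira structures exist only on two of them, and are of type (2, 2)
    (∀ b n : ℕ,
      ¬ AdmitsDiagonalDoubleKodairaStructure SmallGroups.G96_211 b n ∧
      ¬ AdmitsDiagonalDoubleKodairaStructure SmallGroups.G96_216 b n ∧
      ¬ AdmitsDiagonalDoubleKodairaStructure SmallGroups.G96_214 b n ∧
      ¬ AdmitsDiagonalDoubleKodairaStructure SmallGroups.G96_217 b n ∧
      (AdmitsDiagonalDoubleKodairaStructure SmallGroups.G96_224 b n ↔ b = 2 ∧ n = 2) ∧
      (AdmitsDiagonalDoubleKodairaStructure SmallGroups.G96_225 b n ↔ b = 2 ∧ n = 2)) := by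
  have hcount := ModelGroup.countData_prestructures
  have hcount' := ModelGroup.countData_structures
  obtain ⟨e211⟩ := ModelGroup.nonempty_equiv_211
  obtain ⟨e214⟩ := ModelGroup.nonempty_equiv_214
  obtain ⟨e216⟩ := ModelGroup.nonempty_equiv_216
  obtain ⟨e217⟩ := ModelGroup.nonempty_equiv_217
  obtain ⟨e224⟩ := ModelGroup.nonempty_equiv_224
  obtain ⟨e225⟩ := ModelGroup.nonempty_equiv_225
  refine ⟨fun G _ n hG hmon ⟨S, hS⟩ => ?_, ?_, ?_, ?_, ?_, ?_, ?_, fun b n => ?_⟩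
  · have hz := hS.z_ne_one
    have hn : n = 2 := by
      rw [← hS.order_z]
      exact (hS.conjugacy.exists_normal_card_three hG hmon hz).2.2
    obtain ⟨N, hN, hN3, hNe⟩ := exists_hasExtraSpecialQuotient32 hG hmon hS.conjugacy hz
    refine ⟨hn, N, hNe, fun N' hN' => eq_of_normal_card_three hG hN3 (hN'.card_eq_three hG), ?_⟩
    obtain ⟨⟨x, y, t⟩, ⟨e⟩⟩ := ModelGroup.exists_representative_equiv hG hmon hS.conjugacy hz
    cases x <;> cases y
    -- For `f = 0` the third invariant does not affect the representative, so no distinction on `t`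
    -- is needed.
    · exact Or.inr (Or.inr (Or.inl ⟨⟨e.symm.trans e224⟩, ModelGroup.quotientIsoTo_49 e hN hN3⟩))
    · cases t
      · exact Or.inl ⟨⟨e.symm.trans e211⟩, ModelGroup.quotientIsoTo_49 e hN hN3⟩
      · exact Or.inr (Or.inl ⟨⟨e.symm.trans e216⟩, ModelGroup.quotientIsoTo_49 e hN hN3⟩)
    · exact Or.inr (Or.inr (Or.inr (Or.inr (Or.inr
        ⟨⟨e.symm.trans e225⟩, ModelGroup.quotientIsoTo_50 e hN hN3⟩))))
    · cases t
      · exact Or.inr (Or.inr (Or.inr (Or.inl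
          ⟨⟨e.symm.trans e214⟩, ModelGroup.quotientIsoTo_50 e hN hN3⟩)))
      · exact Or.inr (Or.inr (Or.inr (Or.inr (Or.inl
          ⟨⟨e.symm.trans e217⟩, ModelGroup.quotientIsoTo_50 e hN hN3⟩))))
  · exact ModelGroup.isTableRow_49 (y := true) (t := false) e211
      ((ModelGroup.numberOfPrestructures_of_ramified (x := false) (t := false) e211).trans
        (by rw [hcount.1]))
      (ModelGroup.numberOfStructures_of_ramified (x := false) (t := false) e211)
  · exact ModelGroup.isTableRow_49 (y := true) (t := true) e216
      ((ModelGroup.numberOfPrestructures_of_ramified (x := false) (t := true) e216).trans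
        (by rw [hcount.2.1]))
      (ModelGroup.numberOfStructures_of_ramified (x := false) (t := true) e216)
  · exact ModelGroup.isTableRow_49 (y := false) (t := false) e224
      ((ModelGroup.numberOfPrestructures_of_unramified (x := false) e224).trans
        (by rw [hcount.2.2.2.2.1]))
      ((ModelGroup.numberOfStructures_of_unramified (x := false) e224).trans (by rw [hcount'.1]))
  · exact ModelGroup.isTableRow_50 (y := true) (t := false) e214
      ((ModelGroup.numberOfPrestructures_of_ramified (x := true) (t := false) e214).trans
        (by rw [hcount.2.2.1]))
      (ModelGroup.numberOfStructures_of_ramified (x := true) (t := false) e214)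
  · exact ModelGroup.isTableRow_50 (y := true) (t := true) e217
      ((ModelGroup.numberOfPrestructures_of_ramified (x := true) (t := true) e217).trans
        (by rw [hcount.2.2.2.1]))
      (ModelGroup.numberOfStructures_of_ramified (x := true) (t := true) e217)
  · exact ModelGroup.isTableRow_50 (y := false) (t := false) e225
      ((ModelGroup.numberOfPrestructures_of_unramified (x := true) e225).trans
        (by rw [hcount.2.2.2.2.2]))
      ((ModelGroup.numberOfStructures_of_unramified (x := true) e225).trans (by rw [hcount'.2]))
  · exact ⟨ModelGroup.not_admits_of_ramified (x := false) (t := false) e211 b n,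
      ModelGroup.not_admits_of_ramified (x := false) (t := true) e216 b n,
      ModelGroup.not_admits_of_ramified (x := true) (t := false) e214 b n,
      ModelGroup.not_admits_of_ramified (x := true) (t := true) e217 b n,
      ModelGroup.admits_iff_of_unramified (x := false) e224 b n,
      ModelGroup.admits_iff_of_unramified (x := true) e225 b n⟩
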